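/- Let $n\ge 2$, $1\le m\le n$, let $\Omega\subset\mathbb R^n$ be a domain and $M_0\in\partial\Omega$, and suppose that $\partial\Omega$ is $C^2$-smooth near $M_0$, that is, in some Cartesian coordinates $x=(\tilde x,x^n)$, $\tilde x\in\mathbb R^{n-1}$, with origin at $M_0$ and for some $\rho>0$ and some $C^2$ function $\omega$ on $\{|\tilde x|<\rho\}$ with $\omega(0)=0$, $$\Omega\cap\{|\tilde x|<\rho,\ |x^n|<\rho\}=\{|\tilde x|<\rho,\ |x^n|<\rho,\ x^n>\omega(\tilde x)\}.\qquad(1)$$ Definitions. For a symmetric matrix $S$ let $T_p(S)$ be the sum of its principal minors of order $p$ ($T_0=1$); $S$ is $k$-positive if $T_p(S)>0$ for $p=0,\dots,k$. The boundary $\partial\Omega$ is $k$-convex at $M_0$ if its curvature matrix at $M_0$ with respect to the interior unit normal $\mathbf n$ is $k$-positive; the curvature matrix is $\tau^T\big((X_{\theta^k\theta^l},\mathbf n)\big)_{k,l}\,\tau$, where $X(\theta)$ is a regular local $C^2$ parametrization of $\partial\Omega$ and $\tau\tau^T=g^{-1}$, $g=X_\theta^TX_\theta$ (equivalently, $\sigma_p(\kappa_1,\dots,\kappa_{n-1})>0$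 for $p\le k$, where $\kappa_i$ are the principal curvatures of $\partial\Omega$ at $M_0$). For a neighbourhood $V$ of $M_0$, a domain $D$ is attached to $\partial\Omega\cap V$ if $D\subset\Omega\cap V$ and $\partial D\cap\partial\Omega=\partial\Omega\cap V$. An $m$-Hessian kernel of local sub-barriers at $M_0$ in such a domain $D$ is a function $W\in C^2(\overline D)$ whose Hessian matrix is $m$-positive at every point of $\overline D$ and for which $$W(M_0)=0,\qquad W|_{\partial D}\le 0,\qquad W|_{\partial D\cap\Omega}\le -1.$$ Theorem. (i) If $\partial\Omega$ is $(m-1)$-convex at $M_0$, then an $m$-Hessian kernel of local sub-barriers at $M_0$ exists; more precisely, for all sufficiently small $r>0$ there is one in some domain attached to $\partial\Omega\cap\overline{B_r(M_0)}$. (ii) If $\partial\Omega$ is $(m-1)$-convex at $M_0$, a kernel is given explicitly: for any coordinates, $\omega$ and $\rho$ as in (1) there are $r_0>0$ and $\beta_1>0$ such that for all $0<r\le r_0$ and $0<\beta\le\beta_1$, with $$y=x^n-\omega(\tilde x)+\tfrac{\beta}{2}|\tilde x|^2,$$ the function $$W=\tfrac83W^\beta,\qquad W^\beta=\frac{y}{\beta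 r^2}\Big(\frac{y}{2\beta r^2}-1\Big),$$ is an $m$-Hessian kernel of local sub-barriers at $M_0$ in the domain $$\Omega_r^\beta=\Big\{x\in\Omega:\ \tfrac{\beta}{2}|\tilde x|^2<y(x)<\tfrac{\beta}{2}r^2\Big\},$$ which is attached to $\partial\Omega\cap\{|\tilde x|\le r,\ |x^n|<\rho\}$. (iii) There exists an $m$-Hessian kernel of local sub-barriers at $M_0$ (in some domain attached to $\partial\Omega\cap V$, for some bounded neighbourhood $V$ of $M_0$) if and only if $\partial\Omega$ is $(m-1)$-convex at $M_0$. -/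

import Mathlib

open Set Metric Topology
open scoped Matrix

noncomputable section

namespace HessianKernel

/-- Euclidean space `ℝⁿ`. -/
abbrev E (n : ℕ) : Type := EuclideanSpace ℝ (Fin n)

/-! ### Traces of order `p` and `m`-positive matrices -/

/-- The `p`-trace `T_p(S)`: the sum of all principal minors of order `p` of `S`
(so `T_0(S) = 1`). -/
def pTrace {n : ℕ} (p : ℕ) (S : Matrix (Fin n) (Fin n) ℝ) : ℝ :=
  ∑ s ∈ (Finset.univ : Finset (Fin n)).powersetCard p,
    (S.submatrix (fun i : s => (i : Fin n)) (fun i : s => (i : Fin n))).det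

/-- `S` is an `m`-positive matrix: `S` is symmetric and `T_p(S) > 0` for `p = 0, 1, …, m`. -/
def IsMPositive {n : ℕ} (m : ℕ) (S : Matrix (Fin n) (Fin n) ℝ) : Prop :=
  S.IsSymm ∧ ∀ p, p ≤ m → 0 < pTrace p S

/-! ### `m`-admissible functions -/

/-- `u ∈ C²(closure D)` for an open set `D`, and `H` is its Hessian matrix on `closure D`:
`u` is twice continuously differentiable in `D`, and `u`, its gradient and its Hessian
matrix extend continuously to `closure D`. -/
def IsC2UpToBoundary {n : ℕ} (D : Set (E n)) (u : E n → ℝ)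
    (H : E n → Matrix (Fin n) (Fin n) ℝ) : Prop :=
  ∃ G : E n → E n,
    ContinuousOn u (closure D) ∧ ContinuousOn G (closure D) ∧ ContinuousOn H (closure D) ∧
    ∀ x ∈ D, HasGradientAt u (G x) x ∧
      HasFDerivAt G (Matrix.toEuclideanCLM (n := Fin n) (𝕜 := ℝ) (H x)) x

/-- `u` is `m`-admissible in `closure D`: it is of class `C²(closure D)`, and its Hessian matrix
is `m`-positive at every point of `closure D`. -/
def IsMAdmissible {n : ℕ} (m : ℕ) (D : Set (E n)) (u : E n → ℝ) : Prop :=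
  ∃ H : E n → Matrix (Fin n) (Fin n) ℝ,
    IsC2UpToBoundary D u H ∧ ∀ x ∈ closure D, IsMPositive m (H x)

/-! ### Hypersurfaces, curvature matrices, convexity -/

/-- `X : Θ → Γ` is a local `C²` parametrization of the hypersurface `Γ ⊆ ℝ^{d+1}` near the point
`M₀ = X θ₀`: `Θ` is an open set of parameters, `X` is `C²` with non-degenerate Jacobian matrix, and
`X` is a homeomorphism of `Θ` onto a neighbourhood of `M₀` in `Γ`. -/
structure IsLocalParam {d : ℕ} (Γ : Set (E (d + 1))) (M₀ : E (d + 1)) (X : E d → E (d + 1))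
    (Θ : Set (E d)) (θ₀ : E d) : Prop where
  isOpen : IsOpen Θ
  mem : θ₀ ∈ Θ
  apply_eq : X θ₀ = M₀
  contDiffOn : ContDiffOn ℝ 2 X Θ
  injective : ∀ θ ∈ Θ, Function.Injective (fderiv ℝ X θ)
  isEmbedding : IsEmbedding (Θ.domRestrict X)
  image : ∃ U : Set (E (d + 1)), IsOpen U ∧ M₀ ∈ U ∧ X '' Θ = Γ ∩ U

/-- The tangent vector `X_k = ∂X/∂θ^k`. -/
def tangentVec {d : ℕ} (X : E d → E (d + 1)) (k : Fin d) (θ : E d) : E (d + 1) :=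
  fderiv ℝ X θ (EuclideanSpace.single k 1)

/-- The metric tensor `g = X_θᵀ X_θ`, i.e. `g_{kl} = (X_k, X_l)`. -/
def metricTensor {d : ℕ} (X : E d → E (d + 1)) (θ : E d) : Matrix (Fin d) (Fin d) ℝ :=
  Matrix.of fun k l => inner ℝ (tangentVec X k θ) (tangentVec X l θ)

/-- The matrix `((X_{kl}, ν))` of the second quadratic form, `X_{kl} = ∂²X/∂θ^k∂θ^l`. -/
def secondForm {d : ℕ} (X : E d → E (d + 1)) (θ : E d) (ν : E (d + 1)) :
    Matrix (Fin d) (Fin d) ℝ :=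
  Matrix.of fun k l => inner ℝ (fderiv ℝ (tangentVec X k) θ (EuclideanSpace.single l 1)) ν

/-- The curvature matrix `𝒦 = τᵀ (X_{θθ}, ν) τ`, where `τ τᵀ = g⁻¹` and `ν` is the unit normal
that orients the hypersurface. -/
def curvatureMatrix {d : ℕ} (X : E d → E (d + 1)) (θ : E d) (ν : E (d + 1))
    (τ : Matrix (Fin d) (Fin d) ℝ) : Matrix (Fin d) (Fin d) ℝ :=
  τᵀ * secondForm X θ ν * τ

/-- `ν` is the interior unit normal to `∂Ω` at `M₀ = X θ₀`, for a local parametrization `X` of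
`∂Ω` near `M₀`. -/
structure IsInteriorNormal {d : ℕ} (Ω : Set (E (d + 1))) (M₀ : E (d + 1)) (X : E d → E (d + 1))
    (θ₀ : E d) (ν : E (d + 1)) : Prop where
  norm_eq : ‖ν‖ = 1
  normal : ∀ k, inner ℝ (tangentVec X k θ₀) ν = 0
  interior : ∃ t₀ : ℝ, 0 < t₀ ∧ ∀ t : ℝ, 0 < t → t < t₀ → M₀ + t • ν ∈ Ω

/-- `∂Ω`, oriented by the interior normal, is `k`-convex at `M₀`: its curvature matrix at `M₀` is
`k`-positive. (Neither the parametrization nor the choice of `τ` matters: two curvature matrices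
at `M₀` are conjugate by an orthogonal matrix, and `k`-traces are orthogonally invariant.) -/
def IsBoundaryConvexAt {d : ℕ} (k : ℕ) (Ω : Set (E (d + 1))) (M₀ : E (d + 1)) : Prop :=
  ∃ (X : E d → E (d + 1)) (Θ : Set (E d)) (θ₀ : E d) (ν : E (d + 1))
    (τ : Matrix (Fin d) (Fin d) ℝ),
    IsLocalParam (frontier Ω) M₀ X Θ θ₀ ∧ IsInteriorNormal Ω M₀ X θ₀ ν ∧
    τ * τᵀ = (metricTensor X θ₀)⁻¹ ∧ IsMPositive k (curvatureMatrix X θ₀ ν τ)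

/-! ### Cartesian coordinates and local graphs -/

/-- The first `d` coordinates `x̃ = (x¹, …, x^{n-1})` of `x ∈ ℝⁿ`, `n = d + 1`. -/
def tilde {d : ℕ} (x : E (d + 1)) : E d := WithLp.toLp 2 fun i => x i.castSucc

/-- The last coordinate `xⁿ` of `x ∈ ℝⁿ`, `n = d + 1`. -/
def lastCoord {d : ℕ} (x : E (d + 1)) : ℝ := x (Fin.last d)

/-- In the Cartesian coordinates `Φ` with origin `M₀`, the set `Ω` is, inside the cylinder
`|x̃| < ρ`, `|xⁿ| < ρ`, the region `xⁿ > ω(x̃)` above the graph of a `C²` function `ω` with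
`ω(0) = 0`. -/
structure IsLocalGraph {d : ℕ} (Ω : Set (E (d + 1))) (M₀ : E (d + 1))
    (Φ : E (d + 1) ≃ᵃⁱ[ℝ] E (d + 1)) (ω : E d → ℝ) (ρ : ℝ) : Prop where
  pos : 0 < ρ
  origin : Φ M₀ = 0
  zero : ω 0 = 0
  contDiffOn : ContDiffOn ℝ 2 ω (ball 0 ρ)
  mem_iff : ∀ x, ‖tilde (Φ x)‖ < ρ → |lastCoord (Φ x)| < ρ → (x ∈ Ω ↔ ω (tilde (Φ x)) < lastCoord (Φ x))

/-- `∂Ω` is `C²`-smooth in some vicinity of `M₀`. -/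
def IsC2BoundaryNear {d : ℕ} (Ω : Set (E (d + 1))) (M₀ : E (d + 1)) : Prop :=
  ∃ (Φ : E (d + 1) ≃ᵃⁱ[ℝ] E (d + 1)) (ω : E d → ℝ) (ρ : ℝ), IsLocalGraph Ω M₀ Φ ω ρ

/-! ### Kernels of local sub-barriers -/

/-- `D` is a subdomain of `Ω` attached to the piece `∂Ω ∩ V` of the boundary of `Ω`; in the
applications `V` is a small neighbourhood of a boundary point, such as a closed ball. -/
structure IsAttachedSubdomain {d : ℕ} (Ω V D : Set (E (d + 1))) : Prop where
  isOpen : IsOpen D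
  isConnected : IsConnected D
  subset : D ⊆ Ω ∩ V
  frontier_inter : frontier D ∩ frontier Ω = frontier Ω ∩ V

/-- `W` is an `m`-Hessian kernel of local sub-barriers at `M₀ ∈ ∂Ω`, in the subdomain `D` of `Ω`
attached to `∂Ω ∩ V`. -/
structure IsKernel {d : ℕ} (m : ℕ) (Ω : Set (E (d + 1))) (M₀ : E (d + 1))
    (V D : Set (E (d + 1))) (W : E (d + 1) → ℝ) : Prop where
  attached : IsAttachedSubdomain Ω V D
  admissible : IsMAdmissible m D W
  apply_eq_zero : W M₀ = 0
  le_zero : ∀ x ∈ frontier D, W x ≤ 0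
  le_neg_one : ∀ x ∈ frontier D ∩ Ω, W x ≤ -1

/-- There exists an `m`-Hessian kernel of local sub-barriers at `M₀`, in a subdomain attached to
`∂Ω ∩ V` for some bounded neighbourhood `V` of `M₀`. -/
def HasKernel {d : ℕ} (m : ℕ) (Ω : Set (E (d + 1))) (M₀ : E (d + 1)) : Prop :=
  ∃ V ∈ 𝓝 M₀, Bornology.IsBounded V ∧ ∃ (D : Set (E (d + 1))) (W : E (d + 1) → ℝ),
    IsKernel m Ω M₀ V D W

/-! ### The explicit kernel -/

/-- The function `y = xⁿ - ω(x̃) + (β/2) |x̃|²`, in the coordinates `Φ`. -/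
def yFun {d : ℕ} (Φ : E (d + 1) ≃ᵃⁱ[ℝ] E (d + 1)) (ω : E d → ℝ) (β : ℝ) (x : E (d + 1)) : ℝ :=
  lastCoord (Φ x) - ω (tilde (Φ x)) + β / 2 * ‖tilde (Φ x)‖ ^ 2

/-- The domain `{x ∈ Ω : (β/2) |x̃|² < y(x) < (β/2) r²}`. -/
def subdomain {d : ℕ} (Ω : Set (E (d + 1))) (Φ : E (d + 1) ≃ᵃⁱ[ℝ] E (d + 1)) (ω : E d → ℝ)
    (r β : ℝ) : Set (E (d + 1)) :=
  {x | x ∈ Ω ∧ β / 2 * ‖tilde (Φ x)‖ ^ 2 < yFun Φ ω β x ∧ yFun Φ ω β x < β / 2 * r ^ 2}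

/-- The function `W^β = (y / (β r²)) (y / (2 β r²) - 1)`. -/
def wBeta {d : ℕ} (Φ : E (d + 1) ≃ᵃⁱ[ℝ] E (d + 1)) (ω : E d → ℝ) (r β : ℝ) (x : E (d + 1)) : ℝ :=
  yFun Φ ω β x / (β * r ^ 2) * (yFun Φ ω β x / (2 * β * r ^ 2) - 1)

/-- The cylinder `|x̃| ≤ r`, `|xⁿ| < h`, in the coordinates `Φ`. -/
def cylinder {d : ℕ} (Φ : E (d + 1) ≃ᵃⁱ[ℝ] E (d + 1)) (r h : ℝ) : Set (E (d + 1)) :=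
  {x | ‖tilde (Φ x)‖ ≤ r ∧ |lastCoord (Φ x)| < h}

end HessianKernel

end

open HessianKernel

/-! In coordinates where the boundary is the graph of ω, let A be the Hessian of x ↦ ω(x̃) at the
origin, as a matrix of full size d + 1, and let p = (-∇ω(0), 1) be the gradient of the height xⁿ -
ω(x̃). Both directions pass through one quantity: the derivative `dirTrace q A p` of T_{q+1} at A in
the direction ppᵀ. If the columns of Q are an orthonormal basis of the tangent space, it equals |p|²
T_q(QᵀAQ), and the curvature matrix is a positive multiple of QᵀAQ. So (m-1)-convexity means `0 <
dirTrace q A p` for all q < m (`IsStdGraph.isBoundaryConvexAt_iff`), with no need to normalize ∇ω(0)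
= 0.

Sufficiency. Let y be the height plus (β/2)⟨x, Jx⟩, with gradient g. The Hessian of a(Sy²/2 - y) is
a(1 - Sy) times D²ω - βJ + S/(1 - Sy) ggᵀ. Traces are affine along rank-one directions, T_{q+1}(A +
S ggᵀ) = T_{q+1}(A) + S `dirTrace q A g`, so positive slopes and a large S make every trace up to
order m positive, near the origin and for small β (`IsStdGraph.exists_isMAdmissible`). Taking J to
be the form |x̃|² and S = 1/(βr²) gives the explicit kernel. Taking J = 1 with S fixed gives a
kernel on Ω ∩ B_r, which is connected because it is star-shaped.

Necessity. The domain of a kernel W fills Ω near M₀, and W ≤ 0 there by the maximum principle, with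
W(M₀) = 0. Hence the derivative of W into Ω at M₀ is some -μ ≤ 0, and the second derivative test
along boundary curves gives D²W ≤ μA on the tangent space (`IsStdGraph.exists_hessian_le`). The
tangential block of the m-positive matrix D²W is (m-1)-positive, and adding a positive semidefinite
matrix preserves this, so μQᵀAQ is (m-1)-positive, and so is QᵀAQ.

The algebra behind the last step is the positivity of `dirTrace` on m-positive matrices
(`IsMPositive.dirTrace_pos`). Diagonalization reduces it to deleting one factor from ∏(1 + λ_j t),
and Newton's inequalities for real-rooted polynomials settle that. -/

namespace HessianKernel

/-! ### Real-rooted polynomials and Newton's inequalities -/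

section RealRooted

open Polynomial

/-- Rolle, with multiplicities: the derivative has at least deg R - 1 roots, which is as many as its
degree allows. -/
theorem splits_derivative {R : ℝ[X]} (hR : R.Splits) : R.derivative.Splits := by
  rw [splits_iff_card_roots] at *
  have h1 := card_roots_le_derivative R
  have h2 := R.derivative.card_roots'
  have h3 := natDegree_derivative_le R
  by_cases h : R.natDegree = 0
  · rw [natDegree_eq_zero.1 h |>.choose_spec.symm]; simp
  · omega

theorem splits_iterate_derivative {R : ℝ[X]} (hR : R.Splits) (k : ℕ) :
    (derivative^[k] R).Splits := by
  induction k with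
  | zero => exact hR
  | succ k ih => rw [Function.iterate_succ_apply']; exact splits_derivative ih

/-- Laguerre's inequality for real-rooted polynomials. -/
theorem eval_mul_eval_derivative_derivative_le {R : ℝ[X]} (hR : R.Splits) (t : ℝ) :
    R.eval t * (derivative (derivative R)).eval t ≤ (derivative R).eval t ^ 2 := by
  obtain ⟨s, hs⟩ := splits_iff_exists_multiset.1 hR
  have key : ∀ s : Multiset ℝ, ∀ Q : ℝ[X], Q = (s.map (X - C ·)).prod →
      Q.eval t * (derivative (derivative Q)).eval t ≤ (derivative Q).eval t ^ 2 := by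
    intro s
    induction s using Multiset.induction with
    | empty => rintro Q rfl; simp
    | cons a s ih =>
      rintro Q rfl
      have := ih _ rfl
      set P := (s.map (X - C ·)).prod
      simp only [Multiset.map_cons, Multiset.prod_cons, derivative_mul, derivative_sub,
        derivative_X, derivative_C, sub_zero, one_mul, derivative_add, eval_add, eval_mul,
        eval_sub, eval_X, eval_C]
      nlinarith [sq_nonneg (P.eval t), mul_le_mul_of_nonneg_left this (sq_nonneg (t - a))]
  rw [hs]
  have := key s _ rfl
  simp only [derivative_mul, derivative_C, zero_mul, zero_add, eval_mul, eval_C]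
  nlinarith [mul_le_mul_of_nonneg_left this (sq_nonneg R.leadingCoeff)]

/-- The weak form of Newton's inequalities for real-rooted polynomials. -/
theorem coeff_mul_coeff_le {R : ℝ[X]} (hR : R.Splits) (p : ℕ) :
    R.coeff p * R.coeff (p + 2) ≤ R.coeff (p + 1) ^ 2 := by
  rcases le_or_gt (R.coeff p * R.coeff (p + 2)) 0 with h | h
  · exact h.trans (sq_nonneg _)
  -- Laguerre's inequality at 0 for the p-th derivative, whose first Taylor data are p! a_p, (p+1)!
  -- a_{p+1}, (p+2)! a_{p+2}. It yields (p+2) a_p a_{p+2} ≤ (p+1) a_{p+1}²; since the product is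
  -- positive in this case, p+2 may be lowered to p+1.
  have := eval_mul_eval_derivative_derivative_le (splits_iterate_derivative hR p) 0
  simp only [← Function.iterate_succ_apply' derivative, ← coeff_zero_eq_eval_zero,
    coeff_iterate_derivative, zero_add, Nat.descFactorial_self, nsmul_eq_mul,
    Nat.succ_eq_add_one] at this
  have e2 : p + 1 + 1 = p + 2 := rfl
  rw [e2, Nat.factorial_succ (p + 1), Nat.factorial_succ p] at this
  push_cast at this
  have hf : (0 : ℝ) < (p.factorial : ℝ) ^ 2 := by positivity
  have hp : (0 : ℝ) ≤ p := by positivity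
  have h1 : (p.factorial : ℝ) ^ 2 * ((p + 1) * ((p + 2) * (R.coeff p * R.coeff (p + 2))))
      ≤ (p.factorial : ℝ) ^ 2 * ((p + 1) * ((p + 1) * R.coeff (p + 1) ^ 2)) := by
    nlinarith [this]
  have h2 := le_of_mul_le_mul_left (le_of_mul_le_mul_left h1 hf) (by positivity)
  have h3 : (p + 1) * (R.coeff p * R.coeff (p + 2)) ≤ (p + 1) * R.coeff (p + 1) ^ 2 := by
    nlinarith
  exact le_of_mul_le_mul_left h3 (by positivity)

/-- Removing a linear factor from a real-rooted polynomial keeps all but the last of its leading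
run of positive coefficients. -/
theorem coeff_pos_of_linear_mul {Q : ℝ[X]} (hQ : Q.Splits) (h0 : Q.coeff 0 = 1) (c : ℝ) {m : ℕ}
    (h : ∀ p ≤ m, 0 < ((1 + C c * X) * Q).coeff p) : ∀ p, p + 1 ≤ m → 0 < Q.coeff p := by
  intro p
  have hc : ∀ p, ((1 + C c * X) * Q).coeff (p + 1) = Q.coeff (p + 1) + c * Q.coeff p := by
    intro p
    rw [add_mul, one_mul, mul_assoc, coeff_add, coeff_C_mul, coeff_X_mul]
  induction p with
  | zero => intro _; rw [h0]; norm_num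
  | succ p ih =>
    intro hp
    have hpos := ih (by omega)
    have h1 := h (p + 1) (by omega)
    have h2 := h (p + 1 + 1) hp
    rw [hc] at h1 h2
    -- If b ≤ 0, then b + ca > 0 gives -cab ≥ b², while e + cb > 0 and a > 0 give ae > -cab.
    -- Together ae > b², against Newton.
    have h3 := coeff_mul_coeff_le hQ p
    by_contra! hneg
    have e2 : p + 1 + 1 = p + 2 := rfl
    rw [e2] at h2
    set a := Q.coeff p
    set b := Q.coeff (p + 1)
    set e := Q.coeff (p + 2)
    nlinarith [mul_pos hpos h2, mul_nonneg h1.le (neg_nonneg.2 hneg)]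

end RealRooted

/-! ### Traces under rank-one perturbations -/

section RankOne

open Polynomial

/-- The matrix determinant lemma in adjugate form. It is needed for the polynomial matrix 1 + tS,
which is invertible only over the fraction field, so the identity is proved there and pulled back.
-/
theorem det_add_vecMulVec {R ι : Type*} [CommRing R] [IsDomain R] [Fintype ι] [DecidableEq ι]
    {A : Matrix ι ι R} (hA : A.det ≠ 0) (u v : ι → R) :
    (A + Matrix.vecMulVec u v).det = A.det + v ⬝ᵥ A.adjugate *ᵥ u := by
  have hfield : ∀ {K : Type _} [Field K] (B : Matrix ι ι K) (hB : B.det ≠ 0) (u v : ι → K),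
      (B + Matrix.vecMulVec u v).det = B.det + v ⬝ᵥ B.adjugate *ᵥ u := by
    intro K _ B hB u v
    rw [Matrix.vecMulVec_eq Unit,
      Matrix.det_add_replicateCol_mul_replicateRow (ι := Unit) (isUnit_iff_ne_zero.2 hB),
      Matrix.det_unique (n := Unit), Matrix.add_apply, Matrix.one_apply_eq, mul_add, mul_one, Matrix.inv_def,
      Ring.inverse_eq_inv', Matrix.mul_smul, Matrix.smul_mul, Matrix.smul_apply, smul_eq_mul,
      mul_inv_cancel_left₀ hB, Matrix.mul_assoc]
    rfl
  let f := algebraMap R (FractionRing R)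
  have hf : Function.Injective f := IsFractionRing.injective R (FractionRing R)
  apply hf
  have h := hfield (A.map f) (by
    rw [← RingHom.mapMatrix_apply, ← RingHom.map_det]
    exact fun h => hA (hf (by rw [h, map_zero]))) (f ∘ u) (f ∘ v)
  have hadd : A.map f + Matrix.vecMulVec (f ∘ u) (f ∘ v) = (A + Matrix.vecMulVec u v).map f := by
    ext i j; simp [Matrix.vecMulVec_apply]
  rw [hadd, ← RingHom.mapMatrix_apply, ← RingHom.mapMatrix_apply, ← RingHom.map_det,
    ← RingHom.map_det, ← RingHom.map_adjugate, RingHom.mapMatrix_apply] at h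
  rw [h, map_add, RingHom.map_dotProduct]
  congr 2
  ext i
  rw [Function.comp_apply, RingHom.map_mulVec]

variable {n : ℕ}

/-- The matrix `1 + tS` over the polynomials in `t`. -/
noncomputable def onePlus (S : Matrix (Fin n) (Fin n) ℝ) : Matrix (Fin n) (Fin n) ℝ[X] :=
  1 + (X : ℝ[X]) • S.map C

theorem pTrace_eq_coeff (p : ℕ) (S : Matrix (Fin n) (Fin n) ℝ) :
    pTrace p S = (onePlus S).det.coeff p :=
  (Matrix.coeff_det_one_add_X_smul_eq_sum_minors S p).symm

theorem pTrace_zero (S : Matrix (Fin n) (Fin n) ℝ) : pTrace 0 S = 1 := by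
  simp [pTrace]

theorem pTrace_one (S : Matrix (Fin n) (Fin n) ℝ) : pTrace 1 S = S.trace := by
  rw [pTrace_eq_coeff, onePlus, Matrix.coeff_det_one_add_X_smul_one]

theorem onePlus_det_ne_zero (S : Matrix (Fin n) (Fin n) ℝ) : (onePlus S).det ≠ 0 := by
  intro h
  have := pTrace_eq_coeff 0 S
  rw [h, pTrace_zero] at this
  simp at this

/-- The derivative of the trace of order `p + 1` at `S` in the direction of `q qᵀ`. -/
noncomputable def dirTrace (p : ℕ) (S : Matrix (Fin n) (Fin n) ℝ) (q : Fin n → ℝ) : ℝ :=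
  ((C ∘ q) ⬝ᵥ (onePlus S).adjugate *ᵥ (C ∘ q)).coeff p

/-- A rank-one change enters a determinant linearly. The factor t in 1 + tS shifts the degree, which
is why the trace of order p + 1 has its slope in the coefficient of order p. -/
theorem pTrace_succ_add_smul (p : ℕ) (S : Matrix (Fin n) (Fin n) ℝ) (q : Fin n → ℝ) (s : ℝ) :
    pTrace (p + 1) (S + s • Matrix.vecMulVec q q) = pTrace (p + 1) S + s * dirTrace p S q := by
  have h : onePlus (S + s • Matrix.vecMulVec q q)
      = onePlus S + Matrix.vecMulVec ((X * C s) • (C ∘ q)) (C ∘ q) := by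
    ext1 i j
    simp [onePlus, Matrix.vecMulVec_apply]
    ring
  rw [pTrace_eq_coeff, h, det_add_vecMulVec (onePlus_det_ne_zero S), Matrix.mulVec_smul,
    dotProduct_smul, coeff_add, ← pTrace_eq_coeff, smul_eq_mul, mul_assoc, coeff_X_mul,
    coeff_C_mul, dirTrace]

theorem dirTrace_eq_sub (p : ℕ) (S : Matrix (Fin n) (Fin n) ℝ) (q : Fin n → ℝ) :
    dirTrace p S q = pTrace (p + 1) (S + Matrix.vecMulVec q q) - pTrace (p + 1) S := by
  have := pTrace_succ_add_smul p S q 1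
  rw [one_smul, one_mul] at this
  linarith

theorem pTrace_conj (p : ℕ) {O : Matrix (Fin n) (Fin n) ℝ} (hO : Oᵀ * O = 1)
    (S : Matrix (Fin n) (Fin n) ℝ) : pTrace p (Oᵀ * S * O) = pTrace p S := by
  have hO' : O * Oᵀ = 1 := mul_eq_one_comm.1 hO
  have h : onePlus (Oᵀ * S * O) = (Oᵀ).map C * onePlus S * O.map C := by
    have h1 : (Oᵀ).map C * (O.map C) = (1 : Matrix (Fin n) (Fin n) ℝ[X]) := by
      rw [← Matrix.map_mul, hO, Matrix.map_one _ C_0 C_1]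
    simp only [onePlus, Matrix.mul_add, Matrix.add_mul, Matrix.mul_one, h1, Matrix.map_mul,
      Matrix.mul_smul, Matrix.smul_mul]
  have h2 : ((Oᵀ).map C).det * (O.map C).det = (1 : ℝ[X]) := by
    rw [← Matrix.det_mul, ← Matrix.map_mul, hO, Matrix.map_one _ C_0 C_1, Matrix.det_one]
  rw [pTrace_eq_coeff, pTrace_eq_coeff, h, Matrix.det_mul, Matrix.det_mul, mul_right_comm, h2,
    one_mul]

/-- The slope is a difference of two traces, and each of them is orthogonally invariant. -/
theorem dirTrace_conj (p : ℕ) {O : Matrix (Fin n) (Fin n) ℝ} (hO : Oᵀ * O = 1)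
    (S : Matrix (Fin n) (Fin n) ℝ) (q : Fin n → ℝ) :
    dirTrace p (Oᵀ * S * O) (Oᵀ *ᵥ q) = dirTrace p S q := by
  have h : Matrix.vecMulVec (Oᵀ *ᵥ q) (Oᵀ *ᵥ q) = Oᵀ * Matrix.vecMulVec q q * O := by
    rw [Matrix.mul_vecMulVec, Matrix.vecMulVec_mul, Matrix.mulVec_transpose]
  rw [dirTrace_eq_sub, dirTrace_eq_sub, h, ← Matrix.add_mul, ← Matrix.mul_add, pTrace_conj _ hO,
    pTrace_conj _ hO]

theorem pTrace_smul (p : ℕ) (c : ℝ) (S : Matrix (Fin n) (Fin n) ℝ) :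
    pTrace p (c • S) = c ^ p * pTrace p S := by
  rw [pTrace, pTrace, Finset.mul_sum]
  refine Finset.sum_congr rfl fun s hs => ?_
  rw [Matrix.submatrix_smul, Pi.smul_apply, Pi.smul_apply, Matrix.det_smul, Fintype.card_coe,
    (Finset.mem_powersetCard.1 hs).2]

theorem continuous_pTrace (p : ℕ) :
    Continuous (pTrace p : Matrix (Fin n) (Fin n) ℝ → ℝ) := by
  unfold pTrace
  exact continuous_finsetSum _ fun s _ => (continuous_id.matrix_submatrix _ _).matrix_det

theorem continuous_dirTrace (p : ℕ) :
    Continuous fun x : Matrix (Fin n) (Fin n) ℝ × (Fin n → ℝ) => dirTrace p x.1 x.2 := by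
  simp only [dirTrace_eq_sub]
  exact ((continuous_pTrace _).comp (continuous_fst.add
    (continuous_snd.matrix_vecMulVec continuous_snd))).sub
    ((continuous_pTrace _).comp continuous_fst)

/-- Along a coordinate axis only one diagonal entry of the adjugate survives: the minor of 1 + tS
without the last row and column. This links slopes to traces of a principal block. -/
theorem dirTrace_last (p : ℕ) (S : Matrix (Fin (n + 1)) (Fin (n + 1)) ℝ) (c : ℝ) :
    dirTrace p S (Pi.single (Fin.last n) c)
      = c ^ 2 * pTrace p (S.submatrix Fin.castSucc Fin.castSucc) := by
  have hq : (C ∘ (Pi.single (Fin.last n) c : Fin (n + 1) → ℝ)) = Pi.single (Fin.last n) (C c) := by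
    ext1 i; by_cases h : i = Fin.last n
    · subst h; simp
    · simp [h]
  have hsub : (onePlus S).submatrix Fin.castSucc Fin.castSucc
      = onePlus (S.submatrix Fin.castSucc Fin.castSucc) := by
    ext1 i j
    simp [onePlus, Matrix.one_apply]
  have hlast : (Fin.last n).succAbove = Fin.castSucc := Fin.succAbove_last
  have hone : (-1 : ℝ[X]) ^ (n + n) = 1 := Even.neg_one_pow ⟨n, rfl⟩
  rw [dirTrace, hq, single_dotProduct, Matrix.mulVec_single, Pi.smul_apply, Matrix.col_apply,
    Matrix.adjugate_fin_succ_eq_det_submatrix, hlast, hsub, Fin.val_last, hone, one_mul,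
    MulOpposite.smul_eq_mul_unop, MulOpposite.unop_op, mul_comm _ (C c), ← mul_assoc, ← C_mul,
    coeff_C_mul, ← pTrace_eq_coeff, sq]

theorem onePlus_diagonal (l : Fin n → ℝ) :
    onePlus (Matrix.diagonal l) = Matrix.diagonal fun i => 1 + C (l i) * X := by
  ext1 i j
  by_cases hij : i = j
  · subst hij
    rw [onePlus, Matrix.add_apply, Matrix.smul_apply, Matrix.map_apply, Matrix.one_apply_eq,
      Matrix.diagonal_apply_eq, Matrix.diagonal_apply_eq, smul_eq_mul, mul_comm]
  · rw [onePlus, Matrix.add_apply, Matrix.smul_apply, Matrix.map_apply, Matrix.one_apply_ne hij,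
      Matrix.diagonal_apply_ne _ hij, Matrix.diagonal_apply_ne _ hij, C_0, smul_zero, add_zero]

theorem dirTrace_diagonal (p : ℕ) (l q : Fin n → ℝ) :
    dirTrace p (Matrix.diagonal l) q
      = ∑ i, q i ^ 2 * (∏ j ∈ Finset.univ.erase i, (1 + C (l j) * X)).coeff p := by
  rw [dirTrace, onePlus_diagonal, Matrix.adjugate_diagonal, dotProduct, finsetSum_coeff]
  refine Finset.sum_congr rfl fun i _ => ?_
  rw [Matrix.mulVec_diagonal, Function.comp_apply, mul_left_comm, ← C_mul, ← sq,
    mul_comm, coeff_C_mul]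

end RankOne

/-! ### Monotonicity of traces on the cone of m-positive matrices -/

section Garding

open Polynomial

variable {n : ℕ}

/-- In an eigenbasis the slope is a sum of squares weighted by coefficients of ∏_{j≠i}(1 + λ_j t).
Each weight is positive because restoring the factor 1 + λ_i t gives a real-rooted polynomial whose
coefficients up to m are the positive traces of S. -/
theorem IsMPositive.dirTrace_pos {m : ℕ} {S : Matrix (Fin n) (Fin n) ℝ} (hS : IsMPositive m S)
    {q : Fin n → ℝ} (hq : q ≠ 0) {p : ℕ} (hp : p + 1 ≤ m) : 0 < dirTrace p S q := by
  have hH : S.IsHermitian := by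
    rw [Matrix.IsHermitian, Matrix.conjTranspose_eq_transpose_of_trivial]; exact hS.1
  set U : Matrix (Fin n) (Fin n) ℝ := (hH.eigenvectorUnitary : Matrix (Fin n) (Fin n) ℝ)
  have hUU : Uᵀ * U = 1 := by
    rw [← Matrix.conjTranspose_eq_transpose_of_trivial, ← Matrix.star_eq_conjTranspose]
    exact Unitary.coe_star_mul_self hH.eigenvectorUnitary
  have hdiag : Uᵀ * S * U = Matrix.diagonal hH.eigenvalues := by
    have := hH.conjStarAlgAut_star_eigenvectorUnitary
    rw [Unitary.conjStarAlgAut_star_apply, Matrix.star_eq_conjTranspose,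
      Matrix.conjTranspose_eq_transpose_of_trivial] at this
    exact this
  have hUq : Uᵀ *ᵥ q ≠ 0 := by
    intro h
    apply hq
    have := congrArg (U *ᵥ ·) h
    simpa [Matrix.mulVec_mulVec, mul_eq_one_comm.1 hUU] using this
  obtain ⟨k, hk⟩ := Function.ne_iff.1 hUq
  rw [← dirTrace_conj p hUU S q, hdiag, dirTrace_diagonal]
  have hpos : ∀ i, 0 < (∏ j ∈ Finset.univ.erase i,
      (1 + C (hH.eigenvalues j) * X)).coeff p := by
    intro i
    refine coeff_pos_of_linear_mul ?_ ?_ (hH.eigenvalues i) (m := m) ?_ p hp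
    · refine Splits.prod fun j _ => Splits.of_natDegree_le_one ?_
      compute_degree
    · rw [coeff_zero_eq_eval_zero, eval_prod]; simp
    · intro r hr
      have h1 := hS.2 r hr
      rw [← pTrace_conj r hUU S, hdiag, pTrace_eq_coeff] at h1
      rw [onePlus_diagonal, Matrix.det_diagonal, ← Finset.mul_prod_erase _ _ (Finset.mem_univ i)] at h1
      exact h1
  refine Finset.sum_pos' (fun i _ => mul_nonneg (sq_nonneg _) (hpos i).le)
    ⟨k, Finset.mem_univ k, mul_pos (sq_pos_of_ne_zero (by simpa using hk)) (hpos k)⟩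

/-- A principal submatrix of an `m`-positive matrix is `(m - 1)`-positive. -/
theorem pTrace_submatrix_pos {m : ℕ} {S : Matrix (Fin (n + 1)) (Fin (n + 1)) ℝ}
    (hS : IsMPositive m S) {p : ℕ} (hp : p + 1 ≤ m) :
    0 < pTrace p (S.submatrix Fin.castSucc Fin.castSucc) := by
  have h := IsMPositive.dirTrace_pos hS (q := Pi.single (Fin.last n) 1) (by simp) hp
  rwa [dirTrace_last, one_pow, one_mul] at h

theorem IsMPositive.conj {m : ℕ} {S O : Matrix (Fin n) (Fin n) ℝ} (hS : IsMPositive m S)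
    (hO : Oᵀ * O = 1) : IsMPositive m (Oᵀ * S * O) := by
  refine ⟨?_, fun p hp => by rw [pTrace_conj p hO]; exact hS.2 p hp⟩
  rw [Matrix.IsSymm, Matrix.transpose_mul, Matrix.transpose_mul, Matrix.transpose_transpose,
    hS.1, Matrix.mul_assoc]

theorem IsMPositive.add_vecMulVec {m : ℕ} {S : Matrix (Fin n) (Fin n) ℝ} (hS : IsMPositive m S)
    (q : Fin n → ℝ) : IsMPositive m (S + Matrix.vecMulVec q q) := by
  refine ⟨?_, fun p hp => ?_⟩
  · rw [Matrix.IsSymm, Matrix.transpose_add, hS.1, Matrix.transpose_vecMulVec]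
  · rcases p with _ | p
    · rw [pTrace_zero]; norm_num
    · by_cases hq : q = 0
      · subst hq; simpa using hS.2 _ hp
      · have := dirTrace_eq_sub p S q
        linarith [IsMPositive.dirTrace_pos hS hq hp, hS.2 _ hp]

/-- A positive semidefinite matrix is a sum of matrices vvᵀ, which can be added one at a time. -/
theorem IsMPositive.add_posSemidef {m : ℕ} {S P : Matrix (Fin n) (Fin n) ℝ}
    (hS : IsMPositive m S) (hP : P.PosSemidef) : IsMPositive m (S + P) := by
  obtain ⟨k, v, rfl⟩ := Matrix.posSemidef_iff_eq_sum_vecMulVec.1 hP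
  have : ∀ s : Finset (Fin k), IsMPositive m (S + ∑ i ∈ s, Matrix.vecMulVec (v i) (v i)) := by
    intro s
    induction s using Finset.induction with
    | empty => simpa using hS
    | insert a s ha ih =>
      rw [Finset.sum_insert ha, add_comm (Matrix.vecMulVec _ _), ← add_assoc]
      exact ih.add_vecMulVec _
  simpa using this Finset.univ

end Garding

/-! ### Invariance under rigid motions -/

section Transport

variable {n d : ℕ}

theorem affineIsometryEquiv_add (Φ : E n ≃ᵃⁱ[ℝ] E n) (x v : E n) :
    Φ (x + v) = Φ x + Φ.linearIsometryEquiv v := by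
  rw [add_comm x v, add_comm (Φ x)]
  exact Φ.map_vadd x v

theorem affineIsometryEquiv_eq (Φ : E n ≃ᵃⁱ[ℝ] E n) :
    (Φ : E n → E n) = fun x => Φ.linearIsometryEquiv.toContinuousLinearEquiv x + Φ 0 := by
  ext1 x
  have := affineIsometryEquiv_add Φ 0 x
  rw [zero_add, add_comm] at this
  exact this

theorem hasFDerivAt_affineIsometryEquiv (Φ : E n ≃ᵃⁱ[ℝ] E n) (x : E n) :
    HasFDerivAt Φ (Φ.linearIsometryEquiv.toContinuousLinearEquiv : E n →L[ℝ] E n) x := by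
  rw [affineIsometryEquiv_eq Φ]
  exact (ContinuousLinearEquiv.hasFDerivAt _).add_const _

theorem contDiff_affineIsometryEquiv (Φ : E n ≃ᵃⁱ[ℝ] E n) : ContDiff ℝ 2 Φ := by
  rw [affineIsometryEquiv_eq Φ]
  exact (ContinuousLinearEquiv.contDiff _).add contDiff_const

theorem exists_orthogonal_matrix (L : E n ≃ₗᵢ[ℝ] E n) :
    ∃ R : Matrix (Fin n) (Fin n) ℝ, Rᵀ * R = 1 ∧
      Matrix.toEuclideanCLM (n := Fin n) (𝕜 := ℝ) R = (L.toContinuousLinearEquiv : E n →L[ℝ] E n) ∧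
      Matrix.toEuclideanCLM (n := Fin n) (𝕜 := ℝ) Rᵀ
        = (L.symm.toContinuousLinearEquiv : E n →L[ℝ] E n) := by
  obtain ⟨R, hR⟩ : ∃ R, Matrix.toEuclideanCLM (n := Fin n) (𝕜 := ℝ) R
      = (L.toContinuousLinearEquiv : E n →L[ℝ] E n) :=
    (Matrix.toEuclideanCLM (n := Fin n) (𝕜 := ℝ)).surjective _
  have hT : Matrix.toEuclideanCLM (n := Fin n) (𝕜 := ℝ) Rᵀ
        = (L.symm.toContinuousLinearEquiv : E n →L[ℝ] E n) := by
    rw [← Matrix.conjTranspose_eq_transpose_of_trivial, ← Matrix.star_eq_conjTranspose, map_star, hR,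
      ContinuousLinearMap.star_eq_adjoint]
    exact LinearIsometryEquiv.adjoint_eq_symm L
  refine ⟨R, ?_, hR, hT⟩
  refine (Matrix.toEuclideanCLM (n := Fin n) (𝕜 := ℝ)).injective
    (?_ : Matrix.toEuclideanCLM (n := Fin n) (𝕜 := ℝ) (Rᵀ * R)
      = Matrix.toEuclideanCLM (n := Fin n) (𝕜 := ℝ) 1)
  rw [map_mul, hT, hR, map_one]
  ext1 x
  exact L.symm_apply_apply x

/-- The Hessian of the composition is RᵀHR with R the orthogonal matrix of the linear part, so its
traces do not change. -/
theorem IsMAdmissible.comp_affineIsometryEquiv {m : ℕ} {D : Set (E n)} {u : E n → ℝ}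
    (h : IsMAdmissible m D u) (Φ : E n ≃ᵃⁱ[ℝ] E n) : IsMAdmissible m (Φ ⁻¹' D) (u ∘ Φ) := by
  obtain ⟨H, ⟨G, hu, hG, hH, hd⟩, hpos⟩ := h
  set L := Φ.linearIsometryEquiv
  obtain ⟨R, hRR, hR, hRT⟩ := exists_orthogonal_matrix L
  have hcl : closure (Φ ⁻¹' D) = Φ ⁻¹' closure D := (Φ.toHomeomorph.preimage_closure D).symm
  have hmaps : MapsTo Φ (closure (Φ ⁻¹' D)) (closure D) := by rw [hcl]; exact fun x hx => hx
  have hc : ContinuousOn Φ (closure (Φ ⁻¹' D)) := Φ.continuous.continuousOn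
  refine ⟨fun x => Rᵀ * H (Φ x) * R, ⟨fun x => L.symm (G (Φ x)), hu.comp hc hmaps,
    L.symm.continuous.comp_continuousOn (hG.comp hc hmaps), ?_, ?_⟩, ?_⟩
  · have hcont : Continuous fun S : Matrix (Fin n) (Fin n) ℝ => Rᵀ * S * R :=
      (continuous_const.matrix_mul continuous_id).matrix_mul continuous_const
    exact hcont.comp_continuousOn (hH.comp hc hmaps)
  · intro x hx
    obtain ⟨h1, h2⟩ := hd (Φ x) hx
    constructor
    · rw [hasGradientAt_iff_hasFDerivAt] at h1 ⊢
      refine (h1.comp x (hasFDerivAt_affineIsometryEquiv Φ x)).congr_fderiv ?_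
      symm
      refine ContinuousLinearMap.ext fun v => ?_
      exact L.symm.inner_map_eq_flip (G (Φ x)) v
    · have h3 := (L.symm.toContinuousLinearEquiv : E n →L[ℝ] E n).hasFDerivAt.comp x
        (h2.comp x (hasFDerivAt_affineIsometryEquiv Φ x))
      rw [map_mul, map_mul, hR, hRT]
      exact h3
  · intro x hx
    exact (hpos _ (hmaps hx)).conj hRR

theorem IsKernel.comp_affineIsometryEquiv {m : ℕ} {Ω V D : Set (E (d + 1))} {M₀ : E (d + 1)}
    {W : E (d + 1) → ℝ} (Φ : E (d + 1) ≃ᵃⁱ[ℝ] E (d + 1)) (h : IsKernel m Ω (Φ M₀) V D W) :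
    IsKernel m (Φ ⁻¹' Ω) M₀ (Φ ⁻¹' V) (Φ ⁻¹' D) (W ∘ Φ) := by
  have hfr : ∀ A : Set (E (d + 1)), frontier (Φ ⁻¹' A) = Φ ⁻¹' frontier A := fun A =>
    (Φ.toHomeomorph.preimage_frontier A).symm
  refine ⟨⟨h.attached.isOpen.preimage Φ.continuous, ?_, ?_, ?_⟩,
    h.admissible.comp_affineIsometryEquiv Φ, h.apply_eq_zero, ?_, ?_⟩
  · exact Φ.toHomeomorph.isConnected_preimage.2 h.attached.isConnected
  · exact fun x hx => h.attached.subset hx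
  · rw [hfr, hfr, ← preimage_inter, h.attached.frontier_inter, preimage_inter]
  · intro x hx
    rw [hfr] at hx
    exact h.le_zero _ hx
  · intro x hx
    rw [hfr] at hx
    exact h.le_neg_one _ hx

theorem HasKernel.comp_affineIsometryEquiv {m : ℕ} {Ω : Set (E (d + 1))} {M₀ : E (d + 1)}
    (Φ : E (d + 1) ≃ᵃⁱ[ℝ] E (d + 1)) (h : HasKernel m Ω (Φ M₀)) :
    HasKernel m (Φ ⁻¹' Ω) M₀ := by
  obtain ⟨V, hV, hb, D, W, hK⟩ := h
  exact ⟨Φ ⁻¹' V, Φ.continuous.continuousAt hV, Φ.antilipschitz.isBounded_preimage hb, _, _,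
    hK.comp_affineIsometryEquiv Φ⟩

/-- Moving the parametrization and the normal by the inverse motion keeps all inner products of
their derivatives, so the same τ and the same curvature matrix serve. -/
theorem IsBoundaryConvexAt.comp_affineIsometryEquiv {k : ℕ} {Ω : Set (E (d + 1))}
    {M₀ : E (d + 1)} (Φ : E (d + 1) ≃ᵃⁱ[ℝ] E (d + 1)) (h : IsBoundaryConvexAt k Ω (Φ M₀)) :
    IsBoundaryConvexAt k (Φ ⁻¹' Ω) M₀ := by
  obtain ⟨X, Θ, θ₀, ν, τ, hX, hν, hτ, hK⟩ := h
  set L := Φ.symm.linearIsometryEquiv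
  have hfr : ∀ A : Set (E (d + 1)), frontier (Φ ⁻¹' A) = Φ ⁻¹' frontier A := fun A =>
    (Φ.toHomeomorph.preimage_frontier A).symm
  have hdiff : ∀ θ ∈ Θ, DifferentiableAt ℝ X θ := fun θ hθ =>
    (hX.contDiffOn.contDiffAt (hX.isOpen.mem_nhds hθ)).differentiableAt (by norm_num)
  have hfd : ∀ θ ∈ Θ, fderiv ℝ (Φ.symm ∘ X) θ
      = (L.toContinuousLinearEquiv : E (d + 1) →L[ℝ] E (d + 1)).comp (fderiv ℝ X θ) := fun θ hθ =>
    ((hasFDerivAt_affineIsometryEquiv Φ.symm (X θ)).comp θ (hdiff θ hθ).hasFDerivAt).fderiv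
  have htan : ∀ k, ∀ θ ∈ Θ, tangentVec (Φ.symm ∘ X) k θ = L (tangentVec X k θ) := by
    intro k θ hθ
    rw [tangentVec, hfd θ hθ]
    rfl
  have hmet : metricTensor (Φ.symm ∘ X) θ₀ = metricTensor X θ₀ := by
    ext1 k l
    simp only [metricTensor, Matrix.of_apply, htan _ _ hX.mem, LinearIsometryEquiv.inner_map_map]
  have hsec : secondForm (Φ.symm ∘ X) θ₀ (L ν) = secondForm X θ₀ ν := by
    ext1 k l
    simp only [secondForm, Matrix.of_apply]
    have h1 : tangentVec (Φ.symm ∘ X) k =ᶠ[𝓝 θ₀] L ∘ tangentVec X k :=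
      Filter.eventuallyEq_of_mem (hX.isOpen.mem_nhds hX.mem) fun θ hθ => htan k θ hθ
    rw [h1.fderiv_eq]
    have h2 : DifferentiableAt ℝ (tangentVec X k) θ₀ := by
      have := (hX.contDiffOn.contDiffAt (hX.isOpen.mem_nhds hX.mem)).fderiv_right
        (m := 1) (by norm_num)
      exact (this.differentiableAt (by norm_num)).clm_apply (differentiableAt_const _)
    have h3 := (L.toContinuousLinearEquiv : E (d + 1) →L[ℝ] E (d + 1)).hasFDerivAt.comp θ₀
      h2.hasFDerivAt
    have h4 : fderiv ℝ (L ∘ tangentVec X k) θ₀ = _ := h3.fderiv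
    rw [h4]
    exact L.inner_map_map _ _
  refine ⟨Φ.symm ∘ X, Θ, θ₀, L ν, τ, ⟨hX.isOpen, hX.mem, ?_, ?_, ?_, ?_, ?_⟩, ⟨?_, ?_, ?_⟩, ?_, ?_⟩
  · simp [hX.apply_eq]
  · exact (contDiff_affineIsometryEquiv Φ.symm).comp_contDiffOn hX.contDiffOn
  · intro θ hθ
    rw [hfd θ hθ]
    exact L.injective.comp (hX.injective θ hθ)
  · exact Φ.symm.toHomeomorph.isEmbedding.comp hX.isEmbedding
  · obtain ⟨U, hU, hM, hXU⟩ := hX.image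
    refine ⟨Φ ⁻¹' U, hU.preimage Φ.continuous, hM, ?_⟩
    rw [image_comp, hXU, hfr, ← preimage_inter]
    exact Φ.symm.toEquiv.image_eq_preimage_symm _
  · rw [L.norm_map, hν.norm_eq]
  · intro k
    rw [htan _ _ hX.mem, L.inner_map_map, hν.normal]
  · obtain ⟨t₀, ht₀, ht⟩ := hν.interior
    refine ⟨t₀, ht₀, fun t h0 h1 => ?_⟩
    have := ht t h0 h1
    rw [mem_preimage]
    convert this using 1
    rw [affineIsometryEquiv_add, map_smul]
    congr 2
    exact Φ.linearIsometryEquiv.apply_symm_apply ν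
  · rw [hmet, hτ]
  · rw [curvatureMatrix, hsec]
    exact hK

end Transport

/-! ### Orthonormal frames adapted to a normal direction -/

section Frame

variable {d : ℕ}

/-- The square matrix with the columns of `Q` followed by the column `ν`. -/
def frameMatrix (Q : Matrix (Fin (d + 1)) (Fin d) ℝ) (ν : Fin (d + 1) → ℝ) :
    Matrix (Fin (d + 1)) (Fin (d + 1)) ℝ :=
  Matrix.of fun i j => Fin.lastCases (motive := fun _ => ℝ) (ν i) (fun k => Q i k) j

theorem frameMatrix_castSucc (Q : Matrix (Fin (d + 1)) (Fin d) ℝ) (ν : Fin (d + 1) → ℝ)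
    (i : Fin (d + 1)) (k : Fin d) : frameMatrix Q ν i k.castSucc = Q i k := by
  simp [frameMatrix]

theorem frameMatrix_last (Q : Matrix (Fin (d + 1)) (Fin d) ℝ) (ν : Fin (d + 1) → ℝ)
    (i : Fin (d + 1)) : frameMatrix Q ν i (Fin.last d) = ν i := by
  simp [frameMatrix]

theorem frameMatrix_orthogonal {Q : Matrix (Fin (d + 1)) (Fin d) ℝ} {ν : Fin (d + 1) → ℝ}
    (hQ : Qᵀ * Q = 1) (hν : ν ⬝ᵥ ν = 1) (hQν : Qᵀ *ᵥ ν = 0) :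
    (frameMatrix Q ν)ᵀ * frameMatrix Q ν = 1 := by
  ext1 i j
  induction i using Fin.lastCases with
  | last =>
    induction j using Fin.lastCases with
    | last =>
      simp only [Matrix.mul_apply, Matrix.transpose_apply, frameMatrix_last, Matrix.one_apply_eq]
      exact hν
    | cast l =>
      have h := congrFun hQν l
      simp only [Matrix.mul_apply, Matrix.transpose_apply, frameMatrix_last, frameMatrix_castSucc]
      rw [Matrix.one_apply_ne (Fin.castSucc_lt_last l).ne']
      simpa only [Matrix.mulVec, dotProduct, Matrix.transpose_apply, mul_comm, Pi.zero_apply]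
        using h
  | cast k =>
    induction j using Fin.lastCases with
    | last =>
      have h := congrFun hQν k
      simp only [Matrix.mul_apply, Matrix.transpose_apply, frameMatrix_last, frameMatrix_castSucc]
      rw [Matrix.one_apply_ne (Fin.castSucc_lt_last k).ne]
      exact h
    | cast l =>
      have h := congrFun (congrFun hQ k) l
      simp only [Matrix.mul_apply, Matrix.transpose_apply, frameMatrix_castSucc] at h ⊢
      rw [h, Matrix.one_apply, Matrix.one_apply]
      simp

theorem frameMatrix_conj_submatrix (Q : Matrix (Fin (d + 1)) (Fin d) ℝ) (ν : Fin (d + 1) → ℝ)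
    (S : Matrix (Fin (d + 1)) (Fin (d + 1)) ℝ) :
    ((frameMatrix Q ν)ᵀ * S * frameMatrix Q ν).submatrix Fin.castSucc Fin.castSucc
      = Qᵀ * S * Q := by
  ext1 k l
  simp only [Matrix.submatrix_apply, Matrix.mul_apply, Matrix.transpose_apply,
    frameMatrix_castSucc]

theorem frameMatrix_transpose_mulVec {Q : Matrix (Fin (d + 1)) (Fin d) ℝ} {ν : Fin (d + 1) → ℝ}
    {p : Fin (d + 1) → ℝ} (hQp : Qᵀ *ᵥ p = 0) :
    (frameMatrix Q ν)ᵀ *ᵥ p = Pi.single (Fin.last d) (ν ⬝ᵥ p) := by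
  ext1 j
  induction j using Fin.lastCases with
  | last =>
    simp only [Matrix.mulVec, dotProduct, Matrix.transpose_apply, frameMatrix_last,
      Pi.single_eq_same]
  | cast k =>
    have h := congrFun hQp k
    rw [Pi.single_eq_of_ne (Fin.castSucc_lt_last k).ne]
    simpa only [Matrix.mulVec, dotProduct, Matrix.transpose_apply, frameMatrix_castSucc,
      Pi.zero_apply] using h

/-- Rotating by the frame (Q, ν) turns p into a multiple of the last basis vector and QᵀSQ into the
principal block that omits it. -/
theorem dirTrace_eq_of_frame {Q : Matrix (Fin (d + 1)) (Fin d) ℝ} {ν p : Fin (d + 1) → ℝ}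
    (hQ : Qᵀ * Q = 1) (hν : ν ⬝ᵥ ν = 1) (hQν : Qᵀ *ᵥ ν = 0) (hQp : Qᵀ *ᵥ p = 0)
    (S : Matrix (Fin (d + 1)) (Fin (d + 1)) ℝ) (q : ℕ) :
    dirTrace q S p = (ν ⬝ᵥ p) ^ 2 * pTrace q (Qᵀ * S * Q) := by
  rw [← dirTrace_conj q (frameMatrix_orthogonal hQ hν hQν) S p, frameMatrix_transpose_mulVec hQp,
    dirTrace_last, frameMatrix_conj_submatrix]

/-- Restriction to a hyperplane is a principal block after rotation; it costs one order of
positivity, the source of m - 1 in the theorem. -/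
theorem IsMPositive.pTrace_frame_pos {m : ℕ} {S : Matrix (Fin (d + 1)) (Fin (d + 1)) ℝ}
    (hS : IsMPositive m S) {Q : Matrix (Fin (d + 1)) (Fin d) ℝ} {ν : Fin (d + 1) → ℝ}
    (hQ : Qᵀ * Q = 1) (hν : ν ⬝ᵥ ν = 1) (hQν : Qᵀ *ᵥ ν = 0) {q : ℕ} (hq : q + 1 ≤ m) :
    0 < pTrace q (Qᵀ * S * Q) := by
  rw [← frameMatrix_conj_submatrix Q ν]
  exact pTrace_submatrix_pos (hS.conj (frameMatrix_orthogonal hQ hν hQν)) hq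

theorem eq_smul_of_frame {Q : Matrix (Fin (d + 1)) (Fin d) ℝ} {ν p : Fin (d + 1) → ℝ}
    (hQ : Qᵀ * Q = 1) (hν : ν ⬝ᵥ ν = 1) (hQν : Qᵀ *ᵥ ν = 0) (hQp : Qᵀ *ᵥ p = 0) :
    p = (ν ⬝ᵥ p) • ν := by
  have h := congrArg (frameMatrix Q ν *ᵥ ·) (frameMatrix_transpose_mulVec (ν := ν) hQp)
  simp only [Matrix.mulVec_mulVec, mul_eq_one_comm.1 (frameMatrix_orthogonal hQ hν hQν),
    Matrix.one_mulVec, Matrix.mulVec_single] at h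
  rw [h]
  ext i
  simp only [frameMatrix_last, Pi.smul_apply, Matrix.col_apply, MulOpposite.smul_eq_mul_unop,
    MulOpposite.unop_op, smul_eq_mul, mul_comm, ← h]

theorem exists_frame {ν : Fin (d + 1) → ℝ} (hν : ν ⬝ᵥ ν = 1) :
    ∃ Q : Matrix (Fin (d + 1)) (Fin d) ℝ, Qᵀ * Q = 1 ∧ Qᵀ *ᵥ ν = 0 := by
  have hn : ‖(WithLp.toLp 2 ν : E (d + 1))‖ = 1 := by
    rw [EuclideanSpace.norm_eq, Real.sqrt_eq_one]
    simpa [dotProduct, sq] using hν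
  obtain ⟨b, hb⟩ := Orthonormal.exists_orthonormalBasis_extension_of_card_eq (𝕜 := ℝ)
    (E := E (d + 1)) (ι := Fin (d + 1)) (by simp) (v := fun _ => WithLp.toLp 2 ν)
    (s := {Fin.last d}) ⟨fun _ => hn, fun i j hij => absurd (Subsingleton.elim i j) hij⟩
  have hlast := hb _ rfl
  have hin : ∀ i j, ∑ l, b i l * b j l = if i = j then 1 else 0 := by
    intro i j
    have := orthonormal_iff_ite.1 b.orthonormal i j
    rw [← this, EuclideanSpace.inner_eq_star_dotProduct]
    simp [dotProduct, mul_comm]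
  refine ⟨Matrix.of fun i k => b k.castSucc i, ?_, ?_⟩
  · ext1 k l
    rw [Matrix.mul_apply, Matrix.one_apply]
    have := hin k.castSucc l.castSucc
    simpa using this
  · ext1 k
    have := hin k.castSucc (Fin.last d)
    rw [hlast, if_neg (Fin.castSucc_lt_last k).ne] at this
    simpa [Matrix.mulVec, dotProduct] using this

end Frame

/-! ### Splitting coordinates into (x̃, xⁿ) -/

section Coordinates

variable {d : ℕ}

/-- The linear map `x ↦ x̃`. -/
noncomputable def tildeL : E (d + 1) →L[ℝ] E d :=
  LinearMap.toContinuousLinearMap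
    { toFun := tilde, map_add' := fun _ _ => rfl, map_smul' := fun _ _ => rfl }

/-- The linear form `x ↦ xⁿ`. -/
noncomputable def lastL : E (d + 1) →L[ℝ] ℝ :=
  LinearMap.toContinuousLinearMap
    { toFun := lastCoord, map_add' := fun _ _ => rfl, map_smul' := fun _ _ => rfl }

theorem tildeL_apply (x : E (d + 1)) : tildeL x = tilde x := rfl

theorem lastL_apply (x : E (d + 1)) : lastL x = lastCoord x := rfl

/-- The point with coordinates `(z, t)`. -/
def graphPoint (z : E d) (t : ℝ) : E (d + 1) :=
  WithLp.toLp 2 (Fin.snoc (α := fun _ => ℝ) (fun i => z i) t)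

@[simp] theorem tilde_graphPoint (z : E d) (t : ℝ) : tilde (graphPoint z t) = z := by
  ext i; simp [tilde, graphPoint]

@[simp] theorem lastCoord_graphPoint (z : E d) (t : ℝ) : lastCoord (graphPoint z t) = t := by
  simp [lastCoord, graphPoint]

@[simp] theorem graphPoint_tilde (x : E (d + 1)) : graphPoint (tilde x) (lastCoord x) = x := by
  ext i
  induction i using Fin.lastCases <;> simp [tilde, lastCoord, graphPoint]

theorem ext_tilde {x y : E (d + 1)} (h : tilde x = tilde y) (h' : lastCoord x = lastCoord y) :
    x = y := by
  rw [← graphPoint_tilde x, ← graphPoint_tilde y, h, h']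

/-- The linear map `(z, t) ↦ (z, t)` onto `ℝⁿ`. -/
noncomputable def pairL : E d × ℝ →L[ℝ] E (d + 1) :=
  LinearMap.toContinuousLinearMap
    { toFun := fun x => graphPoint x.1 x.2
      map_add' := fun x y => ext_tilde (by
          simp only [← tildeL_apply, map_add]; simp [tildeL_apply]) (by
          simp only [← lastL_apply, map_add]; simp [lastL_apply])
      map_smul' := fun c x => ext_tilde (by
          simp only [← tildeL_apply, map_smul]; simp [tildeL_apply]) (by
          simp only [← lastL_apply, map_smul]; simp [lastL_apply]) }

theorem pairL_apply (x : E d × ℝ) : pairL x = graphPoint x.1 x.2 := rfl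

theorem norm_sq_eq_tilde (x : E (d + 1)) : ‖x‖ ^ 2 = ‖tilde x‖ ^ 2 + lastCoord x ^ 2 := by
  rw [EuclideanSpace.norm_sq_eq, EuclideanSpace.norm_sq_eq, Fin.sum_univ_castSucc]
  simp [tilde, lastCoord]

theorem norm_tilde_le (x : E (d + 1)) : ‖tilde x‖ ≤ ‖x‖ := by
  have := norm_sq_eq_tilde x
  exact (sq_le_sq₀ (norm_nonneg _) (norm_nonneg _)).1 (by nlinarith [sq_nonneg (lastCoord x)])

theorem abs_lastCoord_le (x : E (d + 1)) : |lastCoord x| ≤ ‖x‖ := by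
  have := norm_sq_eq_tilde x
  exact abs_le_of_sq_le_sq (by nlinarith [sq_nonneg ‖tilde x‖]) (norm_nonneg _)

/-- The matrix of a bilinear form. -/
noncomputable def bilinMatrix {n : ℕ} (B : E n →L[ℝ] E n →L[ℝ] ℝ) : Matrix (Fin n) (Fin n) ℝ :=
  Matrix.of fun i j => B (EuclideanSpace.single j 1) (EuclideanSpace.single i 1)

theorem dotProduct_bilinMatrix_mulVec {n : ℕ} (B : E n →L[ℝ] E n →L[ℝ] ℝ) (v w : E n) :
    w.ofLp ⬝ᵥ bilinMatrix B *ᵥ v.ofLp = B v w := by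
  have hv : ∀ v : E n, v = ∑ i, v i • EuclideanSpace.single i (1 : ℝ) := by
    intro v
    conv_lhs => rw [← (EuclideanSpace.basisFun (Fin n) ℝ).sum_repr v]
    simp
  conv_rhs => rw [hv v, hv w]
  simp only [map_sum, map_smul, _root_.sum_apply, _root_.smul_apply,
    dotProduct, Matrix.mulVec, bilinMatrix, Matrix.of_apply, smul_eq_mul, Finset.mul_sum]
  refine Finset.sum_congr rfl fun i _ => Finset.sum_congr rfl fun j _ => by ring

theorem inner_toEuclideanCLM_bilinMatrix {n : ℕ} (B : E n →L[ℝ] E n →L[ℝ] ℝ) (v w : E n) :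
    inner ℝ w (Matrix.toEuclideanCLM (n := Fin n) (𝕜 := ℝ) (bilinMatrix B) v) = B v w := by
  rw [Matrix.inner_toEuclideanCLM, dotProduct_bilinMatrix_mulVec]

end Coordinates

/-! ### Derivatives of the height over a graph -/

section Graph

variable {d : ℕ}

/-- The second derivative of `x ↦ ω x̃`, as a bilinear form on `ℝⁿ`. -/
noncomputable def graphForm (ω : E d → ℝ) (z : E d) : E (d + 1) →L[ℝ] E (d + 1) →L[ℝ] ℝ :=
  (fderiv ℝ (fderiv ℝ ω) z).bilinearComp tildeL tildeL

/-- The Hessian matrix of `x ↦ ω x̃`. -/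
noncomputable def graphHess (ω : E d → ℝ) (z : E d) : Matrix (Fin (d + 1)) (Fin (d + 1)) ℝ :=
  bilinMatrix (graphForm ω z)

/-- The gradient `(-∇ω, 1)` of `x ↦ xⁿ - ω x̃`. -/
noncomputable def graphGrad (ω : E d → ℝ) (z : E d) : E (d + 1) :=
  (InnerProductSpace.toDual ℝ (E (d + 1))).symm (lastL - (fderiv ℝ ω z).comp tildeL)

theorem inner_graphGrad (ω : E d → ℝ) (z : E d) (v : E (d + 1)) :
    inner ℝ (graphGrad ω z) v = lastCoord v - fderiv ℝ ω z (tilde v) := by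
  rw [graphGrad, InnerProductSpace.toDual_symm_apply]
  rfl

theorem graphForm_apply (ω : E d → ℝ) (z : E d) (v w : E (d + 1)) :
    graphForm ω z v w = fderiv ℝ (fderiv ℝ ω) z (tilde v) (tilde w) := rfl

/-- The height `xⁿ - ω x̃` over the graph of `ω`. -/
def height (ω : E d → ℝ) (x : E (d + 1)) : ℝ := lastCoord x - ω (tilde x)

theorem height_graphPoint (ω : E d → ℝ) (z : E d) (t : ℝ) :
    height ω (graphPoint z (ω z + t)) = t := by simp [height]

variable {ω : E d → ℝ} {ρ : ℝ}

theorem contDiffAt_of_mem_ball (hω : ContDiffOn ℝ 2 ω (ball 0 ρ)) {z : E d} (hz : ‖z‖ < ρ) :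
    ContDiffAt ℝ 2 ω z :=
  hω.contDiffAt (isOpen_ball.mem_nhds (by simpa using hz))

theorem hasGradientAt_height (hω : ContDiffOn ℝ 2 ω (ball 0 ρ)) {x : E (d + 1)}
    (hx : ‖tilde x‖ < ρ) : HasGradientAt (height ω) (graphGrad ω (tilde x)) x := by
  rw [hasGradientAt_iff_hasFDerivAt, graphGrad, LinearIsometryEquiv.apply_symm_apply]
  have h1 : HasFDerivAt ω (fderiv ℝ ω (tilde x)) (tildeL x) :=
    ((contDiffAt_of_mem_ball hω hx).differentiableAt (by norm_num)).hasFDerivAt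
  exact (lastL.hasFDerivAt (x := x)).sub (h1.comp x tildeL.hasFDerivAt)

theorem contDiffAt_fderiv (hω : ContDiffOn ℝ 2 ω (ball 0 ρ)) {z : E d} (hz : ‖z‖ < ρ) :
    ContDiffAt ℝ 1 (fderiv ℝ ω) z :=
  (contDiffAt_of_mem_ball hω hz).fderiv_right (by norm_num)

theorem continuousAt_graphGrad (hω : ContDiffOn ℝ 2 ω (ball 0 ρ)) {z : E d} (hz : ‖z‖ < ρ) :
    ContinuousAt (graphGrad ω) z := by
  refine (LinearIsometryEquiv.continuous _).continuousAt.comp ?_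
  exact continuousAt_const.sub ((contDiffAt_fderiv hω hz).continuousAt.clm_comp continuousAt_const)

theorem hasFDerivAt_graphGrad (hω : ContDiffOn ℝ 2 ω (ball 0 ρ)) {x : E (d + 1)}
    (hx : ‖tilde x‖ < ρ) :
    HasFDerivAt (fun x => graphGrad ω (tilde x))
      (-Matrix.toEuclideanCLM (n := Fin (d + 1)) (𝕜 := ℝ) (graphHess ω (tilde x))) x := by
  have h1 : HasFDerivAt (fderiv ℝ ω) (fderiv ℝ (fderiv ℝ ω) (tilde x)) (tildeL x) :=
    ((contDiffAt_fderiv hω hx).differentiableAt (by norm_num)).hasFDerivAt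
  have h2 := h1.comp x tildeL.hasFDerivAt
  have h3 := ((ContinuousLinearMap.compL ℝ (E (d + 1)) (E d) ℝ).flip tildeL).hasFDerivAt.comp x h2
  have h4 := (h3.const_sub lastL)
  have h5 := (LinearMap.toContinuousLinearMap
    { toFun := (InnerProductSpace.toDual ℝ (E (d + 1))).symm
      map_add' := map_add _
      map_smul' := fun c f => by simp }).hasFDerivAt.comp x h4
  refine h5.congr_fderiv (ContinuousLinearMap.ext fun v => ext_inner_left ℝ fun w => ?_)
  rw [_root_.neg_apply, inner_neg_right, graphHess, inner_toEuclideanCLM_bilinMatrix,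
    real_inner_comm]
  exact InnerProductSpace.toDual_symm_apply

theorem continuousAt_graphHess (hω : ContDiffOn ℝ 2 ω (ball 0 ρ)) {z : E d} (hz : ‖z‖ < ρ) :
    ContinuousAt (graphHess ω) z := by
  have h : ContinuousAt (fderiv ℝ (fderiv ℝ ω)) z :=
    ((contDiffAt_fderiv hω hz).fderiv_right (m := 0) (by norm_num)).continuousAt
  refine continuousAt_pi.2 fun i => continuousAt_pi.2 fun j => ?_
  exact (h.clm_apply continuousAt_const).clm_apply continuousAt_const

theorem graphHess_isSymm (hω : ContDiffOn ℝ 2 ω (ball 0 ρ)) {z : E d} (hz : ‖z‖ < ρ) :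
    (graphHess ω z).IsSymm := by
  have h := (contDiffAt_of_mem_ball hω hz).isSymmSndFDerivAt (by simp)
  ext i j
  exact h.eq _ _

end Graph

/-! ### Curvature of the boundary in terms of the defining function -/

section StdGraph

variable {d : ℕ} {Ω : Set (E (d + 1))} {ω : E d → ℝ} {ρ : ℝ}

/-- The open set `Ω` lies above the graph of the `C²` function `ω`, in a cylinder centred at the
origin. -/
structure IsStdGraph (Ω : Set (E (d + 1))) (ω : E d → ℝ) (ρ : ℝ) : Prop where
  isOpen : IsOpen Ω
  pos : 0 < ρ
  zero : ω 0 = 0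
  contDiffOn : ContDiffOn ℝ 2 ω (ball 0 ρ)
  mem_iff : ∀ x, ‖tilde x‖ < ρ → |lastCoord x| < ρ → (x ∈ Ω ↔ 0 < height ω x)

@[simp] theorem tilde_zero : tilde (0 : E (d + 1)) = 0 := rfl

@[simp] theorem lastCoord_zero : lastCoord (0 : E (d + 1)) = 0 := rfl

theorem eventually_cylinder {x : E (d + 1)} (hx : ‖tilde x‖ < ρ) (hx' : |lastCoord x| < ρ) :
    ∀ᶠ y in 𝓝 x, ‖tilde y‖ < ρ ∧ |lastCoord y| < ρ :=
  ((tildeL (d := d)).continuous.norm.continuousAt.eventually_lt continuousAt_const hx).and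
    ((lastL (d := d)).continuous.abs.continuousAt.eventually_lt continuousAt_const hx')

theorem IsStdGraph.continuousAt_height (h : IsStdGraph Ω ω ρ) {x : E (d + 1)}
    (hx : ‖tilde x‖ < ρ) : ContinuousAt (height ω) x :=
  (hasGradientAt_height h.contDiffOn hx).hasFDerivAt.continuousAt

/-- Negative height persists nearby and excludes the closure of Ω; a point of zero height is a limit
of its upward vertical translates, which lie in Ω. -/
theorem IsStdGraph.mem_frontier_iff (h : IsStdGraph Ω ω ρ) {x : E (d + 1)} (hx : ‖tilde x‖ < ρ)
    (hx' : |lastCoord x| < ρ) : x ∈ frontier Ω ↔ height ω x = 0 := by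
  rw [h.isOpen.frontier_eq]
  constructor
  · rintro ⟨hcl, hnot⟩
    rw [h.mem_iff x hx hx', not_lt] at hnot
    by_contra hne
    have hlt : height ω x < 0 := lt_of_le_of_ne hnot hne
    have hev : ∀ᶠ y in 𝓝 x, y ∉ Ω := by
      filter_upwards [eventually_cylinder hx hx',
        (h.continuousAt_height hx).eventually_lt continuousAt_const hlt] with y hy hy2
      rw [h.mem_iff y hy.1 hy.2]
      exact hy2.le.not_gt
    exact (mem_closure_iff_frequently.1 hcl) hev
  · intro h0
    refine ⟨?_, fun hm => ((h.mem_iff x hx hx').1 hm).ne' h0⟩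
    let f : ℝ → E (d + 1) := fun t => graphPoint (tilde x) (lastCoord x + t)
    have hf : Continuous f := pairL.continuous.comp (by fun_prop :
      Continuous fun t : ℝ => (tilde x, lastCoord x + t))
    have hf0 : f 0 = x := by simp [f]
    have ht : Filter.Tendsto f (𝓝[>] 0) (𝓝 x) := by
      have := hf.tendsto 0
      rw [hf0] at this
      exact this.mono_left nhdsWithin_le_nhds
    refine mem_closure_of_tendsto ht ?_
    filter_upwards [ht.eventually (eventually_cylinder hx hx'), self_mem_nhdsWithin] with t h1 h2
    rw [h.mem_iff _ h1.1 h1.2]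
    have : height ω (f t) = height ω x + t := by simp [height, f]; ring
    rw [this, h0, zero_add]
    exact h2

theorem graphGrad_ne_zero (ω : E d → ℝ) (z : E d) : graphGrad ω z ≠ 0 := by
  intro h
  have := inner_graphGrad ω z (graphPoint 0 1)
  simp [h] at this

/-- Decides the orientation: the sign of the height along a ray shows on which side of the boundary
its direction points. -/
theorem IsStdGraph.tendsto_height_ray (h : IsStdGraph Ω ω ρ) (v : E (d + 1)) :
    Filter.Tendsto (fun t : ℝ => t⁻¹ * height ω (t • v)) (𝓝[>] 0)
      (𝓝 (inner ℝ (graphGrad ω 0) v)) := by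
  have h4 := (hasGradientAt_height (x := (0 : ℝ) • v) h.contDiffOn (by simp [h.pos])).hasFDerivAt
  have h5 := h4.comp_hasDerivAt (0 : ℝ) ((hasDerivAt_id (0 : ℝ)).smul_const v)
  have h6 := h5.tendsto_slope_zero_right
  have hz : height ω (0 : E (d + 1)) = 0 := by simp [height, h.zero]
  simpa only [one_smul, zero_smul, tilde_zero, InnerProductSpace.toDual_apply_apply, zero_add, id,
    Function.comp_apply, hz, sub_zero, smul_eq_mul] using h6

theorem eventually_ray_cylinder (hρ : 0 < ρ) (v : E (d + 1)) :
    ∀ᶠ t : ℝ in 𝓝[>] 0, ‖tilde (t • v)‖ < ρ ∧ |lastCoord (t • v)| < ρ := by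
  have hcont : Filter.Tendsto (fun t : ℝ => t • v) (𝓝[>] 0) (𝓝 0) := by
    have : ContinuousAt (fun t : ℝ => t • v) 0 := by fun_prop
    rw [ContinuousAt, zero_smul] at this
    exact this.mono_left nhdsWithin_le_nhds
  exact hcont.eventually (eventually_cylinder (by simpa) (by simpa))

/-- The matrix whose columns are the tangent vectors. -/
noncomputable def tangentMatrix (X : E d → E (d + 1)) (θ : E d) : Matrix (Fin (d + 1)) (Fin d) ℝ :=
  Matrix.of fun i k => tangentVec X k θ i

theorem metricTensor_eq (X : E d → E (d + 1)) (θ : E d) :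
    metricTensor X θ = (tangentMatrix X θ)ᵀ * tangentMatrix X θ := by
  ext1 k l
  simp [metricTensor, Matrix.mul_apply, tangentMatrix, EuclideanSpace.inner_eq_star_dotProduct,
    dotProduct, mul_comm]

theorem tangentMatrix_mulVec (X : E d → E (d + 1)) (θ : E d) (v : Fin d → ℝ) :
    tangentMatrix X θ *ᵥ v = (fderiv ℝ X θ (WithLp.toLp 2 v)).ofLp := by
  have hv : (WithLp.toLp 2 v : E d) = ∑ i, v i • EuclideanSpace.single i (1 : ℝ) := by
    conv_lhs => rw [← (EuclideanSpace.basisFun (Fin d) ℝ).sum_repr (WithLp.toLp 2 v)]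
    simp
  rw [hv, map_sum]
  ext i
  simp [Matrix.mulVec, dotProduct, tangentMatrix, tangentVec, mul_comm]

theorem metricTensor_posDef {X : E d → E (d + 1)} {θ : E d}
    (h : Function.Injective (fderiv ℝ X θ)) : (metricTensor X θ).PosDef := by
  rw [metricTensor_eq, ← Matrix.conjTranspose_eq_transpose_of_trivial]
  refine Matrix.PosDef.conjTranspose_mul_self _ fun v w hvw => ?_
  simp only [tangentMatrix_mulVec] at hvw
  have := h (WithLp.ofLp_injective 2 hvw)
  exact WithLp.toLp_injective 2 this

/-- The height vanishes identically along the parametrization, so its derivative does too. The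
relation is kept on a neighbourhood so that it can be differentiated again. -/
theorem IsStdGraph.eventually_inner_tangentVec (h : IsStdGraph Ω ω ρ) {X : E d → E (d + 1)}
    {Θ : Set (E d)} {θ₀ : E d} (hX : IsLocalParam (frontier Ω) 0 X Θ θ₀) :
    ∀ᶠ θ in 𝓝 θ₀, ‖tilde (X θ)‖ < ρ ∧ DifferentiableAt ℝ X θ ∧
      ∀ k, inner ℝ (graphGrad ω (tilde (X θ))) (tangentVec X k θ) = 0 := by
  have hΘ := hX.isOpen.mem_nhds hX.mem
  have hc : ContinuousAt X θ₀ := (hX.contDiffOn.contDiffAt hΘ).continuousAt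
  have hcyl : ∀ᶠ θ in 𝓝 θ₀, ‖tilde (X θ)‖ < ρ ∧ |lastCoord (X θ)| < ρ := by
    refine hc.eventually (eventually_cylinder ?_ ?_) <;> rw [hX.apply_eq] <;> simp [h.pos]
  obtain ⟨U, -, -, hXU⟩ := hX.image
  have hzero : ∀ᶠ θ in 𝓝 θ₀, (height ω ∘ X) θ = 0 := by
    filter_upwards [hcyl, hΘ] with θ h1 h2
    have : X θ ∈ frontier Ω ∩ U := hXU ▸ mem_image_of_mem X h2
    exact (h.mem_frontier_iff h1.1 h1.2).1 this.1
  filter_upwards [hzero.eventually_nhds, hcyl, hX.isOpen.mem_nhds hX.mem] with θ h1 h2 h3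
  have hd : DifferentiableAt ℝ X θ :=
    (hX.contDiffOn.contDiffAt (hX.isOpen.mem_nhds h3)).differentiableAt (by norm_num)
  refine ⟨h2.1, hd, fun k => ?_⟩
  have h4 := (hasGradientAt_height h.contDiffOn h2.1).hasFDerivAt.comp θ hd.hasFDerivAt
  have h5 : HasFDerivAt (height ω ∘ X) (0 : E d →L[ℝ] ℝ) θ :=
    (hasFDerivAt_const (0 : ℝ) θ).congr_of_eventuallyEq h1
  have h6 := congrArg (fun f : E d →L[ℝ] ℝ => f (EuclideanSpace.single k 1)) (h4.unique h5)
  exact h6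

/-- The second fundamental form of the boundary in terms of the Hessian of `ω`. -/
theorem IsStdGraph.inner_fderiv_tangentVec (h : IsStdGraph Ω ω ρ) {X : E d → E (d + 1)}
    {Θ : Set (E d)} {θ₀ : E d} (hX : IsLocalParam (frontier Ω) 0 X Θ θ₀) (k l : Fin d) :
    inner ℝ (graphGrad ω 0) (fderiv ℝ (tangentVec X k) θ₀ (EuclideanSpace.single l 1))
      = graphForm ω 0 (tangentVec X l θ₀) (tangentVec X k θ₀) := by
  have hev := h.eventually_inner_tangentVec hX
  obtain ⟨h1, h2, -⟩ := hev.self_of_nhds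
  have hdt : DifferentiableAt ℝ (tangentVec X k) θ₀ := by
    have := (hX.contDiffOn.contDiffAt (hX.isOpen.mem_nhds hX.mem)).fderiv_right
      (m := 1) (by norm_num)
    exact (this.differentiableAt (by norm_num)).clm_apply (differentiableAt_const _)
  have h3 := (hasFDerivAt_graphGrad h.contDiffOn h1).comp θ₀ h2.hasFDerivAt
  -- Differentiating the orthogonality of the gradient and X_k along X_l trades second derivatives
  -- of X for the Hessian of ω.
  have h4 := h3.inner ℝ hdt.hasFDerivAt
  have h5 : HasFDerivAt (fun θ => inner ℝ (graphGrad ω (tilde (X θ))) (tangentVec X k θ))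
      (0 : E d →L[ℝ] ℝ) θ₀ :=
    (hasFDerivAt_const (0 : ℝ) θ₀).congr_of_eventuallyEq (hev.mono fun θ hθ => hθ.2.2 k)
  have h6 := congrArg (fun f : E d →L[ℝ] ℝ => f (EuclideanSpace.single l 1)) (h4.unique h5)
  have h7 : inner ℝ (graphGrad ω (tilde (X θ₀)))
        (fderiv ℝ (tangentVec X k) θ₀ (EuclideanSpace.single l 1))
      + inner ℝ (-Matrix.toEuclideanCLM (n := Fin (d + 1)) (𝕜 := ℝ)
          (graphHess ω (tilde (X θ₀))) (tangentVec X l θ₀)) (tangentVec X k θ₀) = 0 := h6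
  rw [hX.apply_eq, tilde_zero, inner_neg_left, graphHess, real_inner_comm _ (_ : E (d + 1)),
    real_inner_comm (tangentVec X k θ₀), inner_toEuclideanCLM_bilinMatrix, real_inner_comm] at h7
  linarith

theorem dotProduct_eq_inner {n : ℕ} (v w : E n) : v.ofLp ⬝ᵥ w.ofLp = inner ℝ v w := by
  simp [EuclideanSpace.inner_eq_star_dotProduct, dotProduct_comm]

/-- The curvature matrix of the boundary in terms of the Hessian of `ω`, and its traces. -/
theorem IsStdGraph.curvatureMatrix_traces (h : IsStdGraph Ω ω ρ) {X : E d → E (d + 1)}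
    {Θ : Set (E d)} {θ₀ : E d} (hX : IsLocalParam (frontier Ω) 0 X Θ θ₀) {ν : E (d + 1)}
    (hν : IsInteriorNormal Ω 0 X θ₀ ν) {τ : Matrix (Fin d) (Fin d) ℝ}
    (hτ : τ * τᵀ = (metricTensor X θ₀)⁻¹) :
    (curvatureMatrix X θ₀ ν τ).IsSymm ∧ ∃ γ : ℝ, 0 < γ ∧ ∀ q,
      dirTrace q (graphHess ω 0) (graphGrad ω 0).ofLp
        = γ ^ (q + 2) * pTrace q (curvatureMatrix X θ₀ ν τ) := by
  set J := tangentMatrix X θ₀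
  set p := graphGrad ω 0
  set Q := J * τ
  have hg := (metricTensor_posDef (hX.injective θ₀ hX.mem)).isUnit
  -- The condition ττᵀ = g⁻¹ says exactly that the columns of Jτ are an orthonormal basis of the
  -- tangent space.
  have hQ : Qᵀ * Q = 1 := by
    have h1 : τ * (τᵀ * metricTensor X θ₀) = 1 := by
      rw [← Matrix.mul_assoc, hτ, Matrix.nonsing_inv_mul _ ((Matrix.isUnit_iff_isUnit_det _).1 hg)]
    have h2 := mul_eq_one_comm.1 h1
    rw [metricTensor_eq] at h2
    simpa only [Q, Matrix.transpose_mul, Matrix.mul_assoc] using h2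
  have hQperp : ∀ v : E (d + 1), (∀ k, inner ℝ (tangentVec X k θ₀) v = 0) → Qᵀ *ᵥ v.ofLp = 0 := by
    intro v hv
    have hJ : Jᵀ *ᵥ v.ofLp = 0 := by
      ext1 k
      rw [Pi.zero_apply, ← hv k, ← dotProduct_eq_inner]
      rfl
    rw [Matrix.transpose_mul, ← Matrix.mulVec_mulVec, hJ, Matrix.mulVec_zero]
  have hν1 : ν.ofLp ⬝ᵥ ν.ofLp = 1 := by
    rw [dotProduct_eq_inner, real_inner_self_eq_norm_sq, hν.norm_eq, one_pow]
  have hQν := hQperp ν hν.normal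
  obtain ⟨h1, h2, h3⟩ := (h.eventually_inner_tangentVec hX).self_of_nhds
  have hQp : Qᵀ *ᵥ p.ofLp = 0 := hQperp p fun k => by
    rw [real_inner_comm]
    have := h3 k
    rwa [hX.apply_eq, tilde_zero] at this
  set γ := ν.ofLp ⬝ᵥ p.ofLp
  have hpν : p = γ • ν := WithLp.ofLp_injective 2 (eq_smul_of_frame hQ hν1 hQν hQp)
  have hγ0 : γ ≠ 0 := fun h0 => graphGrad_ne_zero ω 0 (by
    change p = 0
    rw [hpν, h0, zero_smul])
  -- The normal points into Ω, so the height is positive along its ray and the limiting slope γ is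
  -- nonnegative; γ ≠ 0 because p ≠ 0.
  have hγ : 0 < γ := by
    refine lt_of_le_of_ne ?_ hγ0.symm
    obtain ⟨t₀, ht₀, ht⟩ := hν.interior
    have hslope := h.tendsto_height_ray ν
    rw [← dotProduct_eq_inner, dotProduct_comm] at hslope
    refine ge_of_tendsto hslope ?_
    filter_upwards [self_mem_nhdsWithin, Ioo_mem_nhdsGT ht₀,
      eventually_ray_cylinder h.pos ν] with t h0 h1 h2
    have hm := ht t h1.1 h1.2
    rw [zero_add, h.mem_iff _ h2.1 h2.2] at hm
    exact mul_nonneg (inv_nonneg.2 (le_of_lt h0)) hm.le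
  have hsec : secondForm X θ₀ ν = γ⁻¹ • (Jᵀ * graphHess ω 0 * J) := by
    ext1 k l
    have hform : (Jᵀ * graphHess ω 0 * J) k l
        = graphForm ω 0 (tangentVec X l θ₀) (tangentVec X k θ₀) := by
      rw [← dotProduct_bilinMatrix_mulVec, Matrix.mul_assoc, Matrix.mul_apply]
      rfl
    rw [Matrix.smul_apply, hform, ← h.inner_fderiv_tangentVec hX, secondForm, Matrix.of_apply]
    change _ = γ⁻¹ • inner ℝ p _
    rw [hpν, real_inner_smul_left, smul_eq_mul, inv_mul_cancel_left₀ hγ0, real_inner_comm]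
  have hK : curvatureMatrix X θ₀ ν τ = γ⁻¹ • (Qᵀ * graphHess ω 0 * Q) := by
    rw [curvatureMatrix, hsec, Matrix.mul_smul, Matrix.smul_mul]
    simp only [Q, Matrix.transpose_mul, Matrix.mul_assoc]
  constructor
  · rw [hK]
    have hs := graphHess_isSymm h.contDiffOn (z := 0) (by simp [h.pos])
    rw [Matrix.IsSymm, Matrix.transpose_smul, Matrix.transpose_mul (_ * _) Q,
      Matrix.transpose_mul Qᵀ, Matrix.transpose_transpose, hs, Matrix.mul_assoc]
  · refine ⟨γ, hγ, fun q => ?_⟩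
    -- In γ^(q+2) two powers come from (ν · p)² and q from the factor γ⁻¹ in the curvature matrix.
    rw [dirTrace_eq_of_frame hQ hν1 hQν hQp, hK, pTrace_smul, ← mul_assoc]
    congr 1
    change γ ^ 2 = _
    rw [pow_add, inv_pow]
    field_simp

theorem exists_mul_transpose_eq_inv {g : Matrix (Fin d) (Fin d) ℝ} (hg : g.PosDef) :
    ∃ τ : Matrix (Fin d) (Fin d) ℝ, τ * τᵀ = g⁻¹ := by
  open scoped MatrixOrder in
  obtain ⟨B, hB⟩ := CStarAlgebra.nonneg_iff_eq_star_mul_self.mp hg.inv.posSemidef.nonneg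
  refine ⟨Bᵀ, ?_⟩
  rw [hB, Matrix.transpose_transpose, Matrix.star_eq_conjTranspose,
    Matrix.conjTranspose_eq_transpose_of_trivial]

/-- The graph map z ↦ (z, ω z) with normal p/|p|. The ball is shrunk so that the graph stays inside
the cylinder; the projection x ↦ x̃ inverts the map, which makes it an embedding. -/
theorem IsStdGraph.exists_param (h : IsStdGraph Ω ω ρ) :
    ∃ (X : E d → E (d + 1)) (Θ : Set (E d)) (ν : E (d + 1)),
      IsLocalParam (frontier Ω) 0 X Θ 0 ∧ IsInteriorNormal Ω 0 X 0 ν := by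
  have hc0 : ContinuousAt ω 0 :=
    (contDiffAt_of_mem_ball h.contDiffOn (by simp [h.pos])).continuousAt
  have hev : ∀ᶠ z in 𝓝 (0 : E d), ‖z‖ < ρ ∧ |ω z| < ρ := by
    refine (continuousAt_id.norm.eventually_lt continuousAt_const (by simp [h.pos])).and
      (hc0.abs.eventually_lt continuousAt_const (by simp [h.zero, h.pos]))
  obtain ⟨δ, hδ, hball⟩ := Metric.eventually_nhds_iff_ball.1 hev
  let X : E d → E (d + 1) := fun z => graphPoint z (ω z)
  have hXc : ContDiffOn ℝ 2 X (ball 0 δ) := by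
    have h1 : ContDiffOn ℝ 2 ω (ball 0 δ) :=
      h.contDiffOn.mono fun z hz => by simpa using (hball z hz).1
    exact (pairL (d := d)).contDiff.comp_contDiffOn (contDiffOn_id.prodMk h1)
  have hfd : ∀ z ∈ ball (0 : E d) δ, ∀ v, fderiv ℝ X z v = graphPoint v (fderiv ℝ ω z v) := by
    intro z hz v
    have h1 : HasFDerivAt ω (fderiv ℝ ω z) z := ((contDiffAt_of_mem_ball h.contDiffOn
      (hball z hz).1).differentiableAt (by norm_num)).hasFDerivAt
    have h2 := (pairL (d := d)).hasFDerivAt.comp z ((hasFDerivAt_id z).prodMk h1)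
    have h3 : fderiv ℝ X z = _ := h2.fderiv
    rw [h3]
    rfl
  have h0 : (0 : E d) ∈ ball (0 : E d) δ := mem_ball_self hδ
  have hX0 : X 0 = 0 := ext_tilde (by simp [X]) (by simp [X, h.zero])
  set p := graphGrad ω 0
  have hp : p ≠ 0 := graphGrad_ne_zero ω 0
  have hpn : 0 < ‖p‖ := norm_pos_iff.2 hp
  refine ⟨X, ball 0 δ, ‖p‖⁻¹ • p, ⟨isOpen_ball, h0, hX0, hXc, ?_, ?_, ?_⟩, ⟨?_, ?_, ?_⟩⟩
  · intro z hz v w hvw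
    rw [hfd z hz, hfd z hz] at hvw
    simpa using congrArg tilde hvw
  · have hcont : Continuous ((ball (0 : E d) δ).domRestrict X) :=
      continuousOn_iff_continuous_domRestrict.1 hXc.continuousOn
    have h1 : IsEmbedding ((tilde : E (d + 1) → E d) ∘ (ball (0 : E d) δ).domRestrict X) := by
      have : (tilde : E (d + 1) → E d) ∘ (ball (0 : E d) δ).domRestrict X = Subtype.val := by
        ext1 z
        exact tilde_graphPoint _ _
      rw [this]
      exact IsEmbedding.subtypeVal
    exact IsEmbedding.of_comp hcont (tildeL (d := d)).continuous h1
  · refine ⟨{x | ‖tilde x‖ < δ} ∩ {x | |lastCoord x| < ρ}, ?_, ?_, ?_⟩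
    · exact (isOpen_lt (tildeL (d := d)).continuous.norm continuous_const).inter
        (isOpen_lt (lastL (d := d)).continuous.abs continuous_const)
    · exact ⟨by simpa using hδ, by simpa using h.pos⟩
    · ext x
      constructor
      · rintro ⟨z, hz, rfl⟩
        have hb := hball z hz
        refine ⟨(h.mem_frontier_iff (by simpa [X] using hb.1) (by simpa [X] using hb.2)).2
          (by simp [X, height]), by simpa [X] using hz, by simpa [X] using hb.2⟩
      · rintro ⟨hx, hx1, hx2⟩
        have hz : tilde x ∈ ball (0 : E d) δ := by simpa using hx1
        have := (h.mem_frontier_iff (hball _ hz).1 hx2).1 hx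
        refine ⟨tilde x, hz, ext_tilde (by simp [X]) ?_⟩
        simp only [X, lastCoord_graphPoint]
        simp only [height] at this
        linarith
  · rw [norm_smul, norm_inv, norm_norm, inv_mul_cancel₀ hpn.ne']
  · intro k
    rw [tangentVec, hfd 0 h0, real_inner_smul_right, real_inner_comm, inner_graphGrad]
    simp
  · have hslope := h.tendsto_height_ray (‖p‖⁻¹ • p)
    have hin : inner ℝ (graphGrad ω 0) (‖p‖⁻¹ • p) = ‖p‖ := by
      change inner ℝ p _ = _
      rw [real_inner_smul_right, real_inner_self_eq_norm_sq]
      field_simp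
    rw [hin] at hslope
    have hev2 : ∀ᶠ t in 𝓝[>] (0 : ℝ), (0 : E (d + 1)) + t • ‖p‖⁻¹ • p ∈ Ω := by
      filter_upwards [hslope.eventually_const_lt hpn, self_mem_nhdsWithin,
        eventually_ray_cylinder h.pos (‖p‖⁻¹ • p)] with t h1 h2 h3
      rw [zero_add, h.mem_iff _ h3.1 h3.2]
      exact (pos_iff_pos_of_mul_pos h1).1 (inv_pos.2 h2)
    obtain ⟨t₀, ht₀, ht⟩ := mem_nhdsGT_iff_exists_Ioo_subset.1 hev2
    exact ⟨t₀, ht₀, fun t h1 h2 => ht ⟨h1, h2⟩⟩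

/-- Convexity in a form free of X, ν and τ, all of which affect the traces only through powers of γ
> 0. -/
theorem IsStdGraph.isBoundaryConvexAt_iff (h : IsStdGraph Ω ω ρ) (k : ℕ) :
    IsBoundaryConvexAt k Ω 0 ↔
      ∀ q ≤ k, 0 < dirTrace q (graphHess ω 0) (graphGrad ω 0).ofLp := by
  constructor
  · rintro ⟨X, Θ, θ₀, ν, τ, hX, hν, hτ, hK⟩ q hq
    obtain ⟨-, γ, hγ, hγK⟩ := h.curvatureMatrix_traces hX hν hτ
    rw [hγK]
    exact mul_pos (pow_pos hγ _) (hK.2 q hq)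
  · intro hpos
    obtain ⟨X, Θ, ν, hX, hν⟩ := h.exists_param
    obtain ⟨τ, hτ⟩ := exists_mul_transpose_eq_inv (metricTensor_posDef (hX.injective 0 hX.mem))
    obtain ⟨hs, γ, hγ, hγK⟩ := h.curvatureMatrix_traces hX hν hτ
    refine ⟨X, Θ, 0, ν, τ, hX, hν, hτ, hs, fun q hq => ?_⟩
    have := hpos q hq
    rw [hγK] at this
    exact (pos_iff_pos_of_mul_pos this).1 (pow_pos hγ _)

end StdGraph

/-! ### Admissibility of quadratic profiles of the corrected height -/

section Admissible

variable {d : ℕ} {Ω : Set (E (d + 1))} {ω : E d → ℝ} {ρ : ℝ}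

/-- The height over the graph of `ω`, corrected by the quadratic form of `β J`. -/
noncomputable def tiltedHeight (ω : E d → ℝ) (β : ℝ) (J : Matrix (Fin (d + 1)) (Fin (d + 1)) ℝ)
    (x : E (d + 1)) : ℝ :=
  height ω x + β / 2 * inner ℝ x (Matrix.toEuclideanCLM (n := Fin (d + 1)) (𝕜 := ℝ) J x)

/-- The gradient of `tiltedHeight`. -/
noncomputable def tiltedGrad (ω : E d → ℝ) (β : ℝ) (J : Matrix (Fin (d + 1)) (Fin (d + 1)) ℝ)
    (x : E (d + 1)) : E (d + 1) :=
  graphGrad ω (tilde x) + β • Matrix.toEuclideanCLM (n := Fin (d + 1)) (𝕜 := ℝ) J x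

theorem inner_toEuclideanCLM_comm {n : ℕ} {J : Matrix (Fin n) (Fin n) ℝ} (hJ : J.IsSymm)
    (x y : E n) : inner ℝ x (Matrix.toEuclideanCLM (n := Fin n) (𝕜 := ℝ) J y)
      = inner ℝ y (Matrix.toEuclideanCLM (n := Fin n) (𝕜 := ℝ) J x) := by
  rw [Matrix.inner_toEuclideanCLM, Matrix.inner_toEuclideanCLM, Matrix.dotProduct_mulVec,
    ← Matrix.mulVec_transpose, hJ, dotProduct_comm]

theorem hasGradientAt_tiltedHeight (hω : ContDiffOn ℝ 2 ω (ball 0 ρ)) (β : ℝ)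
    {J : Matrix (Fin (d + 1)) (Fin (d + 1)) ℝ} (hJ : J.IsSymm) {x : E (d + 1)}
    (hx : ‖tilde x‖ < ρ) : HasGradientAt (tiltedHeight ω β J) (tiltedGrad ω β J x) x := by
  have h1 := hasGradientAt_height hω hx
  rw [hasGradientAt_iff_hasFDerivAt] at h1 ⊢
  have h2 := (hasFDerivAt_id x).inner ℝ
    (Matrix.toEuclideanCLM (n := Fin (d + 1)) (𝕜 := ℝ) J).hasFDerivAt
  refine (h1.add (h2.const_mul (β / 2))).congr_fderiv (ContinuousLinearMap.ext fun v => ?_)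
  have h3 : inner ℝ (tiltedGrad ω β J x) v = inner ℝ (graphGrad ω (tilde x)) v
      + β / 2 * (inner ℝ x (Matrix.toEuclideanCLM (n := Fin (d + 1)) (𝕜 := ℝ) J v)
        + inner ℝ v (Matrix.toEuclideanCLM (n := Fin (d + 1)) (𝕜 := ℝ) J x)) := by
    rw [tiltedGrad, inner_add_left, real_inner_smul_left, inner_toEuclideanCLM_comm hJ x v,
      real_inner_comm (Matrix.toEuclideanCLM (n := Fin (d + 1)) (𝕜 := ℝ) J x) v]
    ring
  exact h3.symm

theorem hasFDerivAt_tiltedGrad (hω : ContDiffOn ℝ 2 ω (ball 0 ρ)) (β : ℝ)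
    (J : Matrix (Fin (d + 1)) (Fin (d + 1)) ℝ) {x : E (d + 1)} (hx : ‖tilde x‖ < ρ) :
    HasFDerivAt (tiltedGrad ω β J)
      (-Matrix.toEuclideanCLM (n := Fin (d + 1)) (𝕜 := ℝ) (graphHess ω (tilde x) - β • J)) x := by
  have h := (hasFDerivAt_graphGrad hω hx).add
    ((Matrix.toEuclideanCLM (n := Fin (d + 1)) (𝕜 := ℝ) J).hasFDerivAt (x := x).const_smul β)
  refine h.congr_fderiv ?_
  rw [map_sub, map_smul]
  abel

theorem toEuclideanCLM_vecMulVec {n : ℕ} (g v : E n) :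
    Matrix.toEuclideanCLM (n := Fin n) (𝕜 := ℝ) (Matrix.vecMulVec g.ofLp g.ofLp) v
      = (inner ℝ g v : ℝ) • g := by
  apply WithLp.ofLp_injective 2
  rw [Matrix.ofLp_toEuclideanCLM, Matrix.vecMulVec_mulVec, dotProduct_eq_inner]
  ext i
  simp [mul_comm]

/-- The profile `a (S y² / 2 - y)` composed with the corrected height is `C²` up to the
boundary. -/
theorem isC2UpToBoundary_profile (hω : ContDiffOn ℝ 2 ω (ball 0 ρ)) (β : ℝ)
    {J : Matrix (Fin (d + 1)) (Fin (d + 1)) ℝ} (hJ : J.IsSymm) (a S : ℝ) {D : Set (E (d + 1))}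
    (hD : ∀ x ∈ closure D, ‖tilde x‖ < ρ) :
    IsC2UpToBoundary D (fun x => a * (S / 2 * tiltedHeight ω β J x ^ 2 - tiltedHeight ω β J x))
      (fun x => (a * (1 - S * tiltedHeight ω β J x)) • (graphHess ω (tilde x) - β • J)
        + (a * S) • Matrix.vecMulVec (tiltedGrad ω β J x).ofLp (tiltedGrad ω β J x).ofLp) := by
  set y := tiltedHeight ω β J
  set g := tiltedGrad ω β J
  have hy : ∀ x ∈ closure D, HasGradientAt y (g x) x := fun x hx =>
    hasGradientAt_tiltedHeight hω β hJ (hD x hx)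
  have hyc : ContinuousOn y (closure D) := fun x hx =>
    (hy x hx).hasFDerivAt.continuousAt.continuousWithinAt
  have hgd : ∀ x ∈ closure D, HasFDerivAt g _ x := fun x hx =>
    hasFDerivAt_tiltedGrad hω β J (hD x hx)
  have hgc : ContinuousOn g (closure D) := fun x hx =>
    (hgd x hx).continuousAt.continuousWithinAt
  have hAc : ContinuousOn (fun x => graphHess ω (tilde x)) (closure D) := fun x hx =>
    (ContinuousAt.comp (f := tilde) (continuousAt_graphHess hω (hD x hx))
      (tildeL (d := d)).continuous.continuousAt).continuousWithinAt
  -- Chain rule for a(Sy²/2 - y): the profile has first derivative a(Sy - 1) and second derivative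
  -- aS, while D²y = -(D²ω - βJ).
  refine ⟨fun x => (a * (S * y x - 1)) • g x, by fun_prop, by fun_prop, ?_, fun x hx => ?_⟩
  · have hc : ContinuousOn (fun x => a * (1 - S * y x)) (closure D) := by fun_prop
    refine (hc.smul (hAc.sub continuousOn_const)).add (ContinuousOn.const_smul ?_ (a * S))
    have : Continuous fun v : E (d + 1) => Matrix.vecMulVec v.ofLp v.ofLp :=
      (PiLp.continuous_ofLp 2 _).matrix_vecMulVec (PiLp.continuous_ofLp 2 _)
    exact this.comp_continuousOn hgc
  · have hx' := subset_closure hx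
    have h1 := (hy x hx').hasFDerivAt
    constructor
    · rw [hasGradientAt_iff_hasFDerivAt]
      refine ((((h1.pow 2).const_mul (S / 2)).sub h1).const_mul a).congr_fderiv
        (ContinuousLinearMap.ext fun v => ?_)
      simp only [_root_.smul_apply, _root_.sub_apply, InnerProductSpace.toDual_apply_apply,
        real_inner_smul_left, smul_eq_mul, nsmul_eq_mul]
      norm_num
      ring
    · have h2 := (((h1.const_mul S).sub_const 1).const_mul a).smul (hgd x hx')
      refine h2.congr_fderiv (ContinuousLinearMap.ext fun v => ?_)
      rw [map_add, map_smul, map_smul]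
      change (a * (S * y x - 1)) • -(Matrix.toEuclideanCLM (n := Fin (d + 1)) (𝕜 := ℝ)
          (graphHess ω (tilde x) - β • J) v) + (a * (S * inner ℝ (g x) v)) • g x
        = (a * (1 - S * y x)) • Matrix.toEuclideanCLM (n := Fin (d + 1)) (𝕜 := ℝ)
          (graphHess ω (tilde x) - β • J) v + (a * S) • Matrix.toEuclideanCLM (n := Fin (d + 1))
            (𝕜 := ℝ) (Matrix.vecMulVec (g x).ofLp (g x).ofLp) v
      rw [toEuclideanCLM_vecMulVec]
      rw [smul_neg, ← neg_smul, smul_smul]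
      congr 2 <;> ring

/-- Each trace is affine in S with positive slope at z₀. One S₀ works at z₀; slope and value at S₀
stay positive nearby by continuity, and the positive slope then covers every S ≥ S₀. -/
theorem exists_eventually_pTrace_pos {α : Type*} [TopologicalSpace α] {n m : ℕ}
    {A : α → Matrix (Fin n) (Fin n) ℝ} {g : α → Fin n → ℝ} {z₀ : α} (hA : ContinuousAt A z₀)
    (hg : ContinuousAt g z₀) (hpos : ∀ q < m, 0 < dirTrace q (A z₀) (g z₀)) :
    ∃ S₀ : ℝ, 0 < S₀ ∧ ∀ᶠ z in 𝓝 z₀, ∀ S ≥ S₀, ∀ p ≤ m,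
      0 < pTrace p (A z + S • Matrix.vecMulVec (g z) (g z)) := by
  have hLc : ∀ q, ContinuousAt (fun z => dirTrace q (A z) (g z)) z₀ := fun q =>
    ContinuousAt.comp (f := fun z => (A z, g z)) (continuous_dirTrace q).continuousAt
      (hA.prodMk hg)
  have hTc : ∀ q, ContinuousAt (fun z => pTrace (q + 1) (A z)) z₀ := fun q =>
    ContinuousAt.comp (f := A) (continuous_pTrace (q + 1)).continuousAt hA
  have hS : ∀ᶠ S : ℝ in Filter.atTop, ∀ q ∈ Finset.range m,
      0 < pTrace (q + 1) (A z₀) + S * dirTrace q (A z₀) (g z₀) := by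
    rw [Filter.eventually_all_finset]
    intro q hq
    exact (Filter.tendsto_atTop_add_const_left _ _ (Filter.tendsto_id.atTop_mul_const
      (hpos q (Finset.mem_range.1 hq)))).eventually_gt_atTop 0
  obtain ⟨S₀, hS₀, hS₀pos⟩ := (hS.and (Filter.eventually_gt_atTop 0)).exists
  refine ⟨S₀, hS₀pos, ?_⟩
  have hev : ∀ᶠ z in 𝓝 z₀, ∀ q ∈ Finset.range m,
      0 < dirTrace q (A z) (g z) ∧ 0 < pTrace (q + 1) (A z) + S₀ * dirTrace q (A z) (g z) := by
    rw [Filter.eventually_all_finset]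
    intro q hq
    exact (continuousAt_const.eventually_lt (hLc q) (hpos q (Finset.mem_range.1 hq))).and
      (continuousAt_const.eventually_lt ((hTc q).add (continuousAt_const.mul (hLc q))) (hS₀ q hq))
  filter_upwards [hev] with z hz S hSS p hp
  rcases p with _ | q
  · rw [pTrace_zero]; norm_num
  · obtain ⟨h1, h2⟩ := hz q (Finset.mem_range.2 hp)
    rw [pTrace_succ_add_smul]
    have := mul_le_mul_of_nonneg_right hSS h1.le
    linarith

/-- Near the origin and for small `β`, the matrices `D²ω - β J + S g gᵀ` have positive traces of
all orders up to `m`, as soon as `S` is large. -/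
theorem IsStdGraph.eventually_pTrace_pos (h : IsStdGraph Ω ω ρ) {m : ℕ}
    (hpos : ∀ q < m, 0 < dirTrace q (graphHess ω 0) (graphGrad ω 0).ofLp)
    (J : Matrix (Fin (d + 1)) (Fin (d + 1)) ℝ) :
    ∃ S₀ : ℝ, 0 < S₀ ∧ ∀ᶠ z in 𝓝 ((0 : E (d + 1)), (0 : ℝ)), ∀ S ≥ S₀, ∀ p ≤ m,
      0 < pTrace p (graphHess ω (tilde z.1) - z.2 • J
        + S • Matrix.vecMulVec (tiltedGrad ω z.2 J z.1).ofLp (tiltedGrad ω z.2 J z.1).ofLp) := by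
  have hpt : ContinuousAt (fun z : E (d + 1) × ℝ => tilde z.1) (0, 0) :=
    ((tildeL (d := d)).continuous.comp continuous_fst).continuousAt
  have hAc : ContinuousAt (fun z : E (d + 1) × ℝ => graphHess ω (tilde z.1) - z.2 • J) (0, 0) := by
    refine ContinuousAt.sub ?_ (continuous_snd.smul continuous_const).continuousAt
    exact ContinuousAt.comp (f := fun z : E (d + 1) × ℝ => tilde z.1)
      (continuousAt_graphHess h.contDiffOn (by simp [h.pos])) hpt
  have hgc : ContinuousAt (fun z : E (d + 1) × ℝ => tiltedGrad ω z.2 J z.1) (0, 0) := by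
    refine ContinuousAt.add ?_ (continuous_snd.smul ((ContinuousLinearMap.continuous _).comp
        continuous_fst)).continuousAt
    exact ContinuousAt.comp (f := fun z : E (d + 1) × ℝ => tilde z.1)
      (continuousAt_graphGrad h.contDiffOn (by simp [h.pos])) hpt
  have hgc' : ContinuousAt (fun z : E (d + 1) × ℝ => (tiltedGrad ω z.2 J z.1).ofLp) (0, 0) :=
    ContinuousAt.comp (f := fun z : E (d + 1) × ℝ => tiltedGrad ω z.2 J z.1)
      (PiLp.continuous_ofLp 2 _).continuousAt hgc
  have hA0 : graphHess ω (tilde (0 : E (d + 1))) - (0 : ℝ) • J = graphHess ω 0 := by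
    rw [zero_smul, sub_zero, tilde_zero]
  have hg0 : tiltedGrad ω 0 J 0 = graphGrad ω 0 := by
    rw [tiltedGrad, zero_smul, add_zero, tilde_zero]
  have hpos' : ∀ q < m, 0 < dirTrace q (graphHess ω (tilde (0 : E (d + 1))) - (0 : ℝ) • J)
      (tiltedGrad ω 0 J 0).ofLp := by
    rw [hA0, hg0]
    exact hpos
  exact exists_eventually_pTrace_pos hAc hgc' hpos'

theorem IsStdGraph.exists_isMAdmissible (h : IsStdGraph Ω ω ρ) {m : ℕ}
    (hpos : ∀ q < m, 0 < dirTrace q (graphHess ω 0) (graphGrad ω 0).ofLp)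
    {J : Matrix (Fin (d + 1)) (Fin (d + 1)) ℝ} (hJ : J.IsSymm) :
    ∃ δ : ℝ, 0 < δ ∧ ∃ S₀ : ℝ, 0 < S₀ ∧ ∀ β, |β| < δ → ∀ S ≥ S₀, ∀ a > 0,
      ∀ D : Set (E (d + 1)), (∀ x ∈ closure D, ‖x‖ < δ ∧ 0 ≤ tiltedHeight ω β J x ∧
        S * tiltedHeight ω β J x < 1) →
      IsMAdmissible m D
        (fun x => a * (S / 2 * tiltedHeight ω β J x ^ 2 - tiltedHeight ω β J x)) := by
  obtain ⟨S₀, hS₀, hev⟩ := h.eventually_pTrace_pos hpos J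
  obtain ⟨δ, hδ, hball⟩ := Metric.eventually_nhds_iff_ball.1 hev
  refine ⟨min δ ρ, lt_min hδ h.pos, S₀, hS₀, fun β hβ S hS a ha D hD => ?_⟩
  have hDρ : ∀ x ∈ closure D, ‖tilde x‖ < ρ := fun x hx =>
    (norm_tilde_le x).trans_lt ((hD x hx).1.trans_le (min_le_right _ _))
  refine ⟨_, isC2UpToBoundary_profile h.contDiffOn β hJ a S hDρ, fun x hx => ?_⟩
  obtain ⟨h1, h2, h3⟩ := hD x hx
  set y := tiltedHeight ω β J x
  set g := (tiltedGrad ω β J x).ofLp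
  have hS0 : 0 < S := hS₀.trans_le hS
  have hpos1 : 0 < 1 - S * y := by linarith
  -- Extracting the positive factor a(1 - Sy) leaves the rank-one coefficient S/(1 - Sy), which is
  -- at least S ≥ S₀ since 0 ≤ Sy < 1.
  have heq : (a * (1 - S * y)) • (graphHess ω (tilde x) - β • J) + (a * S) • Matrix.vecMulVec g g
      = (a * (1 - S * y)) • (graphHess ω (tilde x) - β • J
        + (S / (1 - S * y)) • Matrix.vecMulVec g g) := by
    rw [smul_add, smul_smul]
    congr 2
    field_simp
  constructor
  · rw [Matrix.IsSymm, Matrix.transpose_add, Matrix.transpose_smul, Matrix.transpose_smul,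
      Matrix.transpose_vecMulVec, Matrix.transpose_sub, Matrix.transpose_smul, hJ,
      graphHess_isSymm h.contDiffOn (hDρ x hx)]
  · intro p hp
    rw [heq, pTrace_smul]
    refine mul_pos (pow_pos (mul_pos ha hpos1) _) (hball (x, β) ?_ _ ?_ p hp)
    · rw [mem_ball, Prod.dist_eq, dist_zero_right, dist_zero_right, Real.norm_eq_abs]
      exact max_lt (h1.trans_le (min_le_left _ _)) (hβ.trans_le (min_le_left _ _))
    · refine hS.trans ((le_div_iff₀ hpos1).2 ?_)
      nlinarith [mul_nonneg hS0.le (mul_nonneg hS0.le h2)]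

end Admissible

/-! ### The explicit kernel on the lens domain -/

section Kernels

variable {d : ℕ} {Ω : Set (E (d + 1))} {ω : E d → ℝ} {ρ : ℝ}

theorem IsStdGraph.height_zero (h : IsStdGraph Ω ω ρ) : height ω (0 : E (d + 1)) = 0 := by
  simp [height, h.zero]

theorem IsStdGraph.exists_abs_le (h : IsStdGraph Ω ω ρ) {κ : ℝ} (hκ : 0 < κ) :
    ∃ r > 0, ∀ z : E d, ‖z‖ ≤ r → |ω z| ≤ κ := by
  have hc0 : ContinuousAt ω 0 :=
    (contDiffAt_of_mem_ball h.contDiffOn (by simp [h.pos])).continuousAt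
  have hev : ∀ᶠ z in 𝓝 (0 : E d), |ω z| < κ :=
    hc0.abs.eventually_lt continuousAt_const (by simpa [h.zero] using hκ)
  obtain ⟨r, hr, hball⟩ := Metric.nhds_basis_closedBall.eventually_iff.1 hev
  exact ⟨r, hr, fun z hz => (hball (by simpa using hz)).le⟩

/-- The matrix of the quadratic form `|x̃|²`. -/
def tildeForm (d : ℕ) : Matrix (Fin (d + 1)) (Fin (d + 1)) ℝ :=
  Matrix.diagonal (Fin.snoc (α := fun _ => ℝ) (fun _ => 1) 0)

theorem inner_tildeForm (x : E (d + 1)) :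
    inner ℝ x (Matrix.toEuclideanCLM (n := Fin (d + 1)) (𝕜 := ℝ) (tildeForm d) x)
      = ‖tilde x‖ ^ 2 := by
  rw [Matrix.inner_toEuclideanCLM, EuclideanSpace.norm_sq_eq, dotProduct, Fin.sum_univ_castSucc]
  simp [tildeForm, Matrix.mulVec_diagonal, tilde, sq]

theorem tiltedHeight_tildeForm (ω : E d → ℝ) (β : ℝ) (x : E (d + 1)) :
    tiltedHeight ω β (tildeForm d) x = height ω x + β / 2 * ‖tilde x‖ ^ 2 := by
  rw [tiltedHeight, inner_tildeForm]

theorem tiltedHeight_one (ω : E d → ℝ) (β : ℝ) (x : E (d + 1)) :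
    tiltedHeight ω β 1 x = height ω x + β / 2 * ‖x‖ ^ 2 := by
  rw [tiltedHeight, map_one, one_apply_eq_self, real_inner_self_eq_norm_sq]

theorem norm_le_tilde_add (x : E (d + 1)) : ‖x‖ ≤ ‖tilde x‖ + |lastCoord x| := by
  refine abs_le_of_sq_le_sq' ?_ (by positivity) |>.2
  rw [norm_sq_eq_tilde, ← sq_abs (lastCoord x)]
  nlinarith [norm_nonneg (tilde x), abs_nonneg (lastCoord x)]

/-- The region between the graph of `ω` and the level set of the corrected height. -/
def lensDomain (Ω : Set (E (d + 1))) (ω : E d → ℝ) (r β : ℝ) : Set (E (d + 1)) :=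
  {x | x ∈ Ω ∧ β / 2 * ‖tilde x‖ ^ 2 < height ω x + β / 2 * ‖tilde x‖ ^ 2 ∧
    height ω x + β / 2 * ‖tilde x‖ ^ 2 < β / 2 * r ^ 2}

section Lens

variable {r β : ℝ}

/-- The two bounds on y force |x̃| < r, and the bound on ω keeps the lens inside the cylinder, where
membership in Ω is the sign of the height. -/
theorem IsStdGraph.mem_lensDomain_iff (h : IsStdGraph Ω ω ρ) (hr : 0 < r) (hrρ : r < ρ)
    (hβ : 0 < β) (hω : ∀ z : E d, ‖z‖ ≤ r → |ω z| + β / 2 * r ^ 2 < ρ) {x : E (d + 1)} :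
    x ∈ lensDomain Ω ω r β ↔ ‖tilde x‖ < r ∧ 0 < height ω x ∧
      height ω x + β / 2 * ‖tilde x‖ ^ 2 < β / 2 * r ^ 2 := by
  constructor
  · rintro ⟨-, h1, h2⟩
    have h3 : β / 2 * ‖tilde x‖ ^ 2 < β / 2 * r ^ 2 := h1.trans h2
    exact ⟨lt_of_pow_lt_pow_left₀ 2 hr.le (lt_of_mul_lt_mul_left h3 (by positivity)),
      by linarith, h2⟩
  · rintro ⟨h1, h2, h3⟩
    refine ⟨(h.mem_iff x (h1.trans hrρ) ?_).2 h2, by linarith, h3⟩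
    have h4 := hω _ h1.le
    have h5 : 0 ≤ β / 2 * ‖tilde x‖ ^ 2 := by positivity
    rw [height] at h2 h3
    rw [abs_lt]
    constructor <;> linarith [neg_abs_le (ω (tilde x)), le_abs_self (ω (tilde x))]

theorem IsStdGraph.isOpen_lensDomain (h : IsStdGraph Ω ω ρ) (hr : 0 < r) (hrρ : r < ρ)
    (hβ : 0 < β) (hω : ∀ z : E d, ‖z‖ ≤ r → |ω z| + β / 2 * r ^ 2 < ρ) :
    IsOpen (lensDomain Ω ω r β) := by
  refine isOpen_iff_mem_nhds.2 fun x hx => ?_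
  have hx' := (h.mem_lensDomain_iff hr hrρ hβ hω).1 hx
  have hc := h.continuousAt_height (hx'.1.trans hrρ)
  have hn : ContinuousAt (fun x : E (d + 1) => β / 2 * ‖tilde x‖ ^ 2) x :=
    (((tildeL (d := d)).continuous.norm.pow 2).const_mul (β / 2)).continuousAt
  filter_upwards [h.isOpen.mem_nhds hx.1, hn.eventually_lt (hc.add hn) hx.2.1,
    (hc.add hn).eventually_lt continuousAt_const hx.2.2] with y h1 h2 h3
  exact ⟨h1, h2, h3⟩

/-- The parametrization of the lens domain by a cylinder. -/
noncomputable def lensMap (ω : E d → ℝ) (r β : ℝ) (x : E d × ℝ) : E (d + 1) :=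
  graphPoint x.1 (ω x.1 + x.2 * (β / 2 * (r ^ 2 - ‖x.1‖ ^ 2)))

theorem IsStdGraph.continuousOn_lensMap (h : IsStdGraph Ω ω ρ) (r β : ℝ) :
    ContinuousOn (lensMap ω r β) (ball 0 ρ ×ˢ univ) := by
  have h1 : ContinuousOn (fun x : E d × ℝ => ω x.1) (ball 0 ρ ×ˢ univ) :=
    h.contDiffOn.continuousOn.comp continuousOn_fst fun x hx => hx.1
  have h2 : ContinuousOn (fun x : E d × ℝ =>
      (x.1, ω x.1 + x.2 * (β / 2 * (r ^ 2 - ‖x.1‖ ^ 2)))) (ball 0 ρ ×ˢ univ) := by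
    have h3 : Continuous fun x : E d × ℝ => x.2 * (β / 2 * (r ^ 2 - ‖x.1‖ ^ 2)) := by fun_prop
    exact continuousOn_fst.prodMk (h1.add h3.continuousOn)
  exact (pairL (d := d)).continuous.comp_continuousOn h2

theorem height_lensMap (ω : E d → ℝ) (r β : ℝ) (x : E d × ℝ) :
    height ω (lensMap ω r β x) = x.2 * (β / 2 * (r ^ 2 - ‖x.1‖ ^ 2)) :=
  height_graphPoint _ _ _

theorem IsStdGraph.image_lensMap (h : IsStdGraph Ω ω ρ) (hr : 0 < r) (hrρ : r < ρ)
    (hβ : 0 < β) (hω : ∀ z : E d, ‖z‖ ≤ r → |ω z| + β / 2 * r ^ 2 < ρ) :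
    lensMap ω r β '' (ball 0 r ×ˢ Ioo 0 1) = lensDomain Ω ω r β := by
  ext x
  rw [h.mem_lensDomain_iff hr hrρ hβ hω]
  have hpos : ∀ z : E d, ‖z‖ < r → 0 < β / 2 * (r ^ 2 - ‖z‖ ^ 2) := fun z hz =>
    mul_pos (by positivity) (by nlinarith [norm_nonneg z])
  constructor
  · rintro ⟨⟨z, t⟩, ⟨hz, ht0, ht1⟩, rfl⟩
    rw [mem_ball_zero_iff] at hz
    have := hpos z hz
    rw [height_lensMap]
    refine ⟨by simpa [lensMap] using hz, mul_pos ht0 this, ?_⟩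
    simp only [lensMap, tilde_graphPoint]
    dsimp only at ht1 ht0 this ⊢
    nlinarith
  · rintro ⟨h1, h2, h3⟩
    have := hpos _ h1
    refine ⟨(tilde x, height ω x / (β / 2 * (r ^ 2 - ‖tilde x‖ ^ 2))),
      ⟨by simpa using h1, div_pos h2 this, (div_lt_one this).2 (by linarith)⟩, ?_⟩
    refine ext_tilde (by simp [lensMap]) ?_
    simp only [lensMap, lastCoord_graphPoint]
    rw [div_mul_cancel₀ _ this.ne', height]
    ring

/-- The point is the image of (x̃, 0), on the bottom of the closed cylinder, under the continuous
parametrization of the lens. This includes the rim |x̃| = r, where the lens has zero thickness. -/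
theorem IsStdGraph.mem_closure_lensDomain (h : IsStdGraph Ω ω ρ) (hr : 0 < r) (hrρ : r < ρ)
    (hβ : 0 < β) (hω : ∀ z : E d, ‖z‖ ≤ r → |ω z| + β / 2 * r ^ 2 < ρ) {x : E (d + 1)}
    (hx : ‖tilde x‖ ≤ r) (hx0 : height ω x = 0) : x ∈ closure (lensDomain Ω ω r β) := by
  have hcl : ((tilde x, 0) : E d × ℝ) ∈ closure (ball (0 : E d) r ×ˢ Ioo (0 : ℝ) 1) := by
    rw [closure_prod_eq, closure_ball _ hr.ne', closure_Ioo (by norm_num)]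
    exact ⟨by simpa using hx, by simp⟩
  have hc : ContinuousWithinAt (lensMap ω r β) (ball (0 : E d) r ×ˢ Ioo (0 : ℝ) 1)
      (tilde x, 0) := by
    refine (h.continuousOn_lensMap r β _ ⟨?_, mem_univ _⟩).mono
      (prod_mono (ball_subset_ball hrρ.le) (subset_univ _))
    simpa using hx.trans_lt hrρ
  have := hc.mem_closure_image hcl
  rw [h.image_lensMap hr hrρ hβ hω] at this
  convert this using 1
  refine ext_tilde (by simp [lensMap]) ?_
  simp only [lensMap, lastCoord_graphPoint, zero_mul, add_zero]
  rw [height] at hx0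
  linarith

theorem IsStdGraph.closure_lensDomain_subset (h : IsStdGraph Ω ω ρ) (hr : 0 < r) (hrρ : r < ρ)
    (hβ : 0 < β) (hω : ∀ z : E d, ‖z‖ ≤ r → |ω z| + β / 2 * r ^ 2 < ρ) {x : E (d + 1)}
    (hx : x ∈ closure (lensDomain Ω ω r β)) : ‖tilde x‖ ≤ r ∧ 0 ≤ height ω x ∧
      height ω x + β / 2 * ‖tilde x‖ ^ 2 ≤ β / 2 * r ^ 2 ∧ |lastCoord x| ≤
        |ω (tilde x)| + β / 2 * r ^ 2 := by
  have hD := fun y (hy : y ∈ lensDomain Ω ω r β) => (h.mem_lensDomain_iff hr hrρ hβ hω).1 hy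
  have hn : Continuous fun x : E (d + 1) => ‖tilde x‖ := (tildeL (d := d)).continuous.norm
  have h1 : ‖tilde x‖ ≤ r := ContinuousWithinAt.closure_le hx hn.continuousWithinAt
    continuousWithinAt_const fun y hy => (hD y hy).1.le
  have hc := (h.continuousAt_height (h1.trans_lt hrρ)).continuousWithinAt
    (s := lensDomain Ω ω r β)
  have h2 : 0 ≤ height ω x := ContinuousWithinAt.closure_le hx continuousWithinAt_const hc
    fun y hy => (hD y hy).2.1.le
  have h3 : height ω x + β / 2 * ‖tilde x‖ ^ 2 ≤ β / 2 * r ^ 2 :=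
    ContinuousWithinAt.closure_le hx (hc.add ((hn.pow 2).const_mul (β / 2)).continuousWithinAt)
      continuousWithinAt_const fun y hy => (hD y hy).2.2.le
  refine ⟨h1, h2, h3, ?_⟩
  have h5 : 0 ≤ β / 2 * ‖tilde x‖ ^ 2 := by positivity
  have h6 : 0 ≤ β / 2 * r ^ 2 := by positivity
  rw [height] at h2 h3
  rw [abs_le]
  constructor <;> linarith [neg_abs_le (ω (tilde x)), le_abs_self (ω (tilde x))]

theorem IsStdGraph.isAttachedSubdomain_lensDomain (h : IsStdGraph Ω ω ρ) (hr : 0 < r)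
    (hrρ : r < ρ) (hβ : 0 < β) (hω : ∀ z : E d, ‖z‖ ≤ r → |ω z| + β / 2 * r ^ 2 < ρ) :
    IsAttachedSubdomain Ω {x | ‖tilde x‖ ≤ r ∧ |lastCoord x| < ρ} (lensDomain Ω ω r β) := by
  have hopen := h.isOpen_lensDomain hr hrρ hβ hω
  have hcl := fun x hx => h.closure_lensDomain_subset hr hrρ hβ hω (x := x) hx
  refine ⟨hopen, ?_, fun x hx => ⟨hx.1, ?_⟩, ?_⟩
  · rw [← h.image_lensMap hr hrρ hβ hω]
    refine (((convex_ball 0 r).prod (convex_Ioo 0 1)).isConnected ?_).image _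
      ((h.continuousOn_lensMap r β).mono (prod_mono (ball_subset_ball hrρ.le) (subset_univ _)))
    exact ⟨(0, 1 / 2), by simpa using hr, by norm_num⟩
  · obtain ⟨h1, -, -, h4⟩ := hcl x (subset_closure hx)
    exact ⟨h1, h4.trans_lt (hω _ h1)⟩
  · ext x
    constructor
    · rintro ⟨hx, hx'⟩
      obtain ⟨h1, -, -, h4⟩ := hcl x hx.1
      exact ⟨hx', h1, h4.trans_lt (hω _ h1)⟩
    · rintro ⟨hx, h1, h2⟩
      have h0 := (h.mem_frontier_iff (h1.trans_lt hrρ) h2).1 hx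
      refine ⟨?_, hx⟩
      rw [hopen.frontier_eq]
      refine ⟨h.mem_closure_lensDomain hr hrρ hβ hω h1 h0, fun hx2 => ?_⟩
      exact ((h.mem_lensDomain_iff hr hrρ hβ hω).1 hx2).2.1.ne' h0

end Lens

theorem tildeForm_isSymm : (tildeForm d).IsSymm := Matrix.diagonal_transpose _

/-- The explicit kernel in standard coordinates. -/
theorem IsStdGraph.exists_isKernel_lens (h : IsStdGraph Ω ω ρ) {m : ℕ}
    (hpos : ∀ q < m, 0 < dirTrace q (graphHess ω 0) (graphGrad ω 0).ofLp) :
    ∃ r₀ : ℝ, 0 < r₀ ∧ ∃ β₁ : ℝ, 0 < β₁ ∧ ∀ r : ℝ, 0 < r → r ≤ r₀ → ∀ β : ℝ, 0 < β → β ≤ β₁ →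
      IsKernel m Ω 0 {x | ‖tilde x‖ ≤ r ∧ |lastCoord x| < ρ} (lensDomain Ω ω r β) fun x =>
        8 / 3 * ((height ω x + β / 2 * ‖tilde x‖ ^ 2) / (β * r ^ 2)
          * ((height ω x + β / 2 * ‖tilde x‖ ^ 2) / (2 * β * r ^ 2) - 1)) := by
  obtain ⟨δ, hδ, S₀, hS₀, hadm⟩ := h.exists_isMAdmissible hpos tildeForm_isSymm
  have hρ := h.pos
  -- On the closed lens |x̃|, |ω| and (β/2)r² are each at most κ, so |x| ≤ 3κ < δ.
  set κ := min δ ρ / 4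
  have hκ : 0 < κ := by positivity
  have hκδ : 4 * κ ≤ δ := by have := min_le_left δ ρ; simp only [κ]; linarith
  have hκρ : 4 * κ ≤ ρ := by have := min_le_right δ ρ; simp only [κ]; linarith
  obtain ⟨r₁, hr₁, hω₁⟩ := h.exists_abs_le hκ
  refine ⟨min (min r₁ κ) 1, by positivity, min κ (1 / S₀), by positivity,
    fun r hr hr0 β hβ hβ1 => ?_⟩
  have hrr₁ : r ≤ r₁ := hr0.trans ((min_le_left _ _).trans (min_le_left _ _))
  have hrκ : r ≤ κ := hr0.trans ((min_le_left _ _).trans (min_le_right _ _))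
  have hr1 : r ≤ 1 := hr0.trans (min_le_right _ _)
  have hβκ : β ≤ κ := hβ1.trans (min_le_left _ _)
  have hβS : β ≤ 1 / S₀ := hβ1.trans (min_le_right _ _)
  have hrsq : r ^ 2 ≤ 1 := by nlinarith
  have hβr : β / 2 * r ^ 2 ≤ κ := by nlinarith
  have hrρ : r < ρ := by linarith
  have hωκ : ∀ z : E d, ‖z‖ ≤ r → |ω z| ≤ κ := fun z hz => hω₁ z (hz.trans hrr₁)
  have hω : ∀ z : E d, ‖z‖ ≤ r → |ω z| + β / 2 * r ^ 2 < ρ := fun z hz => by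
    linarith [hωκ z hz]
  have hcl := fun x hx => h.closure_lensDomain_subset hr hrρ hβ hω (x := x) hx
  have hβr2 : 0 < β * r ^ 2 := by positivity
  -- The profile with S = 1/(βr²) and a = 8/(3βr²). The constraints r ≤ 1 and β ≤ 1/S₀ ensure S ≥
  -- S₀, and y ≤ (β/2)r² gives Sy ≤ 1/2.
  have hW : (fun x : E (d + 1) => 8 / 3 * ((height ω x + β / 2 * ‖tilde x‖ ^ 2) / (β * r ^ 2)
        * ((height ω x + β / 2 * ‖tilde x‖ ^ 2) / (2 * β * r ^ 2) - 1)))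
      = fun x => 8 / (3 * (β * r ^ 2)) * (1 / (β * r ^ 2) / 2
        * tiltedHeight ω β (tildeForm d) x ^ 2 - tiltedHeight ω β (tildeForm d) x) := by
    ext1 x
    rw [tiltedHeight_tildeForm]
    field_simp
  have hopen := h.isOpen_lensDomain hr hrρ hβ hω
  refine ⟨h.isAttachedSubdomain_lensDomain hr hrρ hβ hω, ?_, ?_, ?_, ?_⟩
  · rw [hW]
    refine hadm β ?_ _ ?_ _ (by positivity) _ fun x hx => ?_
    · rw [abs_of_pos hβ]; linarith
    · rw [ge_iff_le, le_div_iff₀ hβr2]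
      rw [le_div_iff₀ hS₀] at hβS
      nlinarith [mul_pos hβ hS₀]
    · obtain ⟨h1, h2, h3, h4⟩ := hcl x hx
      rw [tiltedHeight_tildeForm]
      refine ⟨?_, by positivity, ?_⟩
      · have := norm_le_tilde_add x
        linarith [hωκ _ h1]
      · rw [div_mul_eq_mul_div, one_mul, div_lt_one hβr2]
        linarith
  · simp [h.height_zero]
  · intro x hx
    obtain ⟨h1, h2, h3, -⟩ := hcl x hx.1
    set y := height ω x + β / 2 * ‖tilde x‖ ^ 2
    have hy : 0 ≤ y := by positivity
    refine mul_nonpos_of_nonneg_of_nonpos (by norm_num)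
      (mul_nonpos_of_nonneg_of_nonpos (by positivity) ?_)
    rw [sub_nonpos, div_le_one (by positivity)]
    linarith
  · rintro x ⟨hx, hxΩ⟩
    rw [hopen.frontier_eq] at hx
    obtain ⟨h1, h2, h3, h4⟩ := hcl x hx.1
    have hpos := (h.mem_iff x (h1.trans_lt hrρ) (h4.trans_lt (hω _ h1))).1 hxΩ
    -- A frontier point inside Ω can only violate the upper constraint on y. There W =
    -- (8/3)(1/2)(1/4 - 1) = -1, which explains the factor 8/3.
    have hy : height ω x + β / 2 * ‖tilde x‖ ^ 2 = β / 2 * r ^ 2 := by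
      refine le_antisymm h3 (not_lt.1 fun hlt => hx.2 ⟨hxΩ, by linarith, hlt⟩)
    rw [hy]
    apply le_of_eq
    field_simp
    norm_num

end Kernels

/-! ### Kernels on small balls -/

section BallKernel

variable {d : ℕ} {Ω : Set (E (d + 1))} {ω : E d → ℝ} {ρ : ℝ}

theorem IsStdGraph.hasStrictFDerivAt_height (h : IsStdGraph Ω ω ρ) :
    HasStrictFDerivAt (height ω)
      (InnerProductSpace.toDual ℝ (E (d + 1)) (graphGrad ω 0)) (0 : E (d + 1)) := by
  have hc : ContDiffAt ℝ 2 (height ω) (0 : E (d + 1)) := by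
    have h1 : ContDiffAt ℝ 2 ω (tildeL (0 : E (d + 1))) :=
      contDiffAt_of_mem_ball h.contDiffOn (by simp [h.pos])
    exact (lastL (d := d)).contDiff.contDiffAt.sub
      (h1.comp (0 : E (d + 1)) (tildeL (d := d)).contDiff.contDiffAt)
  have := hc.hasStrictFDerivAt (by norm_num)
  rwa [(hasGradientAt_height (x := (0 : E (d + 1))) h.contDiffOn
    (by simp [h.pos])).hasFDerivAt.fderiv] at this

/-- Small balls intersected with `Ω` are star-shaped, also with respect to boundary points. -/
theorem IsStdGraph.exists_star_ball (h : IsStdGraph Ω ω ρ) :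
    ∃ r₀ : ℝ, 0 < r₀ ∧ r₀ ≤ ρ ∧ ∀ r : ℝ, 0 < r → r < r₀ → ∃ c : E (d + 1), ∀ x : E (d + 1),
      ‖x‖ ≤ r → 0 ≤ height ω x → ∀ t : ℝ, 0 < t → t ≤ 1 → (1 - t) • x + t • c ∈ Ω ∩ ball 0 r := by
  set p : E (d + 1) := graphGrad ω 0
  have hP : 0 < ‖p‖ := norm_pos_iff.2 (graphGrad_ne_zero ω 0)
  have hP16 : 0 < ‖p‖ / 16 := by positivity
  -- Near the origin the height is linear up to a Lipschitz error with constant |p|/16, small enough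
  -- for both cases below.
  obtain ⟨s, hs, happ⟩ := h.hasStrictFDerivAt_height.approximates_deriv_on_nhds
    (c := ⟨‖p‖ / 16, hP16.le⟩) (Or.inr hP16)
  obtain ⟨δ, hδ, hball⟩ := Metric.mem_nhds_iff.1 hs
  have happ' : ∀ x y : E (d + 1), ‖x‖ < δ → ‖y‖ < δ →
      height ω y + inner ℝ p (x - y) - ‖p‖ / 16 * ‖x - y‖ ≤ height ω x := by
    intro x y hx hy
    have := happ x (hball (by simpa using hx)) y (hball (by simpa using hy))
    rw [InnerProductSpace.toDual_apply_apply, Real.norm_eq_abs] at this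
    have h2 := (abs_le.1 this).1
    change -(‖p‖ / 16 * ‖x - y‖) ≤ height ω x - height ω y - inner ℝ p (x - y) at h2
    linarith
  refine ⟨min δ ρ, lt_min hδ h.pos, min_le_right _ _, fun r hr hrδ => ?_⟩
  set c : E (d + 1) := (r / 2) • ‖p‖⁻¹ • p
  have hcn : ‖c‖ = r / 2 := by
    rw [norm_smul, norm_smul, norm_inv, norm_norm, inv_mul_cancel₀ hP.ne', mul_one,
      Real.norm_eq_abs, abs_of_pos (by positivity)]
  have hpc : inner ℝ p c = ‖p‖ * r / 2 := by
    rw [real_inner_smul_right, real_inner_smul_right, real_inner_self_eq_norm_sq]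
    field_simp
  have hrδ' : r < δ := hrδ.trans_le (min_le_left _ _)
  refine ⟨c, fun x hx hx0 t ht ht1 => ?_⟩
  set w := (1 - t) • x + t • c
  have hw : ‖w‖ < r := by
    calc ‖w‖ ≤ ‖(1 - t) • x‖ + ‖t • c‖ := norm_add_le _ _
      _ = (1 - t) * ‖x‖ + t * (r / 2) := by
        rw [norm_smul, norm_smul, hcn, Real.norm_of_nonneg (by linarith),
          Real.norm_of_nonneg ht.le]
      _ ≤ (1 - t) * r + t * (r / 2) := by
        have := mul_le_mul_of_nonneg_left hx (by linarith : 0 ≤ 1 - t)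
        linarith
      _ < r := by nlinarith
  have hwx : w - x = t • (c - x) := by simp only [w]; module
  have hheight : 0 < height ω w := by
    -- If x is low, moving towards c gains at least t|p|r/4 and the error is at most t|p|r/8, so w
    -- is compared with x. If x is high, w is compared with 0: ⟨p, w⟩ ≥ |p|r/4 exceeds the error
    -- |p|r/16.
    rcases le_or_gt (inner ℝ p x) (‖p‖ * r / 4) with hle | hgt
    · have h1 := happ' w x (hw.trans hrδ') (hx.trans_lt hrδ')
      rw [hwx, norm_smul, Real.norm_of_nonneg ht.le, real_inner_smul_right, inner_sub_right,
        hpc] at h1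
      have h2 : ‖c - x‖ ≤ 2 * r := by linarith [norm_sub_le c x]
      have h3 : t * (‖p‖ * r / 4) ≤ t * (‖p‖ * r / 2 - inner ℝ p x) :=
        mul_le_mul_of_nonneg_left (by linarith) ht.le
      have h4 : ‖p‖ / 16 * (t * ‖c - x‖) ≤ ‖p‖ / 16 * (t * (2 * r)) := by gcongr
      have h5 : 0 < t * (‖p‖ * r) := by positivity
      linarith
    · have h1 := happ' w 0 (hw.trans hrδ') (by simpa using hδ)
      rw [h.height_zero, sub_zero, zero_add] at h1
      have h2 : inner ℝ p w = (1 - t) * inner ℝ p x + t * (‖p‖ * r / 2) := by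
        simp only [w]
        rw [inner_add_right, real_inner_smul_right, real_inner_smul_right, hpc]
      have h3 : (1 - t) * (‖p‖ * r / 4) ≤ (1 - t) * inner ℝ p x :=
        mul_le_mul_of_nonneg_left hgt.le (by linarith)
      have h4 : ‖p‖ / 16 * ‖w‖ ≤ ‖p‖ / 16 * r := by gcongr
      have h5 : 0 < ‖p‖ * r := by positivity
      nlinarith
  have hwρ : ‖w‖ < ρ := hw.trans (hrδ.trans_le (min_le_right _ _))
  exact ⟨(h.mem_iff w ((norm_tilde_le w).trans_lt hwρ) ((abs_lastCoord_le w).trans_lt hwρ)).2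
    hheight, by simpa using hw⟩

/-- Kernels attached to the pieces of the boundary cut out by small balls. -/
theorem IsStdGraph.exists_isKernel_ball (h : IsStdGraph Ω ω ρ) {m : ℕ}
    (hpos : ∀ q < m, 0 < dirTrace q (graphHess ω 0) (graphGrad ω 0).ofLp) :
    ∃ r₀ : ℝ, 0 < r₀ ∧ ∀ r : ℝ, 0 < r → r ≤ r₀ → ∃ (D : Set (E (d + 1))) (W : E (d + 1) → ℝ),
      IsKernel m Ω 0 (closedBall 0 r) D W := by
  -- With J = 1 the correction is (β/2)|x|², which bounds y from below on the sphere |x| = r.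
  obtain ⟨δ, hδ, S, hS, hadm⟩ := h.exists_isMAdmissible hpos (J := 1) Matrix.isSymm_one
  obtain ⟨r₁, hr₁, hr₁ρ, hstar⟩ := h.exists_star_ball
  set β := δ / 2
  have hβ : 0 < β := by positivity
  set y : E (d + 1) → ℝ := tiltedHeight ω β 1
  have hy0 : S * y 0 = 0 := by simp [y, tiltedHeight_one, h.height_zero]
  have hyc : ContinuousAt y 0 :=
    (hasGradientAt_tiltedHeight h.contDiffOn β Matrix.isSymm_one (x := (0 : E (d + 1)))
      (by simp [h.pos])).hasFDerivAt.continuousAt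
  have hev : ∀ᶠ x in 𝓝 (0 : E (d + 1)), S * y x < 1 :=
    (hyc.const_mul S).eventually_lt continuousAt_const (by rw [hy0]; norm_num)
  obtain ⟨r₂, hr₂, hball⟩ := Metric.nhds_basis_closedBall.eventually_iff.1 hev
  refine ⟨min (r₁ / 2) (min r₂ (δ / 2)), by positivity, fun r hr hr0 => ?_⟩
  have hrr₁ : r < r₁ := by linarith [min_le_left (r₁ / 2) (min r₂ (δ / 2))]
  have hrr₂ : r ≤ r₂ := hr0.trans ((min_le_right _ _).trans (min_le_left _ _))
  have hrδ : r < δ := by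
    linarith [hr0.trans ((min_le_right (r₁ / 2) _).trans (min_le_right r₂ (δ / 2)))]
  have hrρ : r < ρ := hrr₁.trans_le hr₁ρ
  obtain ⟨c, hc⟩ := hstar r hr hrr₁
  set D := Ω ∩ ball (0 : E (d + 1)) r
  have hopen : IsOpen D := h.isOpen.inter isOpen_ball
  have hmem : ∀ x : E (d + 1), ‖x‖ ≤ r → (x ∈ Ω ↔ 0 < height ω x) := fun x hx =>
    h.mem_iff x ((norm_tilde_le x).trans_lt (hx.trans_lt hrρ))
      ((abs_lastCoord_le x).trans_lt (hx.trans_lt hrρ))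
  have hcl : ∀ x ∈ closure D, ‖x‖ ≤ r ∧ 0 ≤ height ω x := by
    intro x hx
    have h1 : ‖x‖ ≤ r := ContinuousWithinAt.closure_le hx continuous_norm.continuousWithinAt
      continuousWithinAt_const fun z hz => (mem_ball_zero_iff.1 hz.2).le
    refine ⟨h1, ContinuousWithinAt.closure_le hx continuousWithinAt_const
      (h.continuousAt_height ((norm_tilde_le x).trans_lt (h1.trans_lt hrρ))).continuousWithinAt
      fun z hz => ((hmem z (mem_ball_zero_iff.1 hz.2).le).1 hz.1).le⟩
  have hcD : c ∈ D := by
    have := hc 0 (by simpa using hr.le) h.height_zero.ge 1 one_pos le_rfl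
    simpa using this
  have hy : ∀ x ∈ closure D, β / 2 * ‖x‖ ^ 2 ≤ y x ∧ S * y x < 1 := by
    intro x hx
    refine ⟨?_, hball (by simpa using (hcl x hx).1.trans hrr₂)⟩
    simp only [y, tiltedHeight_one]
    linarith [(hcl x hx).2]
  have hW : ∀ x ∈ closure D, 4 / (β * r ^ 2) * (S / 2 * y x ^ 2 - y x)
      ≤ 4 / (β * r ^ 2) * (-(y x / 2)) := by
    intro x hx
    obtain ⟨h1, h2⟩ := hy x hx
    have h3 : 0 ≤ y x := le_trans (by positivity) h1
    refine mul_le_mul_of_nonneg_left ?_ (by positivity)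
    nlinarith
  -- Since Sy < 1 the profile is at most -y/2, and y ≥ βr²/2 on the sphere, so the factor 4/(βr²)
  -- gives exactly -1.
  refine ⟨D, fun x => 4 / (β * r ^ 2) * (S / 2 * y x ^ 2 - y x), ⟨hopen, ?_, ?_, ?_⟩, ?_, ?_, ?_,
    ?_⟩
  · refine (StarConvex.isPathConnected (a := c) ?_ hcD).isConnected
    intro x hx a b ha hb hab
    rcases ha.eq_or_lt with rfl | ha'
    · rw [zero_add] at hab
      simpa [hab] using hx
    · have hxr := (mem_ball_zero_iff.1 hx.2).le
      have := hc x hxr ((hmem x hxr).1 hx.1).le a ha' (by linarith)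
      rwa [show 1 - a = b by linarith, add_comm (b • x)] at this
  · exact fun x hx => ⟨hx.1, ball_subset_closedBall hx.2⟩
  · ext x
    constructor
    · rintro ⟨hx, hx'⟩
      exact ⟨hx', by simpa using (hcl x hx.1).1⟩
    · rintro ⟨hx, hxr⟩
      rw [mem_closedBall_zero_iff] at hxr
      have h0 := (h.mem_frontier_iff ((norm_tilde_le x).trans_lt (hxr.trans_lt hrρ))
        ((abs_lastCoord_le x).trans_lt (hxr.trans_lt hrρ))).1 hx
      refine ⟨?_, hx⟩
      rw [hopen.frontier_eq]
      refine ⟨?_, fun hx2 => ((hmem x hxr).1 hx2.1).ne' h0⟩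
      -- The star property also holds from boundary points, including those with |x| = r, so the
      -- segment towards c approaches x from inside D.
      have ht : Filter.Tendsto (fun t : ℝ => (1 - t) • x + t • c) (𝓝[>] 0) (𝓝 x) := by
        have : Continuous fun t : ℝ => (1 - t) • x + t • c := by fun_prop
        have h2 := this.tendsto 0
        simp only [sub_zero, one_smul, zero_smul, add_zero] at h2
        exact h2.mono_left nhdsWithin_le_nhds
      refine mem_closure_of_tendsto ht ?_
      filter_upwards [Ioo_mem_nhdsGT (zero_lt_one' ℝ)] with t ht
      exact hc x hxr h0.ge t ht.1 ht.2.le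
  · refine hadm β ?_ S le_rfl _ (by positivity) D fun x hx => ?_
    · rw [abs_of_pos hβ]; simp only [β]; linarith
    · exact ⟨(hcl x hx).1.trans_lt hrδ, le_trans (by positivity) (hy x hx).1, (hy x hx).2⟩
  · have : y 0 = 0 := by simp [y, tiltedHeight_one, h.height_zero]
    simp [this]
  · intro x hx
    refine (hW x hx.1).trans (mul_nonpos_of_nonneg_of_nonpos (by positivity) ?_)
    have : 0 ≤ y x := le_trans (by positivity) (hy x hx.1).1
    linarith
  · rintro x ⟨hx, hxΩ⟩
    rw [hopen.frontier_eq] at hx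
    have hxr : r ≤ ‖x‖ := not_lt.1 fun hlt => hx.2 ⟨hxΩ, by simpa using hlt⟩
    refine (hW x hx.1).trans ?_
    have h1 : β / 2 * r ^ 2 ≤ y x := le_trans (by gcongr) (hy x hx.1).1
    have h2 : 4 / (β * r ^ 2) * (-(y x / 2)) ≤ 4 / (β * r ^ 2) * (-(β / 2 * r ^ 2 / 2)) := by
      gcongr
    refine h2.trans (le_of_eq ?_)
    field_simp
    norm_num

end BallKernel

/-! ### Second derivative test and derivatives on the side of a rectangle -/

section Calculus

/-- A positive second derivative would make x a local minimum as well, so φ would be constant near x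
and c would vanish. -/
theorem deriv_two_nonpos_of_isLocalMax {φ φ' : ℝ → ℝ} {c x : ℝ}
    (h1 : ∀ᶠ s in 𝓝 x, HasDerivAt φ (φ' s) s) (h2 : HasDerivAt φ' c x) (hmax : IsLocalMax φ x) :
    c ≤ 0 := by
  by_contra! hc
  have hd : deriv φ =ᶠ[𝓝 x] φ' := h1.mono fun s hs => hs.deriv
  have hdd : deriv (deriv φ) x = c := hd.deriv_eq.trans h2.deriv
  have hmin := isLocalMin_of_deriv_deriv_pos (f := φ) (x₀ := x) (by rw [hdd]; exact hc)
    hmax.deriv_eq_zero h1.self_of_nhds.continuousAt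
  have hconst : φ =ᶠ[𝓝 x] fun _ => φ x := by
    filter_upwards [hmax, hmin] with s hs hs' using le_antisymm hs hs'
  have hzero : φ' =ᶠ[𝓝 x] fun _ => 0 := by
    filter_upwards [h1, hconst.eventually_nhds] with s hs hs'
    exact hs.unique ((hasDerivAt_const s (φ x)).congr_of_eventuallyEq hs')
  exact hc.ne' (h2.unique ((hasDerivAt_const x (0 : ℝ)).congr_of_eventuallyEq hzero))

/-- One-sided extension of partial derivatives to the side `t = 0` of a rectangle. -/
theorem hasFDerivWithinAt_side {δ : ℝ} {f A B : ℝ × ℝ → ℝ}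
    (hf : ContinuousOn f (Icc (-δ) δ ×ˢ Icc 0 δ)) (hA : ContinuousOn A (Icc (-δ) δ ×ˢ Icc 0 δ))
    (hB : ContinuousOn B (Icc (-δ) δ ×ˢ Icc 0 δ))
    (hd : ∀ x ∈ Ioo (-δ) δ ×ˢ Ioo 0 δ, HasFDerivAt f
      (A x • ContinuousLinearMap.fst ℝ ℝ ℝ + B x • ContinuousLinearMap.snd ℝ ℝ ℝ) x)
    {s : ℝ} (hs : s ∈ Ioo (-δ) δ) :
    HasFDerivWithinAt f (A (s, 0) • ContinuousLinearMap.fst ℝ ℝ ℝ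
      + B (s, 0) • ContinuousLinearMap.snd ℝ ℝ ℝ) (Icc (-δ) δ ×ˢ Icc 0 δ) (s, 0) := by
  have hδ : 0 < δ := by have := hs.1.trans hs.2; linarith
  have hcl : closure (Ioo (-δ) δ ×ˢ Ioo 0 δ) = Icc (-δ) δ ×ˢ Icc 0 δ := by
    rw [closure_prod_eq, closure_Ioo (by linarith), closure_Ioo hδ.ne]
  have hsub : Ioo (-δ) δ ×ˢ Ioo 0 δ ⊆ Icc (-δ) δ ×ˢ Icc 0 δ := hcl ▸ subset_closure
  have hmem : (s, (0 : ℝ)) ∈ Icc (-δ) δ ×ˢ Icc 0 δ := ⟨Ioo_subset_Icc_self hs, le_rfl, hδ.le⟩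
  rw [← hcl]
  -- On a convex open set, continuity up to the boundary together with convergence of the derivative
  -- gives a derivative at the boundary point.
  refine hasFDerivWithinAt_closure_of_tendsto_fderiv
    (fun x hx => (hd x hx).differentiableAt.differentiableWithinAt)
    ((convex_Ioo _ _).prod (convex_Ioo _ _)) (isOpen_Ioo.prod isOpen_Ioo)
    (fun x hx => (hf x (hcl ▸ hx)).mono hsub) ?_
  have h1 : Filter.Tendsto (fun x => A x • ContinuousLinearMap.fst ℝ ℝ ℝ
      + B x • ContinuousLinearMap.snd ℝ ℝ ℝ) (𝓝[Ioo (-δ) δ ×ˢ Ioo 0 δ] (s, 0))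
      (𝓝 (A (s, 0) • ContinuousLinearMap.fst ℝ ℝ ℝ
        + B (s, 0) • ContinuousLinearMap.snd ℝ ℝ ℝ)) :=
    (((hA _ hmem).mono hsub).smul continuousWithinAt_const).add
      (((hB _ hmem).mono hsub).smul continuousWithinAt_const)
  refine h1.congr' ?_
  filter_upwards [self_mem_nhdsWithin] with x hx
  exact (hd x hx).fderiv.symm

/-- A kernel is differentiable only inside its domain. This turns continuous extension of the
gradient into a genuine two-sided derivative along the straightened boundary. -/
theorem hasDerivAt_side {δ : ℝ} {f A B : ℝ × ℝ → ℝ}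
    (hf : ContinuousOn f (Icc (-δ) δ ×ˢ Icc 0 δ)) (hA : ContinuousOn A (Icc (-δ) δ ×ˢ Icc 0 δ))
    (hB : ContinuousOn B (Icc (-δ) δ ×ˢ Icc 0 δ))
    (hd : ∀ x ∈ Ioo (-δ) δ ×ˢ Ioo 0 δ, HasFDerivAt f
      (A x • ContinuousLinearMap.fst ℝ ℝ ℝ + B x • ContinuousLinearMap.snd ℝ ℝ ℝ) x)
    {s : ℝ} (hs : s ∈ Ioo (-δ) δ) : HasDerivAt (fun s => f (s, 0)) (A (s, 0)) s := by
  have hδ : 0 < δ := by have := hs.1.trans hs.2; linarith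
  have h1 := hasFDerivWithinAt_side hf hA hB hd hs
  have h2 : HasDerivWithinAt (fun s : ℝ => (s, (0 : ℝ))) ((1 : ℝ), (0 : ℝ)) (Icc (-δ) δ) s :=
    ((hasDerivAt_id s).prodMk (hasDerivAt_const s (0 : ℝ))).hasDerivWithinAt
  have hmaps : MapsTo (fun s : ℝ => (s, (0 : ℝ))) (Icc (-δ) δ) (Icc (-δ) δ ×ˢ Icc 0 δ) :=
    fun t ht => ⟨ht, le_rfl, hδ.le⟩
  have h3 := h1.comp_hasDerivWithinAt s h2 hmaps
  have h4 := h3.hasDerivAt (Icc_mem_nhds hs.1 hs.2)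
  simpa [Function.comp_def] using h4

theorem hasDerivWithinAt_normal {δ : ℝ} (hδ : 0 < δ) {f A B : ℝ × ℝ → ℝ}
    (hf : ContinuousOn f (Icc (-δ) δ ×ˢ Icc 0 δ)) (hA : ContinuousOn A (Icc (-δ) δ ×ˢ Icc 0 δ))
    (hB : ContinuousOn B (Icc (-δ) δ ×ˢ Icc 0 δ))
    (hd : ∀ x ∈ Ioo (-δ) δ ×ˢ Ioo 0 δ, HasFDerivAt f
      (A x • ContinuousLinearMap.fst ℝ ℝ ℝ + B x • ContinuousLinearMap.snd ℝ ℝ ℝ) x) :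
    HasDerivWithinAt (fun t => f (0, t)) (B (0, 0)) (Icc 0 δ) 0 := by
  have h0 : (0 : ℝ) ∈ Ioo (-δ) δ := ⟨by linarith, hδ⟩
  have h1 := hasFDerivWithinAt_side hf hA hB hd h0
  have h2 : HasDerivWithinAt (fun t : ℝ => ((0 : ℝ), t)) ((0 : ℝ), (1 : ℝ)) (Icc 0 δ) 0 :=
    ((hasDerivAt_const (0 : ℝ) (0 : ℝ)).prodMk (hasDerivAt_id (0 : ℝ))).hasDerivWithinAt
  have hmaps : MapsTo (fun t : ℝ => ((0 : ℝ), t)) (Icc 0 δ) (Icc (-δ) δ ×ˢ Icc 0 δ) :=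
    fun t ht => ⟨Ioo_subset_Icc_self h0, ht⟩
  have h3 := h1.comp_hasDerivWithinAt (0 : ℝ) h2 hmaps
  simpa [Function.comp_def] using h3

end Calculus

/-! ### Weak maximum principle -/

section MaximumPrinciple

theorem single_dotProduct_toEuclideanCLM {n : ℕ} (H : Matrix (Fin n) (Fin n) ℝ) (i : Fin n) :
    inner ℝ (EuclideanSpace.single i (1 : ℝ)) (Matrix.toEuclideanCLM (n := Fin n) (𝕜 := ℝ) H
      (EuclideanSpace.single i 1)) = H i i := by
  rw [Matrix.inner_toEuclideanCLM]
  simp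

/-- The weak maximum principle for functions with Hessian matrices of positive trace. -/
theorem IsMAdmissible.nonpos_of_frontier {n m : ℕ} (hm : 1 ≤ m) {D : Set (E n)} {W : E n → ℝ}
    (hW : IsMAdmissible m D W) (hD : IsOpen D) (hb : Bornology.IsBounded D)
    (hfr : ∀ x ∈ frontier D, W x ≤ 0) : ∀ x ∈ closure D, W x ≤ 0 := by
  obtain ⟨H, ⟨G, hWc, hG, hHc, hd⟩, hpos⟩ := hW
  intro x hx
  obtain ⟨x₀, hx₀, hmax⟩ := (hb.isCompact_closure).exists_isMaxOn ⟨x, hx⟩ hWc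
  refine (hmax hx).trans (not_lt.1 fun hlt => ?_)
  have hx₀D : x₀ ∈ D := by
    by_contra hn
    exact (hfr x₀ (hD.frontier_eq ▸ ⟨hx₀, hn⟩)).not_gt hlt
  -- A positive maximum is interior. There every diagonal entry of the Hessian is a second
  -- derivative along a coordinate line, hence nonpositive, against the positive trace T_1.
  have htr := (hpos x₀ hx₀).2 1 hm
  rw [pTrace_one] at htr
  refine htr.not_ge (Finset.sum_nonpos fun i _ => ?_)
  rw [Matrix.diag_apply]
  set e : E n := EuclideanSpace.single i 1
  have hline : ∀ s : ℝ, HasDerivAt (fun s : ℝ => x₀ + s • e) e s := fun s => by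
    simpa using ((hasDerivAt_id s).smul_const e).const_add x₀
  have hl0 : x₀ + (0 : ℝ) • e = x₀ := by simp
  have hlc : Filter.Tendsto (fun s : ℝ => x₀ + s • e) (𝓝 0) (𝓝 x₀) := by
    have := (hline 0).continuousAt.tendsto
    rwa [hl0] at this
  refine deriv_two_nonpos_of_isLocalMax (φ := fun s => W (x₀ + s • e))
    (φ' := fun s => inner ℝ e (G (x₀ + s • e))) (x := 0) ?_ ?_ ?_
  · filter_upwards [hlc.eventually (hD.mem_nhds hx₀D)] with s hs
    have h1 := (hd _ hs).1.hasFDerivAt.comp_hasDerivAt s (hline s)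
    rw [InnerProductSpace.toDual_apply_apply, real_inner_comm] at h1
    exact h1
  · have h1 := (hd x₀ hx₀D).2
    rw [← hl0] at h1
    have h2 := h1.comp_hasDerivAt (0 : ℝ) (hline 0)
    have h3 := (hasDerivAt_const (0 : ℝ) e).inner ℝ h2
    rw [hl0, single_dotProduct_toEuclideanCLM, inner_zero_left, add_zero] at h3
    exact h3
  · have h1 : IsLocalMax W x₀ := by
      filter_upwards [hD.mem_nhds hx₀D] with y hy using hmax (subset_closure hy)
    filter_upwards [hlc.eventually h1] with s hs
    simpa using hs

end MaximumPrinciple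

/-! ### Necessity of convexity -/

section Necessity

variable {d : ℕ} {Ω : Set (E (d + 1))} {ω : E d → ℝ} {ρ : ℝ}

/-- The point at height `t` over the graph of `ω`. -/
def overGraph (ω : E d → ℝ) (x : E d × ℝ) : E (d + 1) := graphPoint x.1 (ω x.1 + x.2)

theorem IsStdGraph.continuousOn_overGraph (h : IsStdGraph Ω ω ρ) :
    ContinuousOn (overGraph ω) (ball 0 ρ ×ˢ univ) := by
  have h1 : ContinuousOn (fun x : E d × ℝ => ω x.1) (ball 0 ρ ×ˢ univ) :=
    h.contDiffOn.continuousOn.comp continuousOn_fst fun x hx => hx.1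
  exact (pairL (d := d)).continuous.comp_continuousOn
    (continuousOn_fst.prodMk (h1.add continuousOn_snd))

/-- The domain of a kernel fills `Ω` near the reference point. -/
theorem IsStdGraph.exists_overGraph_mem (h : IsStdGraph Ω ω ρ) {m : ℕ} {V D : Set (E (d + 1))}
    {W : E (d + 1) → ℝ} (hV : V ∈ 𝓝 0) (hK : IsKernel m Ω 0 V D W) :
    ∃ ε : ℝ, 0 < ε ∧ ε ≤ ρ ∧ ∀ z : E d, ‖z‖ < ε →
      overGraph ω (z, 0) ∈ frontier D ∧ ∀ t : ℝ, 0 < t → t < ε → overGraph ω (z, t) ∈ D := by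
  have hρ := h.pos
  obtain ⟨H, ⟨G, hWc, -, -, -⟩, -⟩ := hK.admissible
  have h0 : overGraph ω (0, 0) = 0 := ext_tilde (by simp [overGraph])
    (by simp [overGraph, h.zero])
  have h0fr : (0 : E (d + 1)) ∈ frontier D := by
    have h1 : (0 : E (d + 1)) ∈ frontier Ω ∩ V :=
      ⟨(h.mem_frontier_iff (by simpa) (by simpa)).2 h.height_zero, mem_of_mem_nhds hV⟩
    rw [← hK.attached.frontier_inter] at h1
    exact h1.1
  -- Continuity and W(0) = 0 keep the part of the frontier of D inside Ω, where W ≤ -1, away from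
  -- the origin.
  have hWev : ∀ᶠ x in 𝓝 (0 : E (d + 1)), x ∈ closure D → -1 < W x := by
    have hc := hWc 0 h0fr.1
    have h2 : ∀ᶠ x in 𝓝[closure D] (0 : E (d + 1)), -1 < W x :=
      continuousWithinAt_const.eventually_lt hc (by rw [hK.apply_eq_zero]; norm_num)
    exact eventually_nhdsWithin_iff.1 h2
  have hcyl := eventually_cylinder (x := (0 : E (d + 1))) (ρ := ρ) (by simpa) (by simpa)
  have hcont : ContinuousAt (overGraph ω) (0, 0) :=
    h.continuousOn_overGraph.continuousAt (prod_mem_nhds (ball_mem_nhds 0 hρ) Filter.univ_mem)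
  have hev := hcont.eventually (h0 ▸ (hWev.and (hcyl.and hV)))
  obtain ⟨ε', hε', hball⟩ := Metric.eventually_nhds_iff_ball.1 hev
  set ε := min ε' ρ
  have hε : 0 < ε := lt_min hε' hρ
  have hnear : ∀ z : E d, ‖z‖ < ε → ∀ t : ℝ, 0 ≤ t → t < ε →
      (overGraph ω (z, t) ∈ closure D → -1 < W (overGraph ω (z, t))) ∧
      (‖tilde (overGraph ω (z, t))‖ < ρ ∧ |lastCoord (overGraph ω (z, t))| < ρ) ∧
      overGraph ω (z, t) ∈ V := by
    intro z hz t ht0 ht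
    refine hball (z, t) ?_
    rw [mem_ball, Prod.dist_eq, dist_zero_right, dist_zero_right, Real.norm_of_nonneg ht0]
    exact max_lt (hz.trans_le (min_le_left _ _)) (ht.trans_le (min_le_left _ _))
  set box := overGraph ω '' (ball (0 : E d) ε ×ˢ Ioo 0 ε)
  have hboxΩ : ∀ x ∈ box, x ∈ Ω ∧ (x ∈ closure D → -1 < W x) := by
    rintro _ ⟨⟨z, t⟩, ⟨hz, ht0, ht1⟩, rfl⟩
    obtain ⟨h1, h2, -⟩ := hnear z (by simpa using hz) t ht0.le ht1
    refine ⟨(h.mem_iff _ h2.1 h2.2).2 ?_, h1⟩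
    rw [overGraph, height_graphPoint]
    exact ht0
  have hboxc : IsPreconnected box := by
    refine ((convex_ball (0 : E d) ε).prod (convex_Ioo 0 ε)).isPreconnected.image _
      (h.continuousOn_overGraph.mono (prod_mono (ball_subset_ball (min_le_right _ _))
        (subset_univ _)))
  have hne : (box ∩ D).Nonempty := by
    have hN : ∀ᶠ x in 𝓝 (0 : E (d + 1)), (‖tilde x‖ < ρ ∧ |lastCoord x| < ρ) ∧ ‖tilde x‖ < ε ∧
        height ω x < ε :=
      hcyl.and (((tildeL (d := d)).continuous.norm.continuousAt.eventually_lt continuousAt_const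
        (by simpa using hε)).and ((h.continuousAt_height (by simpa)).eventually_lt
          continuousAt_const (by rwa [h.height_zero])))
    obtain ⟨x, hxD, ⟨hx1, hx2⟩, hx3, hx4⟩ :=
      ((mem_closure_iff_frequently.1 h0fr.1).and_eventually hN).exists
    have hxΩ := (h.mem_iff x hx1 hx2).1 (hK.attached.subset hxD).1
    refine ⟨x, ⟨(tilde x, height ω x), ⟨by simpa using hx3, hxΩ, hx4⟩, ?_⟩, hxD⟩
    exact ext_tilde (by simp [overGraph]) (by simp [overGraph, height])
  -- The box above the graph is connected, meets D, and contains no frontier point of D, so D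
  -- swallows it.
  have hsub : box ⊆ D := by
    refine hboxc.subset_of_closure_inter_subset hK.attached.isOpen hne fun x hx => ?_
    by_contra hxD
    obtain ⟨h1, h2⟩ := hboxΩ x hx.2
    have := hK.le_neg_one x ⟨hK.attached.isOpen.frontier_eq ▸ ⟨hx.1, hxD⟩, h1⟩
    exact this.not_gt (h2 hx.1)
  refine ⟨ε, hε, min_le_right _ _, fun z hz => ⟨?_, fun t ht0 ht => hsub
    ⟨(z, t), ⟨by simpa using hz, ht0, ht⟩, rfl⟩⟩⟩
  obtain ⟨-, h2, h3⟩ := hnear z hz 0 le_rfl hε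
  have h4 : overGraph ω (z, 0) ∈ frontier Ω ∩ V :=
    ⟨(h.mem_frontier_iff h2.1 h2.2).2 (height_graphPoint _ _ _), h3⟩
  rw [← hK.attached.frontier_inter] at h4
  exact h4.1

/-- The tangent vector of the graph of `ω` at the point over `z`, in the direction `ξ`. -/
noncomputable def graphTangent (ω : E d → ℝ) (ξ z : E d) : E (d + 1) :=
  graphPoint ξ (fderiv ℝ ω z ξ)

/-- Along the boundary the Hessian of a kernel is controlled by the second fundamental form. -/
theorem IsStdGraph.exists_hessian_le (h : IsStdGraph Ω ω ρ) {m : ℕ} (hm : 1 ≤ m)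
    (hk : HasKernel m Ω 0) :
    ∃ H₀ : Matrix (Fin (d + 1)) (Fin (d + 1)) ℝ, IsMPositive m H₀ ∧ ∃ μ : ℝ, 0 ≤ μ ∧
      ∀ ξ : E d, inner ℝ (graphTangent ω ξ 0) (Matrix.toEuclideanCLM (n := Fin (d + 1)) (𝕜 := ℝ) H₀
        (graphTangent ω ξ 0)) ≤ μ * fderiv ℝ (fderiv ℝ ω) 0 ξ ξ := by
  obtain ⟨V, hV, hb, D, W, hK⟩ := hk
  obtain ⟨ε, hε, hερ, hover⟩ := h.exists_overGraph_mem hV hK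
  have hbD : Bornology.IsBounded D := hb.subset fun x hx => (hK.attached.subset hx).2
  have hneg := hK.admissible.nonpos_of_frontier hm hK.attached.isOpen hbD hK.le_zero
  obtain ⟨H, ⟨G, hWc, hGc, hHc, hd⟩, hpos⟩ := hK.admissible
  have hcl : ∀ z : E d, ‖z‖ < ε → ∀ t : ℝ, 0 ≤ t → t < ε → overGraph ω (z, t) ∈ closure D := by
    intro z hz t ht0 ht
    rcases ht0.eq_or_lt with rfl | ht0
    · exact (hover z hz).1.1
    · exact subset_closure ((hover z hz).2 t ht0 ht)
  have h0 : overGraph ω (0, 0) = 0 := ext_tilde (by simp [overGraph])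
    (by simp [overGraph, h.zero])
  set e : E (d + 1) := graphPoint 0 1
  -- The second inequality is the second derivative of W along the boundary curve s ↦ (sξ, ω(sξ));
  -- the term with ⟨G, e⟩ comes from the bending of that curve.
  have key : ∀ ξ : E d, inner ℝ (G 0) e ≤ 0 ∧
      inner ℝ (graphTangent ω ξ 0) (Matrix.toEuclideanCLM (n := Fin (d + 1)) (𝕜 := ℝ) (H 0)
        (graphTangent ω ξ 0)) + fderiv ℝ (fderiv ℝ ω) 0 ξ ξ * inner ℝ (G 0) e ≤ 0 := by
    intro ξ
    obtain ⟨δ, hδ, hδε, hδξ⟩ : ∃ δ : ℝ, 0 < δ ∧ δ < ε ∧ ∀ s ∈ Icc (-δ) δ, ‖s • ξ‖ < ε := by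
      refine ⟨ε / 2 / (1 + ‖ξ‖), by positivity, ?_, fun s hs => ?_⟩
      · rw [div_lt_iff₀ (by positivity)]
        nlinarith [norm_nonneg ξ]
      · rw [norm_smul, Real.norm_eq_abs]
        have h1 : |s| ≤ ε / 2 / (1 + ‖ξ‖) := abs_le.2 hs
        have h2 : |s| * (1 + ‖ξ‖) ≤ ε / 2 := (le_div_iff₀ (by positivity)).1 h1
        nlinarith [abs_nonneg s]
    set K := Icc (-δ) δ ×ˢ Icc (0 : ℝ) δ
    -- A surface swept by vertical translates of the curve. It straightens the boundary to the side
    -- t = 0, and its tangent T is independent of t.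
    let x : ℝ × ℝ → E (d + 1) := fun q => overGraph ω (q.1 • ξ, q.2)
    let T : ℝ × ℝ → E (d + 1) := fun q => graphTangent ω ξ (q.1 • ξ)
    let w : ℝ × ℝ → ℝ := fun q => fderiv ℝ (fderiv ℝ ω) (q.1 • ξ) ξ ξ
    have hρq : ∀ q ∈ K, ‖q.1 • ξ‖ < ρ := fun q hq => (hδξ _ hq.1).trans_le hερ
    have hxcl : MapsTo x K (closure D) := fun q hq =>
      hcl _ (hδξ _ hq.1) _ hq.2.1 (hq.2.2.trans_lt hδε)
    have hxD : ∀ q ∈ Ioo (-δ) δ ×ˢ Ioo (0 : ℝ) δ, x q ∈ D := fun q hq =>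
      (hover _ (hδξ _ (Ioo_subset_Icc_self hq.1))).2 _ hq.2.1 (hq.2.2.trans hδε)
    have hUK : Ioo (-δ) δ ×ˢ Ioo (0 : ℝ) δ ⊆ K :=
      prod_mono Ioo_subset_Icc_self Ioo_subset_Icc_self
    have hsm : ∀ q : ℝ × ℝ, HasFDerivAt (fun q : ℝ × ℝ => q.1 • ξ)
        ((ContinuousLinearMap.fst ℝ ℝ ℝ).smulRight ξ) q := fun q =>
      ((ContinuousLinearMap.fst ℝ ℝ ℝ).smulRight ξ).hasFDerivAt
    have hxd : ∀ q ∈ K, HasFDerivAt x ((ContinuousLinearMap.fst ℝ ℝ ℝ).smulRight (T q)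
        + (ContinuousLinearMap.snd ℝ ℝ ℝ).smulRight e) q := by
      intro q hq
      have h1 : HasFDerivAt ω (fderiv ℝ ω (q.1 • ξ)) (q.1 • ξ) :=
        ((contDiffAt_of_mem_ball h.contDiffOn (hρq q hq)).differentiableAt
          (by norm_num)).hasFDerivAt
      have h2 := (hsm q).prodMk ((HasFDerivAt.comp q (f := fun q : ℝ × ℝ => q.1 • ξ) h1
        (hsm q)).add hasFDerivAt_snd)
      have h3 := (pairL (d := d)).hasFDerivAt.comp q h2
      refine h3.congr_fderiv (ContinuousLinearMap.ext fun v => ?_)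
      change graphPoint (v.1 • ξ) (fderiv ℝ ω (q.1 • ξ) (v.1 • ξ) + v.2)
        = v.1 • graphPoint ξ (fderiv ℝ ω (q.1 • ξ) ξ) + v.2 • e
      refine ext_tilde ?_ ?_
      · simp only [← tildeL_apply, map_add, map_smul]
        simp [tildeL_apply, e]
      · simp only [← lastL_apply, map_add, map_smul]
        simp [lastL_apply, e]
    have hTd : ∀ q ∈ K, HasFDerivAt T
        ((ContinuousLinearMap.fst ℝ ℝ ℝ).smulRight (w q • e)) q := by
      intro q hq
      have h1 : HasFDerivAt (fderiv ℝ ω) (fderiv ℝ (fderiv ℝ ω) (q.1 • ξ)) (q.1 • ξ) :=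
        ((contDiffAt_fderiv h.contDiffOn (hρq q hq)).differentiableAt (by norm_num)).hasFDerivAt
      have h2 := (HasFDerivAt.comp q (f := fun q : ℝ × ℝ => q.1 • ξ) h1 (hsm q)).clm_apply
        (hasFDerivAt_const ξ q)
      have h3 := (pairL (d := d)).hasFDerivAt.comp q ((hasFDerivAt_const ξ q).prodMk h2)
      refine h3.congr_fderiv (ContinuousLinearMap.ext fun v => ?_)
      have h4 : pairL ((0 : E d), fderiv ℝ ω (q.1 • ξ) 0
          + fderiv ℝ (fderiv ℝ ω) (q.1 • ξ) (v.1 • ξ) ξ) = v.1 • w q • e := by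
        rw [pairL_apply]
        refine ext_tilde ?_ ?_
        · simp only [← tildeL_apply, map_smul]
          simp [tildeL_apply, e]
        · simp only [← lastL_apply, map_smul]
          simp [lastL_apply, e, w]
      exact h4
    have hxc : ContinuousOn x K := fun q hq => (hxd q hq).continuousAt.continuousWithinAt
    have hTc : ContinuousOn T K := fun q hq => (hTd q hq).continuousAt.continuousWithinAt
    have hwc : ContinuousOn w K := by
      intro q hq
      have h1 : ContinuousAt (fderiv ℝ (fderiv ℝ ω)) (q.1 • ξ) :=
        ((contDiffAt_fderiv h.contDiffOn (hρq q hq)).fderiv_right (m := 0)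
          (by norm_num)).continuousAt
      have h2 := ContinuousAt.comp (f := fun q : ℝ × ℝ => q.1 • ξ) h1 (hsm q).continuousAt
      exact ((h2.clm_apply continuousAt_const).clm_apply continuousAt_const).continuousWithinAt
    have hGx : ContinuousOn (fun q => G (x q)) K := hGc.comp hxc hxcl
    have hHx : ContinuousOn (fun q => H (x q)) K := hHc.comp hxc hxcl
    have hHL : ContinuousOn (fun q => Matrix.toEuclideanCLM (n := Fin (d + 1)) (𝕜 := ℝ)
        (H (x q))) K := by
      have hlin : Continuous (fun S : Matrix (Fin (d + 1)) (Fin (d + 1)) ℝ =>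
          Matrix.toEuclideanCLM (n := Fin (d + 1)) (𝕜 := ℝ) S) :=
        LinearMap.continuous_of_finiteDimensional
          (Matrix.toEuclideanCLM (n := Fin (d + 1)) (𝕜 := ℝ)).toAlgEquiv.toLinearMap
      exact hlin.comp_continuousOn hHx
    have hWx : ContinuousOn (fun q => W (x q)) K := hWc.comp hxc hxcl
    have hF : ∀ q ∈ Ioo (-δ) δ ×ˢ Ioo (0 : ℝ) δ, HasFDerivAt (fun q => W (x q))
        ((inner ℝ (G (x q)) (T q) : ℝ) • ContinuousLinearMap.fst ℝ ℝ ℝ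
          + (inner ℝ (G (x q)) e : ℝ) • ContinuousLinearMap.snd ℝ ℝ ℝ) q := by
      intro q hq
      refine ((hd _ (hxD q hq)).1.hasFDerivAt.comp q (hxd q (hUK hq))).congr_fderiv
        (ContinuousLinearMap.ext fun v => ?_)
      change inner ℝ (G (x q)) (v.1 • T q + v.2 • e)
        = inner ℝ (G (x q)) (T q) * v.1 + inner ℝ (G (x q)) e * v.2
      rw [inner_add_right, real_inner_smul_right, real_inner_smul_right]
      ring
    have hg : ∀ q ∈ Ioo (-δ) δ ×ˢ Ioo (0 : ℝ) δ,
        HasFDerivAt (fun q => (inner ℝ (G (x q)) (T q) : ℝ))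
        ((inner ℝ (T q) (Matrix.toEuclideanCLM (n := Fin (d + 1)) (𝕜 := ℝ) (H (x q)) (T q))
            + w q * inner ℝ (G (x q)) e : ℝ) • ContinuousLinearMap.fst ℝ ℝ ℝ
          + (inner ℝ (T q) (Matrix.toEuclideanCLM (n := Fin (d + 1)) (𝕜 := ℝ) (H (x q)) e) : ℝ)
            • ContinuousLinearMap.snd ℝ ℝ ℝ) q := by
      intro q hq
      have h1 := ((hd _ (hxD q hq)).2.comp q (hxd q (hUK hq))).inner ℝ (hTd q (hUK hq))
      refine h1.congr_fderiv (ContinuousLinearMap.ext fun v => ?_)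
      change inner ℝ (G (x q)) (v.1 • w q • e) + inner ℝ (Matrix.toEuclideanCLM (n := Fin (d + 1))
          (𝕜 := ℝ) (H (x q)) (v.1 • T q + v.2 • e)) (T q)
        = (inner ℝ (T q) (Matrix.toEuclideanCLM (n := Fin (d + 1)) (𝕜 := ℝ) (H (x q)) (T q))
            + w q * inner ℝ (G (x q)) e) * v.1
          + inner ℝ (T q) (Matrix.toEuclideanCLM (n := Fin (d + 1)) (𝕜 := ℝ) (H (x q)) e) * v.2
      rw [map_add, map_smul, map_smul, real_inner_comm (T q) (_ + _), inner_add_right,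
        real_inner_smul_right, real_inner_smul_right, real_inner_smul_right,
        real_inner_smul_right]
      ring
    have hA1 : ContinuousOn (fun q => (inner ℝ (G (x q)) (T q) : ℝ)) K := hGx.inner hTc
    have hB1 : ContinuousOn (fun q => (inner ℝ (G (x q)) e : ℝ)) K := hGx.inner continuousOn_const
    have hA2 : ContinuousOn (fun q => (inner ℝ (T q) (Matrix.toEuclideanCLM (n := Fin (d + 1))
        (𝕜 := ℝ) (H (x q)) (T q)) + w q * inner ℝ (G (x q)) e : ℝ)) K :=
      (hTc.inner (hHL.clm_apply hTc)).add (hwc.mul hB1)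
    have hB2 : ContinuousOn (fun q => (inner ℝ (T q) (Matrix.toEuclideanCLM (n := Fin (d + 1))
        (𝕜 := ℝ) (H (x q)) e) : ℝ)) K := hTc.inner (hHL.clm_apply continuousOn_const)
    have hx0 : x (0, 0) = 0 := by simp only [x, zero_smul, h0]
    have hT0 : T (0, 0) = graphTangent ω ξ 0 := by simp only [T, zero_smul]
    have hw0 : w (0, 0) = fderiv ℝ (fderiv ℝ ω) 0 ξ ξ := by simp only [w, zero_smul]
    have hδ0 : (0 : ℝ) ∈ Ioo (-δ) δ := ⟨by linarith, hδ⟩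
    constructor
    · have h1 := hasDerivWithinAt_normal hδ hWx hA1 hB1 hF
      rw [hx0] at h1
      have h2 : HasDerivWithinAt (fun t => W (x (0, t))) (inner ℝ (G 0) e) (Ioi 0) 0 :=
        (h1.mono Ioo_subset_Icc_self).mono_of_mem_nhdsWithin (Ioo_mem_nhdsGT hδ)
      have h3 := (hasDerivWithinAt_iff_tendsto_slope' (by simp)).1 h2
      -- Along the vertical segment W starts at 0 and stays nonpositive by the maximum principle.
      refine le_of_tendsto h3 ?_
      filter_upwards [Ioo_mem_nhdsGT hδ] with t ht
      rw [slope_def_field, hx0, hK.apply_eq_zero, sub_zero, sub_zero]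
      exact div_nonpos_of_nonpos_of_nonneg
        (hneg _ (hxcl ⟨Ioo_subset_Icc_self hδ0, Ioo_subset_Icc_self ht⟩)) ht.1.le
    · have h1 := hasDerivAt_side hA1 hA2 hB2 hg hδ0
      have h2 := deriv_two_nonpos_of_isLocalMax (φ := fun s => W (x (s, 0))) (x := 0)
        (Filter.eventually_of_mem (isOpen_Ioo.mem_nhds hδ0) fun s hs =>
          hasDerivAt_side hWx hA1 hB1 hF hs) h1 ?_
      · rwa [hx0, hT0, hw0] at h2
      · filter_upwards [isOpen_Ioo.mem_nhds hδ0] with s hs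
        simp only [hx0, hK.apply_eq_zero]
        exact hK.le_zero _ (hover _ (hδξ _ (Ioo_subset_Icc_self hs))).1
  refine ⟨H 0, hpos 0 (h0 ▸ hcl 0 (by simpa) 0 le_rfl hε), -inner ℝ (G 0) e, ?_, fun ξ => ?_⟩
  · linarith [(key 0).1]
  · linarith [(key ξ).2]

/-- On the tangent space μA is an (m-1)-positive matrix plus a positive semidefinite one. -/
theorem IsStdGraph.dirTrace_pos_of_hasKernel (h : IsStdGraph Ω ω ρ) {m : ℕ} (hm : 1 ≤ m)
    (hk : HasKernel m Ω 0) : ∀ q < m, 0 < dirTrace q (graphHess ω 0) (graphGrad ω 0).ofLp := by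
  obtain ⟨H₀, hH₀, μ, hμ, hle⟩ := h.exists_hessian_le hm hk
  set p : E (d + 1) := graphGrad ω 0
  set A := graphHess ω 0
  have hP : 0 < ‖p‖ := norm_pos_iff.2 (graphGrad_ne_zero ω 0)
  set ν : E (d + 1) := ‖p‖⁻¹ • p
  have hν : ν.ofLp ⬝ᵥ ν.ofLp = 1 := by
    rw [dotProduct_eq_inner, real_inner_self_eq_norm_sq, norm_smul, norm_inv, norm_norm,
      inv_mul_cancel₀ hP.ne', one_pow]
  have hνp : ν.ofLp ⬝ᵥ p.ofLp = ‖p‖ := by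
    rw [dotProduct_eq_inner, real_inner_smul_left, real_inner_self_eq_norm_sq]
    field_simp
  obtain ⟨Q, hQ, hQν⟩ := exists_frame hν
  have hpν : p = ‖p‖ • ν := by rw [smul_inv_smul₀ hP.ne']
  have hQp : Qᵀ *ᵥ p.ofLp = 0 := by
    rw [hpν, WithLp.ofLp_smul, Matrix.mulVec_smul, hQν, smul_zero]
  have hAs : A.IsSymm := graphHess_isSymm h.contDiffOn (by simp [h.pos])
  have hB : IsMPositive (m - 1) (Qᵀ * H₀ * Q) := by
    refine ⟨?_, fun q hq => hH₀.pTrace_frame_pos hQ hν hQν (by omega)⟩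
    rw [Matrix.IsSymm, Matrix.transpose_mul, Matrix.transpose_mul, Matrix.transpose_transpose,
      hH₀.1, Matrix.mul_assoc]
  have hpsd : (μ • (Qᵀ * A * Q) - Qᵀ * H₀ * Q).PosSemidef := by
    have hfac : μ • (Qᵀ * A * Q) - Qᵀ * H₀ * Q = Qᵀ * (μ • A - H₀) * Q := by
      rw [Matrix.mul_sub, Matrix.sub_mul, Matrix.mul_smul, Matrix.smul_mul]
    rw [hfac]
    refine Matrix.PosSemidef.of_dotProduct_mulVec_nonneg ?_ fun u => ?_
    · rw [Matrix.IsHermitian, Matrix.conjTranspose_eq_transpose_of_trivial, Matrix.transpose_mul,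
        Matrix.transpose_mul, Matrix.transpose_transpose, Matrix.transpose_sub,
        Matrix.transpose_smul, hAs, hH₀.1, Matrix.mul_assoc]
    · set v : E (d + 1) := WithLp.toLp 2 (Q *ᵥ u)
      have hvp : inner ℝ p v = 0 := by
        rw [← dotProduct_eq_inner]
        change p.ofLp ⬝ᵥ Q *ᵥ u = 0
        rw [Matrix.dotProduct_mulVec, ← Matrix.mulVec_transpose, hQp, zero_dotProduct]
      rw [inner_graphGrad] at hvp
      -- Vectors orthogonal to p = (-∇ω(0), 1) are the tangent vectors of the graph.
      have hvT : v = graphTangent ω (tilde v) 0 :=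
        ext_tilde (by simp [graphTangent]) (by simp [graphTangent]; linarith)
      have h1 := hle (tilde v)
      rw [← hvT, Matrix.inner_toEuclideanCLM, ← graphForm_apply, ← dotProduct_bilinMatrix_mulVec]
        at h1
      have h2 : star u ⬝ᵥ (Qᵀ * (μ • A - H₀) * Q) *ᵥ u
          = μ * (v.ofLp ⬝ᵥ A *ᵥ v.ofLp) - v.ofLp ⬝ᵥ H₀ *ᵥ v.ofLp := by
        rw [star_trivial, ← Matrix.mulVec_mulVec, ← Matrix.mulVec_mulVec, Matrix.dotProduct_mulVec,
          Matrix.vecMul_transpose, Matrix.sub_mulVec, Matrix.smul_mulVec, dotProduct_sub,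
          dotProduct_smul, smul_eq_mul]
      rw [h2]
      exact sub_nonneg.2 h1
  have hsum := hB.add_posSemidef hpsd
  rw [add_sub_cancel] at hsum
  intro q hq
  have h1 := hsum.2 q (by omega)
  rw [pTrace_smul] at h1
  -- Only μ ≥ 0 is known, but μ^q T_q(QᵀAQ) > 0 already forces the trace to be positive, so no
  -- strict boundary-point lemma is needed.
  have h2 : 0 < pTrace q (Qᵀ * A * Q) := by
    by_contra! hneg
    exact h1.not_ge (mul_nonpos_of_nonneg_of_nonpos (pow_nonneg hμ q) hneg)
  rw [dirTrace_eq_of_frame hQ hν hQν hQp, hνp]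
  exact mul_pos (pow_pos hP 2) h2

end Necessity

/-! ### Return to arbitrary Cartesian coordinates -/

section LocalGraph

variable {d : ℕ} {Ω : Set (E (d + 1))} {M₀ : E (d + 1)} {Φ : E (d + 1) ≃ᵃⁱ[ℝ] E (d + 1)}
  {ω : E d → ℝ} {ρ : ℝ}

theorem IsLocalGraph.isStdGraph (h : IsLocalGraph Ω M₀ Φ ω ρ) (hΩ : IsOpen Ω) :
    IsStdGraph (Φ.symm ⁻¹' Ω) ω ρ := by
  refine ⟨hΩ.preimage Φ.symm.continuous, h.pos, h.zero, h.contDiffOn, fun x hx hx' => ?_⟩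
  have := h.mem_iff (Φ.symm x) (by rwa [Φ.apply_symm_apply]) (by rwa [Φ.apply_symm_apply])
  rw [Φ.apply_symm_apply] at this
  rw [mem_preimage, this, height, sub_pos]

theorem preimage_preimage_symm (Φ : E (d + 1) ≃ᵃⁱ[ℝ] E (d + 1)) (Ω : Set (E (d + 1))) :
    Φ ⁻¹' (Φ.symm ⁻¹' Ω) = Ω := by
  ext x
  rw [mem_preimage, mem_preimage, Φ.symm_apply_apply]

theorem IsLocalGraph.symm_zero (h : IsLocalGraph Ω M₀ Φ ω ρ) : Φ.symm 0 = M₀ := by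
  rw [← h.origin, Φ.symm_apply_apply]

theorem IsLocalGraph.isBoundaryConvexAt_iff (h : IsLocalGraph Ω M₀ Φ ω ρ) (hΩ : IsOpen Ω)
    (k : ℕ) : IsBoundaryConvexAt k Ω M₀ ↔
      ∀ q ≤ k, 0 < dirTrace q (graphHess ω 0) (graphGrad ω 0).ofLp := by
  rw [← (h.isStdGraph hΩ).isBoundaryConvexAt_iff k]
  constructor <;> intro hc
  · rw [← h.symm_zero] at hc
    exact hc.comp_affineIsometryEquiv Φ.symm
  · rw [← h.origin] at hc
    have := hc.comp_affineIsometryEquiv Φ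
    rwa [preimage_preimage_symm] at this

theorem IsLocalGraph.isKernel (h : IsLocalGraph Ω M₀ Φ ω ρ) {m : ℕ} {V D : Set (E (d + 1))}
    {W : E (d + 1) → ℝ} (hK : IsKernel m (Φ.symm ⁻¹' Ω) 0 V D W) :
    IsKernel m Ω M₀ (Φ ⁻¹' V) (Φ ⁻¹' D) (W ∘ Φ) := by
  rw [← h.origin] at hK
  have := hK.comp_affineIsometryEquiv Φ
  rwa [preimage_preimage_symm] at this

theorem IsLocalGraph.exists_isKernel_closedBall (h : IsLocalGraph Ω M₀ Φ ω ρ) (hΩ : IsOpen Ω)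
    {m : ℕ} (hpos : ∀ q < m, 0 < dirTrace q (graphHess ω 0) (graphGrad ω 0).ofLp) :
    ∃ r₀ : ℝ, 0 < r₀ ∧ ∀ r : ℝ, 0 < r → r ≤ r₀ → ∃ (D : Set (E (d + 1))) (W : E (d + 1) → ℝ),
      IsKernel m Ω M₀ (closedBall M₀ r) D W := by
  obtain ⟨r₀, hr₀, hker⟩ := (h.isStdGraph hΩ).exists_isKernel_ball hpos
  refine ⟨r₀, hr₀, fun r hr hrr => ?_⟩
  obtain ⟨D, W, hK⟩ := hker r hr hrr
  have hball : Φ ⁻¹' closedBall 0 r = closedBall M₀ r := by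
    rw [← h.origin]
    exact Φ.isometry.preimage_closedBall M₀ r
  exact ⟨Φ ⁻¹' D, W ∘ Φ, hball ▸ h.isKernel hK⟩

theorem IsLocalGraph.exists_isKernel_subdomain (h : IsLocalGraph Ω M₀ Φ ω ρ) (hΩ : IsOpen Ω)
    {m : ℕ} (hpos : ∀ q < m, 0 < dirTrace q (graphHess ω 0) (graphGrad ω 0).ofLp) :
    ∃ r₀ : ℝ, 0 < r₀ ∧ ∃ β₁ : ℝ, 0 < β₁ ∧ ∀ r : ℝ, 0 < r → r ≤ r₀ → ∀ β : ℝ, 0 < β → β ≤ β₁ →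
      IsKernel m Ω M₀ (cylinder Φ r ρ) (subdomain Ω Φ ω r β)
        (fun x => 8 / 3 * wBeta Φ ω r β x) := by
  obtain ⟨r₀, hr₀, β₁, hβ₁, hker⟩ := (h.isStdGraph hΩ).exists_isKernel_lens hpos
  refine ⟨r₀, hr₀, β₁, hβ₁, fun r hr hrr β hβ hββ => ?_⟩
  have hD : Φ ⁻¹' lensDomain (Φ.symm ⁻¹' Ω) ω r β = subdomain Ω Φ ω r β := by
    ext x
    simp only [lensDomain, subdomain, mem_preimage, mem_ofPred_eq, Φ.symm_apply_apply, yFun, height]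
  exact hD ▸ h.isKernel (hker r hr hrr β hβ hββ)

theorem IsLocalGraph.dirTrace_pos_of_hasKernel (h : IsLocalGraph Ω M₀ Φ ω ρ) (hΩ : IsOpen Ω)
    {m : ℕ} (hm : 1 ≤ m) (hk : HasKernel m Ω M₀) :
    ∀ q < m, 0 < dirTrace q (graphHess ω 0) (graphGrad ω 0).ofLp := by
  rw [← h.symm_zero] at hk
  exact (h.isStdGraph hΩ).dirTrace_pos_of_hasKernel hm (hk.comp_affineIsometryEquiv Φ.symm)

end LocalGraph

end HessianKernel

theorem theorem6p11 (d m : ℕ) (hd : 1 ≤ d) (hm : 1 ≤ m) (hmd : m ≤ d + 1)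
    (Ω : Set (E (d + 1))) (hΩ : IsOpen Ω) (hΩc : IsConnected Ω)
    (M₀ : E (d + 1)) (hM₀ : M₀ ∈ frontier Ω) (hC2 : IsC2BoundaryNear Ω M₀) :
    -- existence of kernels in subdomains attached to arbitrarily small boundary pieces
    (IsBoundaryConvexAt (m - 1) Ω M₀ →
      ∃ r₀ : ℝ, 0 < r₀ ∧ ∀ r : ℝ, 0 < r → r ≤ r₀ →
        ∃ (D : Set (E (d + 1))) (W : E (d + 1) → ℝ),
          IsKernel m Ω M₀ (Metric.closedBall M₀ r) D W) ∧
    -- the explicit kernel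
    (IsBoundaryConvexAt (m - 1) Ω M₀ →
      ∀ (Φ : E (d + 1) ≃ᵃⁱ[ℝ] E (d + 1)) (ω : E d → ℝ) (ρ : ℝ), IsLocalGraph Ω M₀ Φ ω ρ →
        ∃ r₀ : ℝ, 0 < r₀ ∧ ∃ β₁ : ℝ, 0 < β₁ ∧
          ∀ r : ℝ, 0 < r → r ≤ r₀ → ∀ β : ℝ, 0 < β → β ≤ β₁ →
            IsKernel m Ω M₀ (cylinder Φ r ρ) (subdomain Ω Φ ω r β)
              (fun x => 8 / 3 * wBeta Φ ω r β x)) ∧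
    -- the equivalence
    (HasKernel m Ω M₀ ↔ IsBoundaryConvexAt (m - 1) Ω M₀) := by
  obtain ⟨Φ, ω, ρ, hgraph⟩ := hC2
  have hball : IsBoundaryConvexAt (m - 1) Ω M₀ → ∃ r₀ : ℝ, 0 < r₀ ∧ ∀ r : ℝ, 0 < r → r ≤ r₀ →
      ∃ (D : Set (E (d + 1))) (W : E (d + 1) → ℝ),
        IsKernel m Ω M₀ (Metric.closedBall M₀ r) D W := fun hconv =>
    hgraph.exists_isKernel_closedBall hΩ fun q hq =>
      (hgraph.isBoundaryConvexAt_iff hΩ (m - 1)).1 hconv q (by omega)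
  -- The explicit kernel must work in every graph representation, so the trace criterion is reread
  -- in the given coordinates Ψ rather than in the fixed Φ.
  refine ⟨hball, fun hconv Ψ ψ σ hΨ => ?_, fun hk => ?_, fun hconv => ?_⟩
  · exact hΨ.exists_isKernel_subdomain hΩ fun q hq =>
      (hΨ.isBoundaryConvexAt_iff hΩ (m - 1)).1 hconv q (by omega)
  · exact (hgraph.isBoundaryConvexAt_iff hΩ (m - 1)).2 fun q hq =>
      hgraph.dirTrace_pos_of_hasKernel hΩ hm hk q (by omega)
  · obtain ⟨r₀, hr₀, hker⟩ := hball hconv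
    obtain ⟨D, W, hK⟩ := hker r₀ hr₀ le_rfl
    exact ⟨Metric.closedBall M₀ r₀, Metric.closedBall_mem_nhds M₀ hr₀, Metric.isBounded_closedBall,
      D, W, hK⟩
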